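/- Let $X$ be a Cantor space (a space homeomorphic to $\{0,1\}^{\mathbb N}$), and let $G$ be a countable group acting faithfully on $X$ by homeomorphisms. Assume that the fixed-point set $\operatorname{Fix}(g)=\{x\in X: g(x)=x\}$ is clopen for every $g\in G$. Let $Y$ be a non-empty closed subset of $X$ that meets every $G$-orbit in at most one point and satisfies the following conditions. (a) The family of translates $\mathcal Y=\{q(Y): q\in G\}$ is everywhere dense in $X$: for every non-empty clopen set $U\subset X$ there is $q\in G$ with $q(Y)\subset U$. (b) For every $n\ge 1$, $G$ acts $n$-transitively on disjoint families in $\mathcal Y$: whenever $L\subset\mathcal Y$ is a family of pairwise disjoint sets, $Y_1,\dots,Y_n$ are distinct members of $L$, and $Y_1',\dots,Y_n'$ are distinct members of $L$, there is $g\in G$ with $g(Y_i)=Y_i'$ for all $i=1,\dots,n$. Let $(h_n)$ be a sequence of elements of $G$ such that (c) $h_n(y)=y$ for all $y\in Y$ and all $n$; (d) for every clopen set $U\supset Y$ there is $N$ such that $\operatorname{supp}(h_n)=\{x\in X: h_n(x)\ne x\}\subset U$ for all $n\ge N$. Let $\pi$ be a unitary representation of $G$ on a separable complex Hilbert space $\mathcal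 H$, and let $\mathcal M_\pi=\pi(G)''$ be the von Neumann algebra it generates. Suppose that - $\pi$ is of finite type: every $v\in\mathcal M_\pi$ with $v^*v=\mathrm{Id}$ satisfies $vv^*=\mathrm{Id}$; - $\pi$ is a factor representation: $\mathcal M_\pi\cap\mathcal M_\pi'=\mathbb C\,\mathrm{Id}$; - $\pi$ is non-regular: it is not quasi-equivalent to the left-regular representation $\lambda$ of $G$ on $\ell^2(G)$, that is, there is no $*$-isomorphism $\varphi:\mathcal M_\pi\to\mathcal M_\lambda$ with $\varphi(\pi(g))=\lambda(g)$ for all $g\in G$. Then every limit point of the sequence $(\pi(h_n))$ in the weak operator topology is a scalar operator $c\,\mathrm{Id}$, $c\in\mathbb C$. -/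

import Mathlib

open Filter Topology
open scoped Pointwise ENNReal

/-- A Cantor space: a topological space homeomorphic to `{0,1}^ℕ`. -/
def IsCantorSpace (X : Type*) [TopologicalSpace X] : Prop :=
  Nonempty (X ≃ₜ (ℕ → Bool))

section Dynamics

variable {G X : Type*} [Group G] [MulAction G X]

/-- The support `{x | g x ≠ x}` of a group element acting on `X`. -/
def actionSupport (X : Type*) [MulAction G X] (g : G) : Set X := {x | g • x ≠ x}

/-- The family `{q(Y) : q ∈ G}` of translates of `Y`. -/
def translates (G : Type*) {X : Type*} [Group G] [MulAction G X] (Y : Set X) : Set (Set X) :=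
  Set.range fun q : G => q • Y

/-- The translates of `Y` are everywhere dense: every nonempty clopen set contains one of them. -/
def DenseTranslates (G : Type*) {X : Type*} [Group G] [MulAction G X] [TopologicalSpace X]
    (Y : Set X) : Prop :=
  ∀ U : Set X, IsClopen U → U.Nonempty → ∃ q : G, q • Y ⊆ U

/-- For a given `n`, the action of `G` on disjoint translates of `Y` is `n`-transitive: whenever
`L` is a family of pairwise disjoint translates of `Y`, and `Z 1, …, Z n` as well as
`Z' 1, …, Z' n` are distinct members of `L`, some `g ∈ G` maps each `Z i` onto `Z' i`. -/
def TransitiveOnDisjointTranslates (G : Type*) {X : Type*} [Group G] [MulAction G X]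
    (Y : Set X) (n : ℕ) : Prop :=
  ∀ L : Set (Set X), L ⊆ translates G Y → L.PairwiseDisjoint id →
    ∀ Z Z' : Fin n → Set X, Function.Injective Z → Function.Injective Z' →
      (∀ i, Z i ∈ L) → (∀ i, Z' i ∈ L) → ∃ g : G, ∀ i, g • Z i = Z' i

end Dynamics

section Representations

/-- A unitary representation of a group on a complex Hilbert space. -/
abbrev UnitaryRep (G H : Type*) [Group G] [NormedAddCommGroup H] [InnerProductSpace ℂ H]
    [CompleteSpace H] :=
  G →* unitary (H →L[ℂ] H)

variable {G H : Type*} [Group G] [NormedAddCommGroup H] [InnerProductSpace ℂ H] [CompleteSpace H]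

/-- The set of operators `π(G) ⊆ B(H)`. -/
def UnitaryRep.operators (π : UnitaryRep G H) : Set (H →L[ℂ] H) :=
  Set.range fun g => (π g : H →L[ℂ] H)

theorem UnitaryRep.star_operators (π : UnitaryRep G H) : star π.operators = π.operators := by
  have key : ∀ a ∈ π.operators, star a ∈ π.operators := by
    rintro _ ⟨g, rfl⟩
    exact ⟨g⁻¹, by simp [map_inv, ← Unitary.star_eq_inv]⟩
  ext a
  refine ⟨fun ha => ?_, fun ha => key a ha⟩
  simpa using key _ ha

/-- The von Neumann algebra `π(G)''` generated by a unitary representation. -/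
noncomputable def UnitaryRep.vonNeumann (π : UnitaryRep G H) : VonNeumannAlgebra H where
  toStarSubalgebra :=
    StarSubalgebra.centralizer ℂ (StarSubalgebra.centralizer ℂ π.operators : Set (H →L[ℂ] H))
  centralizer_centralizer' := by
    change Set.centralizer (Set.centralizer
      (StarSubalgebra.centralizer ℂ
        (StarSubalgebra.centralizer ℂ π.operators : Set (H →L[ℂ] H)) : Set (H →L[ℂ] H))) =
      (StarSubalgebra.centralizer ℂ
        (StarSubalgebra.centralizer ℂ π.operators : Set (H →L[ℂ] H)) : Set (H →L[ℂ] H))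
    rw [StarSubalgebra.coe_centralizer_centralizer, Set.centralizer_centralizer_centralizer]

/-- The carrier of the generated von Neumann algebra is the bicommutant of `π(G)`. -/
theorem UnitaryRep.coe_vonNeumann (π : UnitaryRep G H) :
    (π.vonNeumann : Set (H →L[ℂ] H)) = Set.centralizer (Set.centralizer π.operators) := by
  change (StarSubalgebra.centralizer ℂ
    (StarSubalgebra.centralizer ℂ π.operators : Set (H →L[ℂ] H)) : Set (H →L[ℂ] H)) = _
  rw [StarSubalgebra.coe_centralizer_centralizer, π.star_operators, Set.union_self]

theorem UnitaryRep.mem_vonNeumann (π : UnitaryRep G H) (g : G) :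
    (π g : H →L[ℂ] H) ∈ π.vonNeumann.toStarSubalgebra := by
  rw [VonNeumannAlgebra.mem_carrier, π.coe_vonNeumann]
  exact Set.subset_centralizer_centralizer ⟨g, rfl⟩

/-- A von Neumann algebra is finite if each of its isometries is unitary. -/
def VonNeumannAlgebra.IsFinite (M : VonNeumannAlgebra H) : Prop :=
  ∀ v ∈ M, star v * v = 1 → v * star v = 1

/-- A von Neumann algebra is a factor if `M ∩ M' = ℂ Id`. -/
def VonNeumannAlgebra.IsFactor (M : VonNeumannAlgebra H) : Prop :=
  (M : Set (H →L[ℂ] H)) ∩ (M.commutant : Set (H →L[ℂ] H)) =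
    Set.range fun c : ℂ => c • (1 : H →L[ℂ] H)

/-- A representation of finite type. -/
def UnitaryRep.IsFiniteType (π : UnitaryRep G H) : Prop := π.vonNeumann.IsFinite

/-- A factor representation. -/
def UnitaryRep.IsFactorRep (π : UnitaryRep G H) : Prop := π.vonNeumann.IsFactor

/-- Quasi-equivalence of unitary representations: a `*`-isomorphism of the generated von Neumann
algebras that carries `π₁ g` to `π₂ g` for all `g`. -/
def UnitaryRep.QuasiEquivalent {H₁ H₂ : Type*}
    [NormedAddCommGroup H₁] [InnerProductSpace ℂ H₁] [CompleteSpace H₁]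
    [NormedAddCommGroup H₂] [InnerProductSpace ℂ H₂] [CompleteSpace H₂]
    (π₁ : UnitaryRep G H₁) (π₂ : UnitaryRep G H₂) : Prop :=
  ∃ φ : π₁.vonNeumann.toStarSubalgebra ≃⋆ₐ[ℂ] π₂.vonNeumann.toStarSubalgebra,
    ∀ g : G, φ ⟨(π₁ g : H₁ →L[ℂ] H₁), π₁.mem_vonNeumann g⟩ =
      ⟨(π₂ g : H₂ →L[ℂ] H₂), π₂.mem_vonNeumann g⟩

end Representations

section Regular

variable (G : Type*) [Group G]

/-- The Hilbert space `ℓ²(G)`. -/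
abbrev EllTwo : Type _ := lp (fun _ : G => ℂ) 2

variable {G}

theorem memℓp_leftTranslate (g : G) (f : EllTwo G) :
    Memℓp (fun h : G => (f : G → ℂ) (g⁻¹ * h)) 2 := by
  have h2 : 0 < (2 : ℝ≥0∞).toReal := by norm_num
  have hf := (memℓp_gen_iff h2).1 (lp.memℓp f)
  exact (memℓp_gen_iff h2).2 ((Equiv.mulLeft g⁻¹).summable_iff.2 hf)

/-- Left translation `(λ(g) f)(h) = f (g⁻¹ h)` on `ℓ²(G)`, as a linear isometry. -/
noncomputable def leftTranslate (g : G) : EllTwo G →ₗᵢ[ℂ] EllTwo G where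
  toFun f := ⟨fun h : G => (f : G → ℂ) (g⁻¹ * h), memℓp_leftTranslate g f⟩
  map_add' _ _ := rfl
  map_smul' _ _ := rfl
  norm_map' f := by
    have h2 : 0 < (2 : ℝ≥0∞).toReal := by norm_num
    rw [lp.norm_eq_tsum_rpow h2, lp.norm_eq_tsum_rpow h2]
    congr 1
    exact (Equiv.mulLeft g⁻¹).tsum_eq fun h => ‖(f : G → ℂ) h‖ ^ (2 : ℝ≥0∞).toReal

theorem leftTranslate_apply (g : G) (f : EllTwo G) (h : G) :
    (leftTranslate g f : G → ℂ) h = (f : G → ℂ) (g⁻¹ * h) := rfl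

theorem leftTranslate_mul (g₁ g₂ : G) (f : EllTwo G) :
    leftTranslate (g₁ * g₂) f = leftTranslate g₁ (leftTranslate g₂ f) := by
  ext h
  simp only [leftTranslate_apply, mul_inv_rev, mul_assoc]

theorem leftTranslate_one (f : EllTwo G) : leftTranslate (1 : G) f = f := by
  ext h
  simp only [leftTranslate_apply, inv_one, one_mul]

/-- Left translation on `ℓ²(G)` as a surjective linear isometry. -/
noncomputable def leftTranslateEquiv (g : G) : EllTwo G ≃ₗᵢ[ℂ] EllTwo G :=
  LinearIsometryEquiv.ofSurjective (leftTranslate g) fun f =>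
    ⟨leftTranslate g⁻¹ f, by rw [← leftTranslate_mul, mul_inv_cancel, leftTranslate_one]⟩

/-- The left-regular representation `(λ(g) f)(h) = f (g⁻¹ h)` of `G` on `ℓ²(G)`. -/
noncomputable def leftRegularRep (G : Type*) [Group G] : UnitaryRep G (EllTwo G) where
  toFun g := Unitary.linearIsometryEquiv.symm (leftTranslateEquiv g)
  map_one' := by
    rw [← map_one Unitary.linearIsometryEquiv.symm]
    congr 1
    ext1 f
    exact leftTranslate_one f
  map_mul' g₁ g₂ := by
    rw [← map_mul]
    congr 1
    ext1 f
    exact leftTranslate_mul g₁ g₂ f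

theorem leftRegularRep_apply (g : G) (f : EllTwo G) (h : G) :
    (((leftRegularRep G g : EllTwo G →L[ℂ] EllTwo G) f : EllTwo G) : G → ℂ) h =
      (f : G → ℂ) (g⁻¹ * h) := rfl

/-- A representation is regular if it is quasi-equivalent to the left-regular representation. -/
def UnitaryRep.IsRegular {H : Type*} [NormedAddCommGroup H] [InnerProductSpace ℂ H]
    [CompleteSpace H] (π : UnitaryRep G H) : Prop :=
  π.QuasiEquivalent (leftRegularRep G)

end Regular

/-! The proof combines a trace on the factor $M=\pi(G)''$ with the fact that operators attached to
disjoint translates of $Y$ are exchangeable.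

Trace. A finite factor carries a faithful trace $\tau$ dominated by finitely many vector states,
hence weakly continuous on $M$ (`IsFinite.exists_trace`, `IsTrace.eq_zero`, `IsTrace.tendsto`). It
is built from partial isometries: exhaustion arguments give vector states that are tracial up to a
factor $1+\varepsilon$, and an ultralimit makes them exactly tracial. Normality survives the limit
because any two states tracial up to a factor $2$ are comparable up to a factor $8$. Throughout,
$\|x\xi\|^2$ plays the role of the value of a vector state at $x^*x$.

Non-regularity. If $\tau(\pi(g))=0$ for all $g\ne1$, then $\sum c_g\pi(g)$ has trace norm equal to
the $\ell^2$-norm of $c$, and $\delta_g\mapsto\pi(g)\eta_i$ extends to intertwiners from $\ell^2(G)$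
which are rich enough to give quasi-equivalence with $\lambda$ (`isRegular_of_trace`). So some
$g\neq 1$ has $\tau(\pi(g))\ne0$.

Limit points. If $s$ fixes $Y$ pointwise, then $\operatorname{Fix}(s)$ is a clopen neighbourhood of
$Y$, so it contains $\operatorname{supp}(h_n)$ eventually and $s$ commutes with $h_n$. A weak limit
$a$ of $\pi(h_n)$ thus commutes with every such $\pi(s)$. For an operator of this kind
$\pi(q)a\pi(q)^*$ depends only on $q(Y)$ (`conj_eq_conj`), and by transitivity the traces of
products of such conjugates along disjoint translates do not depend on which translates are used.

Conclusion. Conjugates of such an operator $b$ along disjoint translates $z_i(Y)$ inside a proper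
clopen set converge weakly to $\tau(b)\,\mathrm{Id}$ (`tendstoWeakly_conj_scalar`). Put
$t=a-\tau(a)\mathrm{Id}$, write $q.t$ for the conjugate by $\pi(q)$, and take the $z_i(Y)$ in a
clopen $U$ disjoint from $gU$. The products $(z_i.t)^*(gz_i.t)$ are pairwise orthogonal for $\tau$,
so they tend weakly to $0$. Since $(gz_i.t)\pi(g)=\pi(g)(z_i.t)$, traciality gives
$\tau(\pi(g)\,z_i.(tt^*))=\tau(\pi(g)(z_i.t)^*(gz_i.t))$. In the limit $\tau(\pi(g))\tau(tt^*)=0$,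
hence $t=0$ (`eq_smul_one_of_mem_stabilized`). -/

section OperatorPreliminaries

/-! ### Moduli, partial isometries and projections -/

open ContinuousLinearMap

variable {H : Type*} [NormedAddCommGroup H] [InnerProductSpace ℂ H] [CompleteSpace H]

/-- Operators with the same norm on every vector have the same modulus squared. -/
theorem star_mul_self_eq_of_norm_apply_eq {x y : H →L[ℂ] H} (h : ∀ ξ, ‖x ξ‖ = ‖y ξ‖) :
    star x * x = star y * y := by
  have key : ((star x * x : H →L[ℂ] H) : H →ₗ[ℂ] H) = ((star y * y : H →L[ℂ] H) : H →ₗ[ℂ] H) := by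
    rw [← ext_inner_map]
    intro ξ
    have e : ∀ z : H →L[ℂ] H, inner ℂ ((star z * z) ξ) ξ = (‖z ξ‖ : ℂ) ^ 2 := fun z => by
      rw [mul_apply_eq_comp, star_eq_adjoint, adjoint_inner_left,
        inner_self_eq_norm_sq_to_K]
      rfl
    simpa using (e x).trans ((congrArg (fun r : ℝ => (r : ℂ) ^ 2) (h ξ)).trans (e y).symm)
  ext ξ
  exact LinearMap.congr_fun key ξ

theorem norm_apply_sq_of_star_mul_self (x : H →L[ℂ] H) (ξ : H) :
    ‖x ξ‖ ^ 2 = (inner ℂ ((star x * x) ξ) ξ).re := by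
  rw [mul_apply_eq_comp, star_eq_adjoint, adjoint_inner_left,
    inner_self_eq_norm_sq_to_K]
  norm_cast

theorem norm_apply_eq_of_star_mul_self_eq {x y : H →L[ℂ] H} (h : star x * x = star y * y) (ξ : H) :
    ‖x ξ‖ = ‖y ξ‖ := by
  have := norm_apply_sq_of_star_mul_self x ξ
  rw [h, ← norm_apply_sq_of_star_mul_self] at this
  exact (sq_eq_sq₀ (norm_nonneg _) (norm_nonneg _)).1 this

theorem norm_abs_apply (x : H →L[ℂ] H) (ξ : H) : ‖CFC.abs x ξ‖ = ‖x ξ‖ := by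
  refine norm_apply_eq_of_star_mul_self_eq ?_ ξ
  rw [(CFC.abs_nonneg x).isSelfAdjoint.star_eq, CFC.abs_mul_abs]

/-- A partial isometry: `u u* u = u`. -/
def IsPartialIsometry (u : H →L[ℂ] H) : Prop := u * star u * u = u

namespace IsPartialIsometry

variable {u v : H →L[ℂ] H}

theorem star (hu : IsPartialIsometry u) : IsPartialIsometry (star u) := by
  unfold IsPartialIsometry at *
  have := congrArg Star.star hu
  simpa [mul_assoc] using this

theorem mul_star_mul (hu : IsPartialIsometry u) : u * (Star.star u * u) = u := by
  rw [← mul_assoc]; exact hu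

theorem star_mul_mul_star (hu : IsPartialIsometry u) : Star.star u * (u * Star.star u) =
    Star.star u := by
  simpa using hu.star.mul_star_mul

theorem initial (hu : IsPartialIsometry u) : IsStarProjection (Star.star u * u) where
  isIdempotentElem := by
    unfold IsIdempotentElem; rw [mul_assoc, hu.mul_star_mul]
  isSelfAdjoint := IsSelfAdjoint.star_mul_self u

theorem final (hu : IsPartialIsometry u) : IsStarProjection (u * Star.star u) := by
  simpa using hu.star.initial

end IsPartialIsometry

theorem isPartialIsometry_of_initial {u : H →L[ℂ] H} (h : IsStarProjection (star u * u)) :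
    IsPartialIsometry u := by
  have h1 : star (u - u * (star u * u)) * (u - u * (star u * u)) = 0 := by
    have h2 := h.isIdempotentElem.eq
    set e := star u * u with he
    have hs : star e = e := h.isSelfAdjoint
    calc star (u - u * e) * (u - u * e) = star u * u - star u * u * e - e * (star u * u) +
          e * (star u * u) * e := by
          rw [star_sub, star_mul, hs]; noncomm_ring
      _ = 0 := by rw [← he, h2, h2]; simp
  have h2 : u - u * (star u * u) = 0 := CStarRing.star_mul_self_eq_zero_iff _ |>.1 h1
  unfold IsPartialIsometry
  rw [mul_assoc, ← sub_eq_zero.1 h2]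

theorem IsStarProjection.norm_apply_sq {e : H →L[ℂ] H} (h : IsStarProjection e) (ξ : H) :
    ‖e ξ‖ ^ 2 = (inner ℂ (e ξ) ξ).re := by
  rw [norm_apply_sq_of_star_mul_self, h.isSelfAdjoint.star_eq, h.isIdempotentElem.eq]

end OperatorPreliminaries

/-! ### Range projections and polar decomposition inside a von Neumann algebra -/

namespace VonNeumannAlgebra

open ContinuousLinearMap

variable {H : Type*} [NormedAddCommGroup H] [InnerProductSpace ℂ H] [CompleteSpace H]
  {M : VonNeumannAlgebra H}

theorem smul_mem {x : H →L[ℂ] H} (c : ℂ) (hx : x ∈ M) : c • x ∈ M :=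
  M.toStarSubalgebra.smul_mem hx c

theorem real_smul_mem {x : H →L[ℂ] H} (c : ℝ) (hx : x ∈ M) : c • x ∈ M := by
  have : c • x = (c : ℂ) • x := by ext; simp
  rw [this]; exact smul_mem _ hx

theorem mem_of_commute {x : H →L[ℂ] H} (h : ∀ y ∈ M.commutant, y * x = x * y) : x ∈ M := by
  rw [← M.commutant_commutant, mem_commutant_iff]
  exact h

theorem mul_eq_of_mem_commutant {x y : H →L[ℂ] H} (hx : x ∈ M) (hy : y ∈ M.commutant) :
    x * y = y * x := mem_commutant_iff.1 hy x hx

theorem apply_of_mem_commutant {x y : H →L[ℂ] H} (hx : x ∈ M) (hy : y ∈ M.commutant) (ξ : H) :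
    x (y ξ) = y (x ξ) := congrArg (fun z : H →L[ℂ] H => z ξ) (mul_eq_of_mem_commutant hx hy)

theorem abs_mem {x : H →L[ℂ] H} (hx : x ∈ M) : CFC.abs x ∈ M := by
  refine mem_of_commute fun y hy => ?_
  have h1 : Commute x y := mul_eq_of_mem_commutant hx hy
  have h2 : Commute x (star y) := mul_eq_of_mem_commutant hx (star_mem hy)
  exact (h1.cfcAbs_left h2).symm

theorem posPart_mem {x : H →L[ℂ] H} (hx : x ∈ M) (hs : IsSelfAdjoint x) : x⁺ ∈ M := by
  have h := CFC.abs_add_self x hs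
  have h2 : x⁺ = (2⁻¹ : ℝ) • (CFC.abs x + x) := by
    rw [h, ← Nat.cast_smul_eq_nsmul ℝ, smul_smul]; norm_num
  rw [h2]
  exact real_smul_mem _ (add_mem (abs_mem hx) hx)

theorem starProjection_mem {K : Submodule ℂ H} [K.HasOrthogonalProjection]
    (hK : ∀ y ∈ M.commutant, ∀ ξ ∈ K, y ξ ∈ K) : K.starProjection ∈ M := by
  rw [IsStarProjection.mem_iff isStarProjection_starProjection]
  intro y hy
  rw [Module.End.mem_invtSubmodule]
  intro ξ hξ
  have hξ' : ξ ∈ K := by simpa using hξ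
  have := hK y hy ξ hξ'
  simpa using this

/-- The range projection of an element of a von Neumann algebra lies in the algebra. -/
theorem exists_rangeProjection {x : H →L[ℂ] H} (hx : x ∈ M) :
    ∃ e ∈ M, IsStarProjection e ∧ e * x = x ∧ ∀ z : H →L[ℂ] H, z * x = 0 → z * e = 0 := by
  let K : Submodule ℂ H := (LinearMap.range (x : H →ₗ[ℂ] H)).topologicalClosure
  have : CompleteSpace K := (Submodule.isClosed_topologicalClosure _).completeSpace_coe
  have hmem : ∀ ξ, x ξ ∈ K := fun ξ => Submodule.le_topologicalClosure _ ⟨ξ, rfl⟩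
  have hind : ∀ z : H →L[ℂ] H, ∀ L : Submodule ℂ H, IsClosed (L : Set H) → (∀ ξ, z (x ξ) ∈ L) →
      ∀ ξ ∈ K, z ξ ∈ L := by
    intro z L hL h ξ hξ
    have : K ≤ L.comap (z : H →ₗ[ℂ] H) := by
      apply Submodule.topologicalClosure_minimal
      · rintro _ ⟨ξ, rfl⟩; exact h ξ
      · exact hL.preimage z.continuous
    exact this hξ
  refine ⟨K.starProjection, starProjection_mem fun y hy => ?_, isStarProjection_starProjection,
    ?_, fun z hz => ?_⟩
  · refine hind y K (Submodule.isClosed_topologicalClosure _) fun ξ => ?_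
    rw [← apply_of_mem_commutant hx hy]
    exact hmem _
  · ext ξ
    exact Submodule.starProjection_eq_self_iff.2 (hmem ξ)
  · ext ξ
    have := hind z ⊥ (by simp) (fun ξ => by
      simpa using congrArg (fun w : H →L[ℂ] H => w ξ) hz) (K.starProjection ξ)
        (K.starProjection_apply_mem ξ)
    simpa using this

/-- Polar decomposition in a von Neumann algebra. -/
theorem exists_polar {x : H →L[ℂ] H} (hx : x ∈ M) :
    ∃ u ∈ M, IsPartialIsometry u ∧ u * CFC.abs x = x ∧ star u * u * CFC.abs x = CFC.abs x ∧
      (∀ z : H →L[ℂ] H, z * x = 0 → z * u = 0) ∧ ∀ z : H →L[ℂ] H, x * z = 0 → u * z = 0 := by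
  let a := CFC.abs x
  have ha : a ∈ M := abs_mem hx
  have has : star a = a := (CFC.abs_nonneg x).isSelfAdjoint
  let K : Submodule ℂ H := (LinearMap.range (a : H →ₗ[ℂ] H)).topologicalClosure
  have : CompleteSpace K := (Submodule.isClosed_topologicalClosure _).completeSpace_coe
  have hmem : ∀ ξ, a ξ ∈ K := fun ξ => Submodule.le_topologicalClosure _ ⟨ξ, rfl⟩
  let e : H →ₗ[ℂ] K := (a : H →ₗ[ℂ] H).codRestrict K hmem
  have he : DenseRange e := by
    intro k
    rw [Metric.mem_closure_iff]
    intro ε hε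
    have hk : (k : H) ∈ closure ((LinearMap.range (a : H →ₗ[ℂ] H) : Submodule ℂ H) : Set H) := by
      rw [← Submodule.topologicalClosure_coe]; exact k.2
    obtain ⟨_, ⟨ξ, rfl⟩, hξ⟩ := Metric.mem_closure_iff.1 hk ε hε
    exact ⟨e ξ, ⟨ξ, rfl⟩, hξ⟩
  have hb : ∀ ξ, ‖(x : H →ₗ[ℂ] H) ξ‖ ≤ 1 * ‖e ξ‖ := fun ξ => by
    rw [one_mul]; exact (norm_abs_apply x ξ).ge
  -- Since $|x|\xi$ and $x\xi$ have equal norms, $|x|\xi\mapsto x\xi$ extends isometrically to the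
  -- closure $K$ of the range of $|x|$; `u` is this extension, set to zero on $K^\perp$.
  let U : K →L[ℂ] H := (x : H →ₗ[ℂ] H).extendOfNorm e
  have hU : ∀ ξ, U (e ξ) = x ξ := LinearMap.extendOfNorm_eq he ⟨1, hb⟩
  let u : H →L[ℂ] H := U ∘L K.orthogonalProjectionOnto
  have hua : ∀ ξ, u (a ξ) = x ξ := fun ξ => by
    have : K.orthogonalProjectionOnto (a ξ) = e ξ :=
      Submodule.orthogonalProjectionOnto_mem_subspace_eq_self (e ξ)
    simp only [u, ContinuousLinearMap.comp_apply, this, hU]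
  have huperp : ∀ ξ ∈ Kᗮ, u ξ = 0 := fun ξ hξ => by
    simp only [u, ContinuousLinearMap.comp_apply]
    rw [Submodule.orthogonalProjectionOnto_eq_zero_iff.2 hξ, map_zero]
  have hUn : ∀ k : K, ‖U k‖ = ‖k‖ := fun k =>
    he.induction_on (p := fun k => ‖U k‖ = ‖k‖) k (isClosed_eq (by fun_prop) (by fun_prop))
      fun ξ => by rw [hU]; exact (norm_abs_apply x ξ).symm
  have huu : star u * u = K.starProjection := by
    have := star_mul_self_eq_of_norm_apply_eq (x := u) (y := K.starProjection) fun ξ => by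
      simp only [u, ContinuousLinearMap.comp_apply, hUn, Submodule.starProjection_apply]
      rfl
    rw [this, (isStarProjection_starProjection (U := K)).isSelfAdjoint.star_eq]
    exact isStarProjection_starProjection.isIdempotentElem
  have hext : ∀ z w : H →L[ℂ] H, (∀ ξ, z (a ξ) = w (a ξ)) → (∀ ξ ∈ Kᗮ, z ξ = w ξ) → z = w := by
    intro z w h1 h2
    ext ξ
    have h3 : ∀ ξ ∈ K, z ξ = w ξ := by
      have : K ≤ LinearMap.eqLocus (z : H →ₗ[ℂ] H) (w : H →ₗ[ℂ] H) := by
        apply Submodule.topologicalClosure_minimal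
        · rintro _ ⟨ξ, rfl⟩; exact h1 ξ
        · exact isClosed_eq z.continuous w.continuous
      exact fun ξ hξ => this hξ
    rw [← Submodule.starProjection_add_starProjection_orthogonal (K := K) ξ, map_add, map_add,
      h3 _ (K.starProjection_apply_mem ξ), h2 _ (Kᗮ.starProjection_apply_mem ξ)]
  refine ⟨u, ?_, isPartialIsometry_of_initial (huu ▸ isStarProjection_starProjection), ?_, ?_,
    ?_, ?_⟩
  · refine mem_of_commute fun y hy => hext _ _ (fun ξ => ?_) fun ξ hξ => ?_
    · simp only [mul_apply_eq_comp]
      rw [← apply_of_mem_commutant ha hy, hua, hua, apply_of_mem_commutant hx hy]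
    · have hy2 : y ξ ∈ Kᗮ := by
        have : ∀ k ∈ K, inner ℂ k (y ξ) = 0 := by
          intro k hk
          have hk' : star y k ∈ K := by
            have : K ≤ K.comap ((star y : H →L[ℂ] H) : H →ₗ[ℂ] H) := by
              apply Submodule.topologicalClosure_minimal
              · rintro _ ⟨ζ, rfl⟩
                have := apply_of_mem_commutant ha (star_mem hy) ζ
                simp only [Submodule.mem_comap, ContinuousLinearMap.coe_coe]
                rw [← this]; exact hmem _
              · exact (Submodule.isClosed_topologicalClosure _).preimage (star y).continuous
            exact this hk
          rw [← adjoint_inner_left, ← star_eq_adjoint]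
          exact (Submodule.mem_orthogonal _ _).1 hξ _ hk'
        exact (Submodule.mem_orthogonal _ _).2 this
      simp only [mul_apply_eq_comp]
      rw [huperp ξ hξ, huperp _ hy2, map_zero]
  · ext ξ; exact hua ξ
  · rw [huu]; ext ξ
    exact Submodule.starProjection_eq_self_iff.2 (hmem ξ)
  · intro z hz
    refine hext _ _ (fun ξ => ?_) fun ξ hξ => ?_
    · simp only [mul_apply_eq_comp, hua]
      simpa using congrArg (fun w : H →L[ℂ] H => w ξ) hz
    · simp [huperp ξ hξ]
  · intro z hz
    ext ξ
    have hz' : x (z ξ) = 0 := by simpa using congrArg (fun w : H →L[ℂ] H => w ξ) hz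
    have haz : a (z ξ) = 0 := by rw [← norm_eq_zero, norm_abs_apply, hz', norm_zero]
    have : z ξ ∈ Kᗮ := by
      rw [Submodule.mem_orthogonal]
      intro k hk
      have hle : K ≤ (Submodule.span ℂ {z ξ})ᗮ := by
        apply Submodule.topologicalClosure_minimal
        · rintro _ ⟨ζ, rfl⟩
          rw [Submodule.mem_orthogonal_singleton_iff_inner_left]
          change inner ℂ (a ζ) (z ξ) = 0
          rw [← has, star_eq_adjoint, adjoint_inner_left, haz, inner_zero_right]
        · exact Submodule.isClosed_orthogonal _
      exact Submodule.mem_orthogonal_singleton_iff_inner_left.1 (hle hk)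
    simpa using huperp _ this

end VonNeumannAlgebra

/-! ### Strong sums of orthogonal partial isometries -/

section StrongSums

open ContinuousLinearMap

variable {H : Type*} [NormedAddCommGroup H] [InnerProductSpace ℂ H] [CompleteSpace H] {ι : Type*}

/-- A family of partial isometries with pairwise orthogonal initial and final spaces. -/
structure IsOrthoFamily (u : ι → H →L[ℂ] H) : Prop where
  isPartialIsometry : ∀ i, IsPartialIsometry (u i)
  star_mul : ∀ i j, i ≠ j → star (u i) * u j = 0
  mul_star : ∀ i j, i ≠ j → u i * star (u j) = 0

/-- The family `u` sums to `w` in the strong-* topology. -/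
structure HasStrongSum (u : ι → H →L[ℂ] H) (w : H →L[ℂ] H) : Prop where
  hasSum : ∀ ξ, HasSum (fun i => u i ξ) (w ξ)
  hasSum_star : ∀ ξ, HasSum (fun i => star (u i) ξ) (star w ξ)

theorem IsOrthoFamily.star {u : ι → H →L[ℂ] H} (hu : IsOrthoFamily u) :
    IsOrthoFamily fun i => star (u i) where
  isPartialIsometry i := (hu.isPartialIsometry i).star
  star_mul i j h := by simpa using hu.mul_star i j h
  mul_star i j h := by simpa using hu.star_mul i j h

theorem HasStrongSum.star {u : ι → H →L[ℂ] H} {w : H →L[ℂ] H} (h : HasStrongSum u w) :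
    HasStrongSum (fun i => star (u i)) (star w) where
  hasSum := h.hasSum_star
  hasSum_star := by simpa using h.hasSum

namespace IsOrthoFamily

variable {u : ι → H →L[ℂ] H} {w : H →L[ℂ] H}

theorem isStarProjection_sum (hu : IsOrthoFamily u) (s : Finset ι) :
    IsStarProjection (∑ i ∈ s, Star.star (u i) * u i) := by
  classical
  induction s using Finset.induction_on with
  | empty => simp
  | insert a s ha ih =>
    rw [Finset.sum_insert ha]
    refine IsStarProjection.add (hu.isPartialIsometry a).initial ih ?_
    rw [Finset.mul_sum]
    refine Finset.sum_eq_zero fun i hi => ?_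
    have : a ≠ i := fun h => ha (h ▸ hi)
    rw [mul_assoc, ← mul_assoc (u a), hu.mul_star a i this]
    simp

theorem sum_norm_sq (hu : IsOrthoFamily u) (s : Finset ι) (ξ : H) :
    ‖∑ i ∈ s, u i ξ‖ ^ 2 = ∑ i ∈ s, ‖u i ξ‖ ^ 2 := by
  have h := norm_apply_sq_of_star_mul_self (∑ i ∈ s, u i) ξ
  have h2 : Star.star (∑ i ∈ s, u i) * (∑ i ∈ s, u i) = ∑ i ∈ s, Star.star (u i) * u i := by
    rw [star_sum, Finset.sum_mul_sum]
    refine Finset.sum_congr rfl fun i hi => ?_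
    rw [Finset.sum_eq_single i (fun j _ hj => hu.star_mul i j hj.symm) (fun h => absurd hi h)]
  rw [h2] at h
  simp only [_root_.sum_apply] at h
  rw [h, sum_inner, Complex.re_sum]
  exact Finset.sum_congr rfl fun i _ => (norm_apply_sq_of_star_mul_self (u i) ξ).symm

theorem norm_sum_le (hu : IsOrthoFamily u) (s : Finset ι) (ξ : H) :
    ‖∑ i ∈ s, u i ξ‖ ≤ ‖ξ‖ := by
  have hp := hu.isStarProjection_sum s
  set p := ∑ i ∈ s, Star.star (u i) * u i with hpdef
  have h1 : ‖∑ i ∈ s, u i ξ‖ ^ 2 = ‖p ξ‖ ^ 2 := by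
    rw [hu.sum_norm_sq, hp.norm_apply_sq, hpdef]
    simp only [_root_.sum_apply]
    rw [sum_inner, Complex.re_sum]
    exact Finset.sum_congr rfl fun i _ => norm_apply_sq_of_star_mul_self (u i) ξ
  have h2 : ‖p ξ‖ ^ 2 ≤ ‖p ξ‖ * ‖ξ‖ := by
    rw [hp.norm_apply_sq]
    exact (Complex.re_le_norm _).trans (norm_inner_le_norm _ _)
  rw [(sq_eq_sq₀ (norm_nonneg _) (norm_nonneg _)).1 h1]
  by_contra hlt
  push Not at hlt
  nlinarith [norm_nonneg ξ, norm_nonneg (p ξ)]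

theorem summable_apply (hu : IsOrthoFamily u) (ξ : H) : Summable fun i => u i ξ := by
  have h1 : Summable fun i => ‖u i ξ‖ ^ 2 := by
    refine summable_of_sum_le (c := ‖ξ‖ ^ 2) (fun i => by positivity) fun s => ?_
    rw [← hu.sum_norm_sq]
    exact pow_le_pow_left₀ (norm_nonneg _) (hu.norm_sum_le s ξ) 2
  rw [summable_iff_vanishing_norm] at h1 ⊢
  intro ε hε
  obtain ⟨s, hs⟩ := h1 (ε ^ 2) (by positivity)
  refine ⟨s, fun t ht => ?_⟩
  have := hs t ht
  rw [← hu.sum_norm_sq, Real.norm_of_nonneg (by positivity)] at this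
  exact lt_of_pow_lt_pow_left₀ 2 hε.le this

theorem exists_hasSum (hu : IsOrthoFamily u) :
    ∃ w : H →L[ℂ] H, ∀ ξ, HasSum (fun i => u i ξ) (w ξ) := by
  refine ⟨LinearMap.mkContinuous
    { toFun := fun ξ => ∑' i, u i ξ
      map_add' := fun ξ η => by
        simp only [map_add]
        exact (hu.summable_apply ξ).tsum_add (hu.summable_apply η)
      map_smul' := fun c ξ => by
        simp only [map_smul, RingHom.id_apply]
        exact (hu.summable_apply ξ).tsum_const_smul c } 1 fun ξ => ?_, fun ξ =>
    (hu.summable_apply ξ).hasSum⟩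
  rw [one_mul]
  exact le_of_tendsto (hu.summable_apply ξ).hasSum.norm (Eventually.of_forall fun s =>
    hu.norm_sum_le s ξ)

theorem exists_hasStrongSum (hu : IsOrthoFamily u) : ∃ w, HasStrongSum u w := by
  obtain ⟨w, hw⟩ := hu.exists_hasSum
  obtain ⟨w', hw'⟩ := hu.star.exists_hasSum
  have : w' = Star.star w := by
    rw [star_eq_adjoint, eq_adjoint_iff]
    intro ξ η
    have h1 : HasSum (fun i => inner ℂ (Star.star (u i) ξ) η) (inner ℂ (w' ξ) η) :=
      (hw' ξ).mapL ((innerSL ℂ).flip η : H →L⋆[ℂ] ℂ)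
    have h2 : HasSum (fun i => inner ℂ ξ (u i η)) (inner ℂ ξ (w η)) :=
      (hw η).mapL (innerSL ℂ ξ)
    refine h1.unique ?_
    convert h2 using 2 with i
    rw [star_eq_adjoint, adjoint_inner_left]
  exact ⟨w, hw, this ▸ hw'⟩

theorem sum_mul_star (hu : IsOrthoFamily u) (hw : HasStrongSum u w) (i : ι) :
    w * Star.star (u i) = u i * Star.star (u i) := by
  ext ξ
  refine (hw.hasSum (Star.star (u i) ξ)).unique ?_
  refine hasSum_single i fun j hj => ?_
  simpa using congrArg (fun z : H →L[ℂ] H => z ξ) (hu.mul_star j i hj)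

theorem star_sum_mul (hu : IsOrthoFamily u) (hw : HasStrongSum u w) (i : ι) :
    Star.star w * u i = Star.star (u i) * u i := by
  simpa using hu.star.sum_mul_star hw.star i

theorem sum_mul_initial (hu : IsOrthoFamily u) (hw : HasStrongSum u w) (i : ι) :
    w * (Star.star (u i) * u i) = u i := by
  rw [← mul_assoc, hu.sum_mul_star hw]; exact hu.isPartialIsometry i

theorem isPartialIsometry_sum (hu : IsOrthoFamily u) (hw : HasStrongSum u w) :
    IsPartialIsometry w := by
  ext ξ
  refine HasSum.unique (f := fun i => u i ξ) ?_ (hw.hasSum ξ)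
  have h := (hw.hasSum ξ).mapL (w * Star.star w)
  have : ∀ i, (w * Star.star w) (u i ξ) = u i ξ := fun i => by
    have : w * Star.star w * u i = u i := by
      rw [mul_assoc, hu.star_sum_mul hw, hu.sum_mul_initial hw]
    exact congrArg (fun z : H →L[ℂ] H => z ξ) this
  simp only [this] at h
  exact h

theorem hasSum_norm_sq (hu : IsOrthoFamily u) (hw : HasStrongSum u w) (ξ : H) :
    HasSum (fun i => ‖u i ξ‖ ^ 2) (‖w ξ‖ ^ 2) := by
  have h := ((hw.hasSum ξ).mapL (Star.star w)).mapL ((innerSL ℂ).flip ξ : H →L⋆[ℂ] ℂ)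
  have h2 := Complex.hasSum_re h
  have h3 : ∀ i, ‖u i ξ‖ ^ 2 = (inner ℂ (Star.star w (u i ξ)) ξ).re := fun i => by
    rw [norm_apply_sq_of_star_mul_self, ← hu.star_sum_mul hw]
    rfl
  rw [norm_apply_sq_of_star_mul_self]
  simp only [h3]
  exact h2

end IsOrthoFamily

namespace HasStrongSum

variable {u : ι → H →L[ℂ] H} {w : H →L[ℂ] H}

theorem mul_eq_zero_left (hw : HasStrongSum u w) {z : H →L[ℂ] H} (h : ∀ i, z * u i = 0) :
    z * w = 0 := by
  ext ξ
  refine HasSum.unique (f := fun i => z (u i ξ)) ((hw.hasSum ξ).mapL z) ?_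
  have : ∀ i, z (u i ξ) = 0 := fun i => congrArg (fun y : H →L[ℂ] H => y ξ) (h i)
  simp only [this]
  exact hasSum_zero

theorem mul_eq_zero_right (hw : HasStrongSum u w) {z : H →L[ℂ] H} (h : ∀ i, u i * z = 0) :
    w * z = 0 := by
  ext ξ
  refine HasSum.unique (f := fun i => u i (z ξ)) (hw.hasSum (z ξ)) ?_
  have : ∀ i, u i (z ξ) = 0 := fun i => congrArg (fun y : H →L[ℂ] H => y ξ) (h i)
  simp only [this]
  exact hasSum_zero

theorem mem (hw : HasStrongSum u w) {M : VonNeumannAlgebra H} (h : ∀ i, u i ∈ M) : w ∈ M := by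
  refine VonNeumannAlgebra.mem_of_commute fun y hy => ?_
  ext ξ
  refine ((hw.hasSum ξ).mapL y).unique ?_
  have := hw.hasSum (y ξ)
  simp only [VonNeumannAlgebra.apply_of_mem_commutant (h _) hy ξ] at this
  exact this

end HasStrongSum

end StrongSums

/-! ### Maximal families, factoriality and dyadic expansions -/

namespace VonNeumannAlgebra

open ContinuousLinearMap

variable {H : Type*} [NormedAddCommGroup H] [InnerProductSpace ℂ H] [CompleteSpace H]
  {M : VonNeumannAlgebra H}

/-- A maximal family of pairwise orthogonal partial isometries with a given property. -/
theorem exists_maximal_orthoFamily (M : VonNeumannAlgebra H) (Q : (H →L[ℂ] H) → Prop) :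
    ∃ (S : Set (H →L[ℂ] H)) (w : H →L[ℂ] H), IsOrthoFamily (Subtype.val : S → H →L[ℂ] H) ∧
      HasStrongSum (Subtype.val : S → H →L[ℂ] H) w ∧ (∀ u ∈ S, u ∈ M ∧ u ≠ 0 ∧ Q u) ∧
      ∀ v ∈ M, IsPartialIsometry v → v ≠ 0 → Q v → v * star w = 0 → star v * w = 0 → False := by
  let P : Set (Set (H →L[ℂ] H)) :=
    {S | IsOrthoFamily (Subtype.val : S → H →L[ℂ] H) ∧ ∀ u ∈ S, u ∈ M ∧ u ≠ 0 ∧ Q u}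
  obtain ⟨S, hS⟩ := zorn_subset P fun c hc hchain => by
    refine ⟨⋃₀ c, ⟨⟨?_, ?_, ?_⟩, ?_⟩, fun s hs => Set.subset_sUnion_of_mem hs⟩
    · rintro ⟨u, s, hs, hu⟩
      exact (hc hs).1.isPartialIsometry ⟨u, hu⟩
    · rintro ⟨u, s, hs, hu⟩ ⟨v, t, ht, hv⟩ huv
      have huv' : u ≠ v := fun h => huv (Subtype.ext h)
      rcases hchain.total hs ht with h | h
      · exact (hc ht).1.star_mul ⟨u, h hu⟩ ⟨v, hv⟩ fun h => huv' (congrArg Subtype.val h)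
      · exact (hc hs).1.star_mul ⟨u, hu⟩ ⟨v, h hv⟩ fun h => huv' (congrArg Subtype.val h)
    · rintro ⟨u, s, hs, hu⟩ ⟨v, t, ht, hv⟩ huv
      have huv' : u ≠ v := fun h => huv (Subtype.ext h)
      rcases hchain.total hs ht with h | h
      · exact (hc ht).1.mul_star ⟨u, h hu⟩ ⟨v, hv⟩ fun h => huv' (congrArg Subtype.val h)
      · exact (hc hs).1.mul_star ⟨u, hu⟩ ⟨v, h hv⟩ fun h => huv' (congrArg Subtype.val h)
    · rintro u ⟨s, hs, hu⟩
      exact (hc hs).2 u hu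
  obtain ⟨w, hw⟩ := hS.prop.1.exists_hasStrongSum
  refine ⟨S, w, hS.prop.1, hw, hS.prop.2, fun v hv hvp hv0 hQ h1 h2 => ?_⟩
  -- Orthogonality to the sum `w` gives orthogonality to each member, because $u=w(u^*u)$; so `v`
  -- could be adjoined to `S`.
  have k1 : ∀ u ∈ S, v * star u = 0 := fun u hu => by
    have := hS.prop.1.star.sum_mul_initial hw.star ⟨u, hu⟩
    simp only [star_star] at this
    rw [← this, ← mul_assoc, h1, zero_mul]
  have k2 : ∀ u ∈ S, star v * u = 0 := fun u hu => by
    have : w * (star u * u) = u := hS.prop.1.sum_mul_initial hw ⟨u, hu⟩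
    rw [← this, ← mul_assoc, h2, zero_mul]
  have k1' : ∀ u ∈ S, u * star v = 0 := fun u hu => by
    simpa using congrArg star (k1 u hu)
  have k2' : ∀ u ∈ S, star u * v = 0 := fun u hu => by
    simpa using congrArg star (k2 u hu)
  have hins : insert v S ∈ P := by
    refine ⟨⟨?_, ?_, ?_⟩, ?_⟩
    · rintro ⟨u, rfl | hu⟩
      exacts [hvp, hS.prop.1.isPartialIsometry ⟨u, hu⟩]
    · rintro ⟨u, rfl | hu⟩ ⟨u', rfl | hu'⟩ h
      · exact absurd rfl h
      · exact k2 _ hu'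
      · exact k2' _ hu
      · exact hS.prop.1.star_mul ⟨u, hu⟩ ⟨u', hu'⟩ fun h' => h (Subtype.ext (Subtype.mk.inj h'))
    · rintro ⟨u, rfl | hu⟩ ⟨u', rfl | hu'⟩ h
      · exact absurd rfl h
      · exact k1 _ hu'
      · exact k1' _ hu
      · exact hS.prop.1.mul_star ⟨u, hu⟩ ⟨u', hu'⟩ fun h' => h (Subtype.ext (Subtype.mk.inj h'))
    · rintro u (rfl | hu)
      exacts [⟨hv, hv0, hQ⟩, hS.prop.2 u hu]
  have hvS : v ∈ S := hS.le_of_ge hins (Set.subset_insert v S) (Set.mem_insert v S)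
  have := k2 v hvS
  exact hv0 ((CStarRing.star_mul_self_eq_zero_iff v).1 this)

/-- The projection onto `K` lies in $M\cap M'$, so it is a scalar. -/
theorem IsFactor.eq_bot_or_eq_top (hM : M.IsFactor) (K : Submodule ℂ H) (hK : IsClosed (K : Set H))
    (h1 : ∀ y ∈ M, ∀ ξ ∈ K, y ξ ∈ K) (h2 : ∀ y ∈ M.commutant, ∀ ξ ∈ K, y ξ ∈ K) :
    K = ⊥ ∨ K = ⊤ := by
  have : CompleteSpace K := hK.completeSpace_coe
  have hp : K.starProjection ∈ M := starProjection_mem h2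
  have hp' : K.starProjection ∈ M.commutant :=
    starProjection_mem fun y hy => h1 y (by rwa [commutant_commutant] at hy)
  obtain ⟨c, hc⟩ : K.starProjection ∈ Set.range fun c : ℂ => c • (1 : H →L[ℂ] H) := by
    rw [← hM]; exact ⟨hp, hp'⟩
  refine or_iff_not_imp_left.2 fun hb => ?_
  obtain ⟨ξ, hξ, h0⟩ := K.ne_bot_iff.1 hb
  have h3 : c • ξ = ξ := by
    have := congrArg (fun z : H →L[ℂ] H => z ξ) hc
    simpa [Submodule.starProjection_eq_self_iff.2 hξ] using this
  have h4 : c = 1 := by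
    have : (c - 1) • ξ = 0 := by rw [sub_smul, h3, one_smul, sub_self]
    exact sub_eq_zero.1 ((smul_eq_zero.1 this).resolve_right h0)
  rw [eq_top_iff]
  intro ζ _
  rw [← Submodule.starProjection_eq_self_iff, ← hc, h4]
  simp

/-- The vectors killed by $qM$ form a closed subspace invariant under $M$ and $M'$, which is
therefore trivial. Only `q` must lie in `M`; `p` is arbitrary, so a rank-one `p` is allowed. -/
theorem IsFactor.exists_mul_mul_ne_zero (hM : M.IsFactor) {p q : H →L[ℂ] H} (hq : q ∈ M)
    (hp0 : p ≠ 0) (hq0 : q ≠ 0) : ∃ x ∈ M, q * x * p ≠ 0 := by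
  by_contra! hcon
  let K : Submodule ℂ H :=
    { carrier := {ξ | ∀ x ∈ M, q (x ξ) = 0}
      add_mem' := fun {a b} ha hb x hx => by rw [map_add, map_add, ha x hx, hb x hx, add_zero]
      zero_mem' := fun x _ => by simp
      smul_mem' := fun c a ha x hx => by rw [map_smul, map_smul, ha x hx, smul_zero] }
  have hK : IsClosed (K : Set H) := by
    change IsClosed {ξ | ∀ x ∈ M, q (x ξ) = 0}
    simp only [Set.ofPred_forall]
    exact isClosed_iInter fun x => isClosed_iInter fun _ =>
      isClosed_eq (q.continuous.comp x.continuous) continuous_const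
  rcases hM.eq_bot_or_eq_top K hK (fun y hy ξ hξ x hx => hξ (x * y) (mul_mem hx hy))
    (fun y hy ξ hξ x hx => by
      rw [apply_of_mem_commutant hx hy, apply_of_mem_commutant hq hy, hξ x hx, map_zero]) with h | h
  · apply hp0
    ext ξ
    have : p ξ ∈ K := fun x hx => by
      simpa using congrArg (fun z : H →L[ℂ] H => z ξ) (hcon x hx)
    rw [h] at this
    simpa using this
  · apply hq0
    ext ξ
    have : ξ ∈ K := h ▸ Submodule.mem_top
    simpa using this 1 (one_mem M)

/-- One binary digit of $a$: `e` is the range projection of $(2a-1)^+$, morally the spectral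
projection for $a>1/2$, and the remainder $2a-e$ is again a positive contraction. The last clause
says that `e` lies under the support of `a`. -/
theorem exists_dyadic_step {a : H →L[ℂ] H} (ha : a ∈ M) (h0 : 0 ≤ a) (h1 : a ≤ 1) :
    ∃ e ∈ M, IsStarProjection e ∧ 0 ≤ a + a - e ∧ a + a - e ≤ 1 ∧
      ∀ z : H →L[ℂ] H, z * a = 0 → z * e = 0 := by
  set b := a + a - 1 with hb
  have hbs : IsSelfAdjoint b := by
    have := h0.isSelfAdjoint
    exact (this.add this).sub (IsSelfAdjoint.one _)
  have hbM : b ∈ M := sub_mem (add_mem ha ha) (one_mem M)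
  have hb1 : b ≤ 1 := by
    rw [hb, sub_le_iff_le_add]; exact add_le_add h1 h1
  have hb2 : -1 ≤ b := by
    rw [hb, neg_le_sub_iff_le_add]
    exact le_add_of_nonneg_left (add_nonneg h0 h0)
  obtain ⟨e, heM, he, hep, hez⟩ := exists_rangeProjection (posPart_mem hbM hbs)
  have hes : star e = e := he.isSelfAdjoint
  have hee : e * e = e := he.isIdempotentElem
  have hdec : b⁺ - b⁻ = b := CFC.posPart_sub_negPart b hbs
  have hne : b⁻ * e = 0 := hez _ (CFC.negPart_mul_posPart b)
  have hpe : b⁺ * e = b⁺ := by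
    have := congrArg star hep
    rwa [star_mul, hes, (CFC.posPart_nonneg b).isSelfAdjoint.star_eq] at this
  have hen : e * b⁻ = 0 := by
    have := congrArg star hne
    rwa [star_mul, hes, (CFC.negPart_nonneg b).isSelfAdjoint.star_eq, star_zero] at this
  have hple : b⁺ ≤ e := by
    have := star_left_conjugate_le_conjugate hb1 e
    rw [hes, mul_one, hee, ← hdec, mul_sub, hep, hen, sub_zero, hpe] at this
    exact this
  have hnle : b⁻ ≤ 1 - e := by
    have := star_left_conjugate_le_conjugate hb2 (1 - e)
    have e1 : star (1 - e) * -1 * (1 - e) = -(1 - e) := by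
      rw [star_sub, hes, star_one]
      have : (1 - e) * (1 - e) = 1 - e := he.one_sub.isIdempotentElem
      rw [mul_neg, mul_one, neg_mul, this]
    have e2 : star (1 - e) * b * (1 - e) = -b⁻ := by
      rw [star_sub, hes, star_one]
      have : (1 - e) * b = -b⁻ := by
        rw [← hdec, sub_mul, mul_sub e, hep, hen, hdec, one_mul, sub_zero]
        exact sub_eq_of_eq_add' (by rw [← sub_eq_add_neg, hdec])
      rw [this, mul_sub, neg_mul, neg_mul, hne]; simp
    rw [e1, e2] at this
    exact neg_le_neg_iff.1 this
  have hpos : 0 ≤ a + a - e := by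
    have : a + a - e = b⁺ + ((1 - e) - b⁻) := by
      calc a + a - e = b + 1 - e := by rw [hb]; abel
        _ = b⁺ - b⁻ + 1 - e := by rw [hdec]
        _ = _ := by abel
    rw [this]
    exact add_nonneg (CFC.posPart_nonneg b) (sub_nonneg.2 hnle)
  refine ⟨e, heM, he, hpos, ?_, fun z hz => ?_⟩
  · have : 1 - (a + a - e) = (e - b⁺) + b⁻ := by
      calc 1 - (a + a - e) = e - b := by rw [hb]; abel
        _ = e - (b⁺ - b⁻) := by rw [hdec]
        _ = _ := by abel
    rw [← sub_nonneg, this]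
    exact add_nonneg (sub_nonneg.2 hple) (CFC.negPart_nonneg b)
  -- From $e\le 2a$ one gets $(ze)(ze)^*=zez^*\le 2zaz^*=0$.
  · have h3 := star_right_conjugate_le_conjugate (sub_nonneg.1 hpos) z
    rw [mul_add, hz, add_zero, zero_mul] at h3
    have h4 : z * e * star z = (z * e) * star (z * e) := by
      rw [star_mul, hes, mul_assoc, mul_assoc, ← mul_assoc e, hee]
    rw [h4] at h3
    exact (CStarRing.mul_star_self_eq_zero_iff _).1 (le_antisymm h3 (mul_star_self_nonneg _))

/-- A positive contraction is a dyadic series of projections. -/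
theorem exists_dyadic_expansion {a : H →L[ℂ] H} (ha : a ∈ M) (h0 : 0 ≤ a) (h1 : a ≤ 1) :
    ∃ e : ℕ → H →L[ℂ] H, (∀ k, e k ∈ M ∧ IsStarProjection (e k) ∧
      ∀ z : H →L[ℂ] H, z * a = 0 → z * e k = 0) ∧
      HasSum (fun k => ((2 : ℝ)⁻¹) ^ (k + 1) • e k) a := by
  choose! E hE using fun (b : H →L[ℂ] H) (hb : b ∈ M ∧ 0 ≤ b ∧ b ≤ 1) =>
    exists_dyadic_step hb.1 hb.2.1 hb.2.2
  -- `A n` is the remainder after `n` digits: $a=\sum_{k<n}2^{-k-1}e_k+2^{-n}A_n$.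
  let A : ℕ → H →L[ℂ] H := fun n => Nat.rec a (fun _ b => b + b - E b) n
  have hA0 : A 0 = a := rfl
  have hAs : ∀ n, A (n + 1) = A n + A n - E (A n) := fun n => rfl
  have hA : ∀ n, A n ∈ M ∧ 0 ≤ A n ∧ A n ≤ 1 := by
    intro n
    induction n with
    | zero => exact ⟨ha, h0, h1⟩
    | succ n ih =>
      obtain ⟨k1, -, k3, k4, -⟩ := hE (A n) ih
      rw [hAs]
      exact ⟨sub_mem (add_mem ih.1 ih.1) k1, k3, k4⟩
  have hz : ∀ n, ∀ z : H →L[ℂ] H, z * a = 0 → z * A n = 0 := by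
    intro n z hz
    induction n with
    | zero => exact hz
    | succ n ih =>
      rw [hAs, mul_sub, mul_add, ih, (hE (A n) (hA n)).2.2.2.2 z ih]; simp
  have hnorm : ∀ n, ‖A n‖ ≤ 1 := fun n =>
    (CStarAlgebra.norm_le_one_iff_of_nonneg (A n) (hA n).2.1).2 (hA n).2.2
  refine ⟨fun k => E (A k), fun k => ⟨(hE _ (hA k)).1, (hE _ (hA k)).2.1, fun z h =>
    (hE _ (hA k)).2.2.2.2 z (hz k z h)⟩, ?_⟩
  have hpart : ∀ n, ∑ k ∈ Finset.range n, ((2 : ℝ)⁻¹) ^ (k + 1) • E (A k) =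
      a - ((2 : ℝ)⁻¹) ^ n • A n := by
    intro n
    induction n with
    | zero => simp [hA0]
    | succ n ih =>
      have : E (A n) = (2 : ℝ) • A n - A (n + 1) := by rw [hAs, two_smul]; abel
      rw [Finset.sum_range_succ, ih, this, smul_sub, smul_smul, pow_succ]
      have h2 : (2 : ℝ)⁻¹ ^ n * 2⁻¹ * 2 = 2⁻¹ ^ n := by ring
      rw [h2]; abel
  have hsum : Summable fun k => ((2 : ℝ)⁻¹) ^ (k + 1) • E (A k) := by
    refine Summable.of_norm_bounded (g := fun k => ((2 : ℝ)⁻¹) ^ k * 2) ?_ fun k => ?_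
    · exact (summable_geometric_of_lt_one (by norm_num) (by norm_num)).mul_right 2
    · have h3 : ‖E (A k)‖ ≤ 3 := by
        have : E (A k) = A k + A k - A (k + 1) := by rw [hAs]; abel
        rw [this]
        calc _ ≤ ‖A k‖ + ‖A k‖ + ‖A (k + 1)‖ :=
              (norm_sub_le _ _).trans (add_le_add (norm_add_le _ _) le_rfl)
          _ ≤ 3 := by linarith [hnorm k, hnorm (k + 1)]
      rw [norm_smul, Real.norm_of_nonneg (by positivity), pow_succ]
      have : (0 : ℝ) < 2⁻¹ ^ k := by positivity
      nlinarith
  rw [hsum.hasSum_iff_tendsto_nat]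
  have hlim : Tendsto (fun n => ((2 : ℝ)⁻¹) ^ n • A n) atTop (𝓝 0) := by
    refine squeeze_zero_norm (a := fun n => ((2 : ℝ)⁻¹) ^ n) (fun n => ?_)
      (tendsto_pow_atTop_nhds_zero_of_lt_one (by norm_num) (by norm_num))
    rw [norm_smul, Real.norm_of_nonneg (by positivity)]
    exact mul_le_of_le_one_right (by positivity) (hnorm n)
  simp only [hpart]
  simpa using tendsto_const_nhds.sub hlim

end VonNeumannAlgebra

/-! ### Comparison of projections in finite factors -/

namespace VonNeumannAlgebra

open ContinuousLinearMap

variable {H : Type*} [NormedAddCommGroup H] [InnerProductSpace ℂ H] [CompleteSpace H]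
  {M : VonNeumannAlgebra H}

theorem mul_eq_of_mul_eq {e x : H →L[ℂ] H} (he : IsStarProjection e) (h : e * x = x) :
    star x * e = star x := by
  have := congrArg star h
  rwa [star_mul, he.isSelfAdjoint.star_eq] at this

theorem mul_star_eq_of_mul_eq {e x : H →L[ℂ] H} (he : IsStarProjection e) (h : x * e = x) :
    e * star x = star x := by
  have := congrArg star h
  rwa [star_mul, he.isSelfAdjoint.star_eq] at this

theorem _root_.IsStarProjection.sub_initial {e u : H →L[ℂ] H} (he : IsStarProjection e)
    (hu : IsPartialIsometry u) (h : u * e = u) : IsStarProjection (e - star u * u) :=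
  hu.initial.sub_of_mul_eq_left he (by rw [mul_assoc, h])

theorem _root_.IsStarProjection.sub_final {f u : H →L[ℂ] H} (hf : IsStarProjection f)
    (hu : IsPartialIsometry u) (h : f * u = u) : IsStarProjection (f - u * star u) := by
  simpa using hf.sub_initial hu.star (mul_eq_of_mul_eq hf h)

/-- Nonzero projections of a factor have equivalent nonzero subprojections. -/
theorem IsFactor.exists_partialIsometry (hM : M.IsFactor) {e f : H →L[ℂ] H} (he : e ∈ M)
    (hf : f ∈ M) (hep : IsStarProjection e) (hfp : IsStarProjection f) (he0 : e ≠ 0)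
    (hf0 : f ≠ 0) : ∃ u ∈ M, IsPartialIsometry u ∧ u ≠ 0 ∧ u * e = u ∧ f * u = u := by
  -- The required `u` is the polar part of a nonzero $fxe$.
  obtain ⟨x, hx, hne⟩ := hM.exists_mul_mul_ne_zero hf he0 hf0
  obtain ⟨u, hu, hup, h1, -, h2, h3⟩ := exists_polar (mul_mem (mul_mem hf hx) he)
  refine ⟨u, hu, hup, ?_, ?_, ?_⟩
  · rintro rfl
    exact hne (by rw [← h1, zero_mul])
  · have := h3 (1 - e) (by rw [mul_assoc, hep.mul_one_sub_self, mul_zero])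
    rw [mul_sub, mul_one, sub_eq_zero] at this
    exact this.symm
  · have := h2 (1 - f) (by rw [← mul_assoc, ← mul_assoc, hfp.one_sub_mul_self, zero_mul, zero_mul])
    rw [sub_mul, one_mul, sub_eq_zero] at this
    exact this.symm

/-- Comparison of projections in a factor. -/
theorem IsFactor.comparison (hM : M.IsFactor) {e f : H →L[ℂ] H} (he : e ∈ M)
    (hf : f ∈ M) (hep : IsStarProjection e) (hfp : IsStarProjection f) :
    ∃ w ∈ M, IsPartialIsometry w ∧ w * e = w ∧ f * w = w ∧ (star w * w = e ∨ w * star w = f) := by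
  obtain ⟨S, w, hS, hw, hQ, hmax⟩ := exists_maximal_orthoFamily M fun u => u * e = u ∧ f * u = u
  have hwM : w ∈ M := hw.mem fun i => (hQ i i.2).1
  have hwp := hS.isPartialIsometry_sum hw
  have hwe : w * e = w := by
    have := hw.mul_eq_zero_right (z := 1 - e) fun i => by
      rw [mul_sub, mul_one, (hQ i i.2).2.2.1, sub_self]
    rw [mul_sub, mul_one, sub_eq_zero] at this
    exact this.symm
  have hwf : f * w = w := by
    have := hw.mul_eq_zero_left (z := 1 - f) fun i => by
      rw [sub_mul, one_mul, (hQ i i.2).2.2.2, sub_self]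
    rw [sub_mul, one_mul, sub_eq_zero] at this
    exact this.symm
  refine ⟨w, hwM, hwp, hwe, hwf, ?_⟩
  by_contra! hcon
  have he' := hep.sub_initial hwp hwe
  have hf' := hfp.sub_final hwp hwf
  -- If something were left over on both sides, a nonzero partial isometry between the leftovers
  -- would contradict maximality.
  obtain ⟨u, hu, hup, hu0, hue, huf⟩ := hM.exists_partialIsometry
    (sub_mem he (mul_mem (star_mem hwM) hwM)) (sub_mem hf (mul_mem hwM (star_mem hwM))) he' hf'
    (sub_ne_zero.2 hcon.1.symm) (sub_ne_zero.2 hcon.2.symm)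
  refine hmax u hu hup hu0 ⟨?_, ?_⟩ ?_ ?_
  · rw [← hue, mul_assoc, sub_mul, hep.isIdempotentElem.eq, mul_assoc (star w), hwe]
  · rw [← huf, ← mul_assoc, mul_sub, hfp.isIdempotentElem.eq, ← mul_assoc f, hwf]
  · rw [← hue, mul_assoc, sub_mul, mul_star_eq_of_mul_eq hep hwe, mul_assoc,
      hwp.star_mul_mul_star, sub_self, mul_zero]
  · rw [← mul_eq_of_mul_eq hf' huf, mul_assoc, sub_mul, hwf, mul_assoc, hwp.mul_star_mul,
      sub_self, mul_zero]

/-- Corners inherit finiteness: $u+(1-e)$ is an isometry in `M`, hence unitary. -/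
theorem IsFinite.mul_star_eq (hfin : M.IsFinite) {e u : H →L[ℂ] H} (he : e ∈ M)
    (hep : IsStarProjection e) (hu : u ∈ M) (h1 : star u * u = e) (h2 : e * u = u) :
    u * star u = e := by
  have hup : IsPartialIsometry u := isPartialIsometry_of_initial (h1 ▸ hep)
  have hue : u * e = u := by rw [← h1]; exact hup.mul_star_mul
  have h2' := mul_eq_of_mul_eq hep h2
  have hue' := mul_star_eq_of_mul_eq hep hue
  have hs : star (u + (1 - e)) = star u + (1 - e) := by
    rw [star_add, star_sub, star_one, hep.isSelfAdjoint.star_eq]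
  have hee := hep.isIdempotentElem.eq
  have := hfin (u + (1 - e)) (add_mem hu (sub_mem (one_mem M) he)) (by
    rw [hs]
    simp only [add_mul, mul_add, mul_sub, sub_mul, one_mul, mul_one, h1, h2, h2', hee]
    abel)
  rw [hs] at this
  simp only [add_mul, mul_add, mul_sub, sub_mul, one_mul, mul_one, hue, hue', hee] at this
  have h3 : u * star u - e = 0 := by
    rw [← sub_eq_zero] at this
    rw [← this]; abel
  exact sub_eq_zero.1 h3

/-- Here $w+u$ has initial projection `e` and final projection below `f`, so $t^*(w+u)$ is an
isometry of the finite corner $eMe$. It is therefore unitary there, and $w+u$ fills `f`. -/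
theorem IsFinite.mul_star_eq_sub (hfin : M.IsFinite) {e f t w u : H →L[ℂ] H}
    (ht : t ∈ M) (hep : IsStarProjection e) (hte : star t * t = e) (htf : t * star t = f)
    (hw : w ∈ M) (hwp : IsPartialIsometry w) (hwe : w * e = w) (hwf : f * w = w) (hu : u ∈ M)
    (hue : star u * u = e - star w * w) (huf : (f - w * star w) * u = u) :
    u * star u = f - w * star w := by
  have htp : IsPartialIsometry t := isPartialIsometry_of_initial (hte ▸ hep)
  have hfp : IsStarProjection f := htf ▸ htp.final
  have he : e ∈ M := hte ▸ mul_mem (star_mem ht) ht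
  have hup : IsPartialIsometry u := isPartialIsometry_of_initial (hue ▸ hep.sub_initial hwp hwe)
  have hfu : f * u = u := by
    rw [← huf, ← mul_assoc, mul_sub, hfp.isIdempotentElem.eq, ← mul_assoc f, hwf]
  have hwu : star w * u = 0 := by
    rw [← huf, ← mul_assoc, mul_sub, mul_eq_of_mul_eq hfp hwf, hwp.star_mul_mul_star, sub_self,
      zero_mul]
  have huw : star u * w = 0 := by simpa using congrArg star hwu
  have huw' : u * star w = 0 := by
    rw [← hup.mul_star_mul, hue, mul_assoc, sub_mul, mul_star_eq_of_mul_eq hep hwe, mul_assoc,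
      hwp.star_mul_mul_star, sub_self, mul_zero]
  have hwu' : w * star u = 0 := by simpa using congrArg star huw'
  have hfs : f * (w + u) = w + u := by rw [mul_add, hwf, hfu]
  have hets : e * star t = star t := by rw [← hte, mul_assoc]; exact htp.star_mul_mul_star
  have hte' : t * e = t := by rw [← hte]; exact htp.mul_star_mul
  have k := hfin.mul_star_eq he hep (mul_mem (star_mem ht) (add_mem hw hu)) (by
    rw [star_mul, star_star, mul_assoc, ← mul_assoc t, htf, hfs, star_add, add_mul, mul_add,
      mul_add, hwu, huw, hue]; abel) (by rw [← mul_assoc, hets])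
  have k2 : (w + u) * star (w + u) = f := by
    have h1 : t * (star t * (w + u) * star (star t * (w + u))) * star t =
        f * (w + u) * star (f * (w + u)) := by
      rw [← htf]; simp only [star_mul, star_star, mul_assoc]
    rw [k, hte', htf, hfs] at h1
    exact h1.symm
  rw [star_add, add_mul, mul_add, mul_add, hwu', huw'] at k2
  rw [← k2]; abel

/-- In a finite factor, complements of equivalent subprojections of equivalent projections are
equivalent. -/
theorem IsFinite.exists_equiv_sub (hfin : M.IsFinite) (hM : M.IsFactor) {e f t w : H →L[ℂ] H}
    (ht : t ∈ M) (hep : IsStarProjection e) (hte : star t * t = e) (htf : t * star t = f)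
    (hw : w ∈ M) (hwp : IsPartialIsometry w) (hwe : w * e = w) (hwf : f * w = w) :
    ∃ u ∈ M, star u * u = e - star w * w ∧ u * star u = f - w * star w := by
  have htp : IsPartialIsometry t := isPartialIsometry_of_initial (hte ▸ hep)
  have hfp : IsStarProjection f := htf ▸ htp.final
  have he : e ∈ M := hte ▸ mul_mem (star_mem ht) ht
  have hf : f ∈ M := htf ▸ mul_mem ht (star_mem ht)
  have he' := hep.sub_initial hwp hwe
  have hf' := hfp.sub_final hwp hwf
  -- Compare the two complements. Whichever one is exhausted, finiteness forces the other to be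
  -- exhausted as well; the second case is the first one for adjoints.
  obtain ⟨u, hu, hup, hue, huf, h | h⟩ := hM.comparison
    (sub_mem he (mul_mem (star_mem hw) hw)) (sub_mem hf (mul_mem hw (star_mem hw))) he' hf'
  · exact ⟨u, hu, h, hfin.mul_star_eq_sub ht hep hte htf hw hwp hwe hwf hu h huf⟩
  · refine ⟨u, hu, ?_, h⟩
    simpa using hfin.mul_star_eq_sub (star_mem ht) hfp (by simpa using htf) (by simpa using hte)
      (star_mem hw) hwp.star (mul_eq_of_mul_eq hfp hwf) (mul_star_eq_of_mul_eq hep hwe)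
      (star_mem hu) (by simpa using h) (by simpa using mul_star_eq_of_mul_eq he' hue)

/-- A finite von Neumann algebra contains no infinite orthogonal sequence of equivalent nonzero
projections. -/
theorem IsFinite.eq_zero_of_sequence (hfin : M.IsFinite) {e : H →L[ℂ] H}
    (hep : IsStarProjection e) {u : ℕ → H →L[ℂ] H} (hu : ∀ i, u i ∈ M)
    (h1 : ∀ i, star (u i) * u i = e) (h2 : ∀ i j, i ≠ j → star (u i) * u j = 0) : e = 0 := by
  have hup : ∀ i, IsPartialIsometry (u i) := fun i =>
    isPartialIsometry_of_initial ((h1 i).symm ▸ hep)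
  have hue : ∀ i, u i * e = u i := fun i => by rw [← h1 i]; exact (hup i).mul_star_mul
  have hv1 : ∀ i, star (u (i + 1) * star (u i)) * (u (i + 1) * star (u i)) =
      u i * star (u i) := fun i => by
    rw [star_mul, star_star, mul_assoc, ← mul_assoc (star (u (i + 1))), h1, ← mul_assoc, hue]
  have hv : IsOrthoFamily fun i => u (i + 1) * star (u i) :=
    { isPartialIsometry := fun i => isPartialIsometry_of_initial (by
        rw [hv1]; exact (hup i).final)
      star_mul := fun i j hij => by
        rw [star_mul, star_star, mul_assoc, ← mul_assoc (star (u (i + 1))),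
          h2 _ _ (by omega), zero_mul, mul_zero]
      mul_star := fun i j hij => by
        rw [star_mul, star_star, mul_assoc, ← mul_assoc (star (u i)), h2 _ _ hij, zero_mul,
          mul_zero] }
  -- `v` is a one-sided shift carrying the $i$-th copy of `e` to the next. Finiteness makes its
  -- initial and final projections equal, yet its range misses the copy with index `0`.
  obtain ⟨v, hvs⟩ := hv.exists_hasStrongSum
  have hvM : v ∈ M := hvs.mem fun i => mul_mem (hu _) (star_mem (hu _))
  have hvp := hv.isPartialIsometry_sum hvs
  have hpu : ∀ i, star v * v * u i = u i := fun i => by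
    have k1 := hv.sum_mul_initial hvs i
    have k2 := hv.star_sum_mul hvs i
    simp only [hv1] at k1 k2
    have k3 : star v * v * (u i * star (u i)) = u i * star (u i) := by
      rw [mul_assoc, k1, k2]
    have k4 : u i * star (u i) * u i = u i := hup i
    calc star v * v * u i = star v * v * (u i * star (u i)) * u i := by
          conv_lhs => rw [← k4]
          simp only [mul_assoc]
      _ = u i := by rw [k3, k4]
  have hpv : star v * v * v = v := by
    have := hvs.mul_eq_zero_left (z := 1 - star v * v) fun i => by
      rw [sub_mul, one_mul, ← mul_assoc, hpu, sub_self]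
    rw [sub_mul, one_mul, sub_eq_zero] at this
    exact this.symm
  have hvv := hfin.mul_star_eq (mul_mem (star_mem hvM) hvM) hvp.initial hvM rfl hpv
  have h0 : star (u 0) * v = 0 := hvs.mul_eq_zero_left fun i => by
    rw [← mul_assoc, h2 _ _ (by omega), zero_mul]
  have h3 : star (u 0) = 0 := by
    rw [← mul_eq_of_mul_eq hvp.initial (hpu 0), ← hvv, ← mul_assoc, h0, zero_mul]
  rw [← h1 0, h3, zero_mul]

/-- In a finite factor the unit is a finite sum of copies of a nonzero projection and of a copy
of a subprojection. -/
theorem IsFinite.exists_partition (hfin : M.IsFinite) (hM : M.IsFactor) {e : H →L[ℂ] H}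
    (he : e ∈ M) (hep : IsStarProjection e) (he0 : e ≠ 0) :
    ∃ S : Finset (H →L[ℂ] H), S.Nonempty ∧ (∀ u ∈ S, u ∈ M ∧ star u * u = e) ∧
      ∃ w ∈ M, IsPartialIsometry w ∧ w * e = w ∧ ∑ u ∈ S, u * star u + w * star w = 1 := by
  let P : Set (Set (H →L[ℂ] H)) :=
    {S | (∀ u ∈ S, u ∈ M ∧ star u * u = e) ∧ ∀ u ∈ S, ∀ v ∈ S, u ≠ v → star u * v = 0}
  obtain ⟨S, hS⟩ := zorn_subset P fun c hc hchain => by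
    refine ⟨⋃₀ c, ⟨?_, ?_⟩, fun s hs => Set.subset_sUnion_of_mem hs⟩
    · rintro u ⟨s, hs, hu⟩
      exact (hc hs).1 u hu
    · rintro u ⟨s, hs, hu⟩ v ⟨t, ht, hv⟩ huv
      rcases hchain.total hs ht with h | h
      · exact (hc ht).2 u (h hu) v hv huv
      · exact (hc hs).2 u hu v (h hv) huv
  have hfinS : S.Finite := by
    by_contra hinf
    have emb := Set.Infinite.natEmbedding S hinf
    exact he0 (hfin.eq_zero_of_sequence hep (u := fun i => (emb i : H →L[ℂ] H))
      (fun i => (hS.prop.1 _ (emb i).2).1) (fun i => (hS.prop.1 _ (emb i).2).2) fun i j hij =>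
        hS.prop.2 _ (emb i).2 _ (emb j).2 fun h => hij (emb.injective (Subtype.ext h)))
  have hins : ∀ v ∈ M, star v * v = e → (∀ u ∈ S, star u * v = 0) → v ∈ S := by
    intro v hv h1 h2
    have : insert v S ∈ P := by
      refine ⟨?_, ?_⟩
      · rintro u (rfl | hu)
        exacts [⟨hv, h1⟩, hS.prop.1 u hu]
      · rintro u (rfl | hu) u' (rfl | hu') h
        · exact absurd rfl h
        · simpa using congrArg star (h2 u' hu')
        · exact h2 u hu
        · exact hS.prop.2 u hu u' hu' h
    exact hS.le_of_ge this (Set.subset_insert v S) (Set.mem_insert v S)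
  have hSne : S.Nonempty := by
    by_contra h
    rw [Set.not_nonempty_iff_eq_empty] at h
    have := hins e he (by rw [hep.isSelfAdjoint.star_eq, hep.isIdempotentElem.eq]) (by simp [h])
    simp [h] at this
  have hup : ∀ u ∈ S, IsPartialIsometry u := fun u hu =>
    isPartialIsometry_of_initial ((hS.prop.1 u hu).2.symm ▸ hep)
  let r : H →L[ℂ] H := ∑ u ∈ hfinS.toFinset, u * star u
  have hru : ∀ u ∈ S, r * u = u := by
    intro u hu
    simp only [r, Finset.sum_mul]
    rw [Finset.sum_eq_single u]
    · exact hup u hu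
    · intro v hv hvu
      rw [mul_assoc, hS.prop.2 v (by simpa using hv) u hu hvu, mul_zero]
    · intro h; exact absurd (hfinS.mem_toFinset.2 hu) h
  have hrs : star r = r := by simp [r, star_sum]
  have hrp : IsStarProjection r :=
    ⟨by
      have : r * r = r := by
        conv_lhs => arg 2; simp only [r]
        rw [Finset.mul_sum]
        refine Finset.sum_congr rfl fun u hu => ?_
        rw [← mul_assoc, hru u (by simpa using hu)]
      exact this, hrs⟩
  have hrM : r ∈ M := sum_mem fun u hu =>
    mul_mem (hS.prop.1 u (by simpa using hu)).1 (star_mem (hS.prop.1 u (by simpa using hu)).1)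
  -- If `e` fitted into the remainder $1-r$, the maximal family could be enlarged; hence $1-r$ is
  -- equivalent to a subprojection of `e`.
  obtain ⟨w, hw, hwp, hwe, hwr, h | h⟩ := hM.comparison he (sub_mem (one_mem M) hrM) hep hrp.one_sub
  · exfalso
    have hz : ∀ u ∈ S, star u * w = 0 := fun u hu => by
      rw [← hwr, ← mul_assoc, mul_sub, mul_one, mul_eq_of_mul_eq hrp (hru u hu), sub_self, zero_mul]
    have := hz w (hins w hw h hz)
    rw [h] at this
    exact he0 this
  · refine ⟨hfinS.toFinset, by simpa using hSne, fun u hu => hS.prop.1 u (by simpa using hu), w, hw,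
      hwp, hwe, ?_⟩
    rw [h]
    exact add_sub_cancel r 1

end VonNeumannAlgebra

/-! ### Almost tracial normal states -/

namespace VonNeumannAlgebra

open ContinuousLinearMap

variable {H : Type*} [NormedAddCommGroup H] [InnerProductSpace ℂ H] [CompleteSpace H]
  {M : VonNeumannAlgebra H}

/-- The support projection of a vector state. -/
theorem exists_support (M : VonNeumannAlgebra H) (ξ : H) :
    ∃ p ∈ M, IsStarProjection p ∧ p ξ = ξ ∧ ∀ z ∈ M, z ξ = 0 → z * p = 0 := by
  -- The support is the projection onto the closure of $M'\xi$, since an element of `M` that kills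
  -- $\xi$ kills all of $M'\xi$.
  let K₀ : Submodule ℂ H :=
    { carrier := {η | ∃ y ∈ M.commutant, y ξ = η}
      add_mem' := by
        rintro _ _ ⟨y, hy, rfl⟩ ⟨z, hz, rfl⟩
        exact ⟨y + z, add_mem hy hz, rfl⟩
      zero_mem' := ⟨0, zero_mem _, rfl⟩
      smul_mem' := by
        rintro c _ ⟨y, hy, rfl⟩
        exact ⟨c • y, smul_mem c hy, rfl⟩ }
  let K := K₀.topologicalClosure
  have hKc : IsClosed (K : Set H) := Submodule.isClosed_topologicalClosure _
  have : CompleteSpace K := hKc.completeSpace_coe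
  have hξ : ξ ∈ K := Submodule.le_topologicalClosure _ ⟨1, one_mem _, rfl⟩
  refine ⟨K.starProjection, starProjection_mem fun y hy ζ hζ => ?_, isStarProjection_starProjection,
    Submodule.starProjection_eq_self_iff.2 hξ, fun z hz hz0 => ?_⟩
  · have : K ≤ K.comap (y : H →ₗ[ℂ] H) := by
      apply Submodule.topologicalClosure_minimal
      · rintro _ ⟨y', hy', rfl⟩
        exact Submodule.le_topologicalClosure _ ⟨y * y', mul_mem hy hy', rfl⟩
      · exact hKc.preimage y.continuous
    exact this hζ
  · have : K ≤ LinearMap.ker (z : H →ₗ[ℂ] H) := by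
      apply Submodule.topologicalClosure_minimal
      · rintro _ ⟨y, hy, rfl⟩
        change z (y ξ) = 0
        rw [apply_of_mem_commutant hz hy, hz0, map_zero]
      · exact isClosed_singleton.preimage z.continuous
    ext ζ
    exact this (K.starProjection_apply_mem ζ)

theorem exists_dyadic_norm_sq {x : H →L[ℂ] H} (hx : x ∈ M) (hx1 : ‖x‖ ≤ 1) :
    ∃ e : ℕ → H →L[ℂ] H, (∀ k, e k ∈ M ∧ IsStarProjection (e k) ∧
      ∀ z : H →L[ℂ] H, z * (star x * x) = 0 → z * e k = 0) ∧
      ∀ ξ, HasSum (fun k => ((2 : ℝ)⁻¹) ^ (k + 1) * ‖e k ξ‖ ^ 2) (‖x ξ‖ ^ 2) := by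
  have h0 : 0 ≤ star x * x := star_mul_self_nonneg x
  have h1 : star x * x ≤ 1 := by
    rw [← CStarAlgebra.norm_le_one_iff_of_nonneg _ h0, CStarRing.norm_star_mul_self]
    exact mul_le_one₀ hx1 (norm_nonneg _) hx1
  obtain ⟨e, he, hsum⟩ := exists_dyadic_expansion (mul_mem (star_mem hx) hx) h0 h1
  refine ⟨e, he, fun ξ => ?_⟩
  have h2 := Complex.hasSum_re (((hsum.mapL ((ContinuousLinearMap.apply ℂ H ξ))).mapL
    ((innerSL ℂ).flip ξ : H →L⋆[ℂ] ℂ)))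
  rw [norm_apply_sq_of_star_mul_self]
  have h3 : ∀ k, ((2 : ℝ)⁻¹) ^ (k + 1) * ‖e k ξ‖ ^ 2 =
      (inner ℂ ((((2 : ℝ)⁻¹) ^ (k + 1) • e k) ξ) ξ).re := fun k => by
    rw [(he k).2.1.norm_apply_sq, _root_.smul_apply, inner_smul_left_eq_smul,
      Complex.smul_re, smul_eq_mul]
  simp only [h3]
  exact h2

/-- With $x=u|x|$ and $x^*x=\sum 2^{-k-1}E_k$ one has $xx^*=\sum 2^{-k-1}uE_ku^*$. Each $uE_k$ is a
partial isometry with initial projection $E_k$ and final projection $uE_ku^*$, so the inequality can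
be summed digit by digit. -/
theorem norm_star_apply_sq_le_of_partialIsometry {e : H →L[ℂ] H} (hep : IsStarProjection e)
    {ξ : H} {C : ℝ}
    (h : ∀ u ∈ M, IsPartialIsometry u → e * u = u → u * e = u →
      ‖star u ξ‖ ^ 2 ≤ C * ‖u ξ‖ ^ 2) {x : H →L[ℂ] H} (hx : x ∈ M) (hex : e * x = x)
    (hxe : x * e = x) : ‖star x ξ‖ ^ 2 ≤ C * ‖x ξ‖ ^ 2 := by
  wlog hx1 : ‖x‖ ≤ 1 generalizing x
  · have hpos : 0 < ‖x‖ := by linarith [not_le.1 hx1]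
    have := this (x := ((‖x‖⁻¹ : ℝ) : ℂ) • x) (smul_mem _ hx) (by rw [mul_smul_comm, hex])
      (by rw [smul_mul_assoc, hxe]) (by
        rw [norm_smul, Complex.norm_real, norm_inv, norm_norm, inv_mul_cancel₀ hpos.ne'])
    rw [star_smul, _root_.smul_apply, _root_.smul_apply, norm_smul,
      norm_smul, norm_star, Complex.norm_real, mul_pow, mul_pow, mul_left_comm] at this
    exact le_of_mul_le_mul_left this (by rw [norm_inv, norm_norm]; positivity)
  obtain ⟨E, hE, hsum⟩ := exists_dyadic_norm_sq hx hx1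
  obtain ⟨u, hu, hup, hua, hia, hl, hr⟩ := exists_polar hx
  have hue : u * e = u := by
    have := hr (1 - e) (by rw [mul_sub, mul_one, hxe, sub_self])
    rw [mul_sub, mul_one, sub_eq_zero] at this
    exact this.symm
  have heu : e * u = u := by
    have := hl (1 - e) (by rw [sub_mul, one_mul, hex, sub_self])
    rw [sub_mul, one_mul, sub_eq_zero] at this
    exact this.symm
  have hstar : ‖star x ξ‖ = ‖x (star u ξ)‖ := by
    have h1 : star x = CFC.abs x * star u := by
      conv_lhs => rw [← hua]
      rw [star_mul, (CFC.abs_nonneg x).isSelfAdjoint.star_eq]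
    rw [h1, mul_apply_eq_comp, norm_abs_apply]
  rw [hstar]
  have hs1 := hsum (star u ξ)
  have hs2 := (hsum ξ).mul_left C
  refine hasSum_le (fun k => ?_) hs1 hs2
  obtain ⟨hkM, hkp, hk⟩ := hE k
  have hiE : star u * u * E k = E k := by
    have := hk (1 - star u * u) (by
      rw [← CFC.abs_mul_abs x, ← mul_assoc, sub_mul, one_mul, hia, sub_self, zero_mul])
    rw [sub_mul, one_mul, sub_eq_zero] at this
    exact this.symm
  have heE : e * E k = E k := by
    have := hk (1 - e) (by
      rw [sub_mul, one_mul, ← mul_assoc, mul_star_eq_of_mul_eq hep hxe, sub_self])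
    rw [sub_mul, one_mul, sub_eq_zero] at this
    exact this.symm
  have hEe : E k * e = E k := by
    have := mul_eq_of_mul_eq hep heE
    rwa [hkp.isSelfAdjoint.star_eq] at this
  have hv : star (u * E k) * (u * E k) = E k := by
    rw [star_mul, hkp.isSelfAdjoint.star_eq, mul_assoc, ← mul_assoc (star u), hiE,
      hkp.isIdempotentElem.eq]
  have h2 := h (u * E k) (mul_mem hu hkM)
    (isPartialIsometry_of_initial (by rw [hv]; exact hkp)) (by rw [← mul_assoc, heu])
    (by rw [mul_assoc, hEe])
  have h3 : ‖(u * E k) ξ‖ = ‖E k ξ‖ := norm_apply_eq_of_star_mul_self_eq (by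
    rw [hv, hkp.isSelfAdjoint.star_eq, hkp.isIdempotentElem.eq]) ξ
  rw [h3, star_mul, hkp.isSelfAdjoint.star_eq, mul_apply_eq_comp] at h2
  have : (0 : ℝ) < 2⁻¹ ^ (k + 1) := by positivity
  nlinarith

/-- First exhaustion: equivalent projections between which a vector state is controlled. -/
theorem IsFinite.exists_bounded_pair (hfin : M.IsFinite) (hM : M.IsFactor) {ξ : H} (hξ : ξ ≠ 0) :
    ∃ p₀ ∈ M, IsStarProjection p₀ ∧ (∀ z ∈ M, z * p₀ = z → z ξ = 0 → z = 0) ∧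
    ∃ t ∈ M, IsPartialIsometry t ∧ t ≠ 0 ∧ t * p₀ = t ∧ p₀ * t = t ∧
      ∀ v ∈ M, IsPartialIsometry v → v ≠ 0 → v * (star t * t) = v → t * star t * v = v →
        ‖v ξ‖ ^ 2 ≤ 2 * ‖star v ξ‖ ^ 2 := by
  obtain ⟨p₀, hp₀, hpp, hpξ, hsup⟩ := exists_support M ξ
  obtain ⟨S, w, hS, hw, hQ, hmax⟩ := exists_maximal_orthoFamily M fun u =>
    u * p₀ = u ∧ p₀ * u = u ∧ 2 * ‖star u ξ‖ ^ 2 ≤ ‖u ξ‖ ^ 2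
  have hwM : w ∈ M := hw.mem fun i => (hQ i i.2).1
  have hwp := hS.isPartialIsometry_sum hw
  have hwe : w * p₀ = w := by
    have := hw.mul_eq_zero_right (z := 1 - p₀) fun i => by
      rw [mul_sub, mul_one, (hQ i i.2).2.2.1, sub_self]
    rw [mul_sub, mul_one, sub_eq_zero] at this
    exact this.symm
  have hwf : p₀ * w = w := by
    have := hw.mul_eq_zero_left (z := 1 - p₀) fun i => by
      rw [sub_mul, one_mul, (hQ i i.2).2.2.2.1, sub_self]
    rw [sub_mul, one_mul, sub_eq_zero] at this
    exact this.symm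
  have hwξ : 2 * ‖star w ξ‖ ^ 2 ≤ ‖w ξ‖ ^ 2 :=
    hasSum_le (fun i : S => (hQ i i.2).2.2.2.2) ((hS.star.hasSum_norm_sq hw.star ξ).mul_left 2)
      (hS.hasSum_norm_sq hw ξ)
  have hpss : star p₀ * p₀ = p₀ := by rw [hpp.isSelfAdjoint.star_eq, hpp.isIdempotentElem.eq]
  obtain ⟨t, ht, hte, htf⟩ := hfin.exists_equiv_sub hM hp₀ hpp hpss
    (by rw [hpp.isSelfAdjoint.star_eq, hpp.isIdempotentElem.eq]) hwM hwp hwe hwf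
  have he' := hpp.sub_initial hwp hwe
  have hf' := hpp.sub_final hwp hwf
  have htp : IsPartialIsometry t := isPartialIsometry_of_initial (hte ▸ he')
  refine ⟨p₀, hp₀, hpp, fun z hz h1 h2 => by rw [← h1, hsup z hz h2], t, ht, htp, ?_, ?_, ?_,
    fun v hv hvp hv0 hvt htv => ?_⟩
  -- If nothing were left, `w` would be unitary on the corner of `p₀`, so
  -- $\|w\xi\|=\|\xi\|=\|w^*\xi\|$, against the factor `2` in `hwξ`.
  · rintro rfl
    rw [zero_mul, eq_comm, sub_eq_zero] at htf
    rw [mul_zero, eq_comm, sub_eq_zero] at hte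
    have h1 : ‖w ξ‖ = ‖ξ‖ := by
      rw [← hpξ]
      conv_rhs => rw [hpξ, ← hpξ]
      have := norm_apply_eq_of_star_mul_self_eq (x := w) (y := p₀) (by rw [← hte, hpss]) (p₀ ξ)
      rw [this, hpξ, hpξ]
    have h2 : ‖star w ξ‖ = ‖ξ‖ := by
      have := norm_apply_eq_of_star_mul_self_eq (x := star w) (y := p₀)
        (by rw [star_star, ← htf, hpss]) ξ
      rw [this, hpξ]
    rw [h1, h2] at hwξ
    have := norm_pos_iff.2 hξ
    nlinarith
  · rw [← htp.mul_star_mul, mul_assoc, hte, sub_mul, hpp.isIdempotentElem.eq, mul_assoc, hwe]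
  · have : p₀ * (t * star t * t) = t * star t * t := by
      rw [← mul_assoc, htf, mul_sub, hpp.isIdempotentElem.eq, ← mul_assoc, hwf]
    rwa [htp] at this
  · by_contra hlt
    rw [not_le] at hlt
    rw [hte] at hvt
    rw [htf] at htv
    refine hmax v hv hvp hv0 ⟨?_, ?_, hlt.le⟩ ?_ ?_
    · rw [← hvt, mul_assoc, sub_mul, hpp.isIdempotentElem.eq, mul_assoc (star w), hwe]
    · rw [← htv, ← mul_assoc, mul_sub, hpp.isIdempotentElem.eq, ← mul_assoc p₀, hwf]
    · rw [← hvt, mul_assoc, sub_mul, mul_star_eq_of_mul_eq hpp hwe, mul_assoc,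
        hwp.star_mul_mul_star, sub_self, mul_zero]
    · rw [← mul_eq_of_mul_eq hf' htv, mul_assoc, sub_mul, hwf, mul_assoc, hwp.mul_star_mul,
        sub_self, mul_zero]

/-- A finite factor has a corner on which some vector state is tracial up to a factor `1 + ε`. -/
theorem IsFinite.exists_almost_tracial_corner [Nontrivial H] (hfin : M.IsFinite)
    (hM : M.IsFactor) {ε : ℝ} (hε : 0 < ε) :
    ∃ ξ : H, ∃ e ∈ M, IsStarProjection e ∧ e ξ ≠ 0 ∧ ∀ x ∈ M, e * x = x → x * e = x →
      ‖star x ξ‖ ^ 2 ≤ (1 + ε) * ‖x ξ‖ ^ 2 := by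
  obtain ⟨ξ, hξ⟩ := exists_ne (0 : H)
  obtain ⟨p₀, hp₀, hpp, hfaith, t, ht, htp, ht0, htp₀, hp₀t, hbd⟩ := hfin.exists_bounded_pair hM hξ
  have hne : ∀ v ∈ M, v ≠ 0 → v * p₀ = v → p₀ * v = v → 0 < ‖v ξ‖ ^ 2 ∧ 0 < ‖star v ξ‖ ^ 2 := by
    intro v hv hv0 h1 h2
    constructor
    · have : v ξ ≠ 0 := fun h => hv0 (hfaith v hv h1 h)
      positivity
    · have : star v ξ ≠ 0 := fun h => hv0 (by
        simpa using hfaith (star v) (star_mem hv) (mul_eq_of_mul_eq hpp h2) h)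
      positivity
  have hcut : ∀ v : H →L[ℂ] H, v * (star t * t) = v → t * star t * v = v →
      v * p₀ = v ∧ p₀ * v = v := fun v h1 h2 => by
    constructor
    · rw [← h1, mul_assoc, mul_assoc, htp₀]
    · rw [← h2, ← mul_assoc, ← mul_assoc, hp₀t]
  -- The ratios of the vector state on the initial and final projections of partial isometries below
  -- `t`. They are positive by faithfulness below `p₀` and bounded by `2` by the first exhaustion.
  let R : Set ℝ := {r | ∃ v ∈ M, IsPartialIsometry v ∧ v ≠ 0 ∧ v * (star t * t) = v ∧
    t * star t * v = v ∧ r = ‖v ξ‖ ^ 2 / ‖star v ξ‖ ^ 2}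
  have hRb : BddAbove R := by
    refine ⟨2, ?_⟩
    rintro _ ⟨v, hv, hvp, hv0, h1, h2, rfl⟩
    obtain ⟨k1, k2⟩ := hcut v h1 h2
    rw [div_le_iff₀ (hne v hv hv0 k1 k2).2]
    exact hbd v hv hvp hv0 h1 h2
  have htR : ‖t ξ‖ ^ 2 / ‖star t ξ‖ ^ 2 ∈ R :=
    ⟨t, ht, htp, ht0, htp.mul_star_mul, htp, rfl⟩
  set μ := sSup R with hμ
  have hμ0 : 0 < μ := lt_of_lt_of_le
    (div_pos (hne t ht ht0 htp₀ hp₀t).1 (hne t ht ht0 htp₀ hp₀t).2) (le_csSup hRb htR)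
  have hup : ∀ v ∈ M, IsPartialIsometry v → v * (star t * t) = v → t * star t * v = v →
      ‖v ξ‖ ^ 2 ≤ μ * ‖star v ξ‖ ^ 2 := by
    intro v hv hvp h1 h2
    by_cases hv0 : v = 0
    · simp [hv0]
    obtain ⟨k1, k2⟩ := hcut v h1 h2
    rw [← div_le_iff₀ (hne v hv hv0 k1 k2).2]
    exact le_csSup hRb ⟨v, hv, hvp, hv0, h1, h2, rfl⟩
  set ν := μ / (1 + ε) with hν
  have hνμ : (1 + ε) * ν = μ := by rw [hν]; field_simp
  have hν0 : 0 < ν := by positivity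
  have hνlt : ν < μ := by nlinarith
  obtain ⟨_, ⟨v₀, hv₀, hv₀p, hv₀0, hv₀t, htv₀, rfl⟩, hlt⟩ := exists_lt_of_lt_csSup ⟨_, htR⟩ hνlt
  obtain ⟨k1, k2⟩ := hcut v₀ hv₀t htv₀
  rw [lt_div_iff₀ (hne v₀ hv₀ hv₀0 k1 k2).2] at hlt
  have hin := hv₀p.initial
  have hfi := hv₀p.final
  -- Second exhaustion: remove from `v₀`, whose ratio exceeds `ν`, a maximal family with ratios at
  -- most `ν`. What remains is nonzero, and below it all ratios lie between `ν` and
  -- $\mu=(1+\varepsilon)\nu$.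
  obtain ⟨S, w, hS, hw, hQ, hmax⟩ := exists_maximal_orthoFamily M fun u =>
    u * (star v₀ * v₀) = u ∧ v₀ * star v₀ * u = u ∧ ‖u ξ‖ ^ 2 ≤ ν * ‖star u ξ‖ ^ 2
  have hwM : w ∈ M := hw.mem fun i => (hQ i i.2).1
  have hwp := hS.isPartialIsometry_sum hw
  have hwe : w * (star v₀ * v₀) = w := by
    have := hw.mul_eq_zero_right (z := 1 - star v₀ * v₀) fun i => by
      rw [mul_sub, mul_one, (hQ i i.2).2.2.1, sub_self]
    rw [mul_sub, mul_one, sub_eq_zero] at this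
    exact this.symm
  have hwf : v₀ * star v₀ * w = w := by
    have := hw.mul_eq_zero_left (z := 1 - v₀ * star v₀) fun i => by
      rw [sub_mul, one_mul, (hQ i i.2).2.2.2.1, sub_self]
    rw [sub_mul, one_mul, sub_eq_zero] at this
    exact this.symm
  have hwξ : ‖w ξ‖ ^ 2 ≤ ν * ‖star w ξ‖ ^ 2 :=
    hasSum_le (fun i : S => (hQ i i.2).2.2.2.2) (hS.hasSum_norm_sq hw ξ)
      ((hS.star.hasSum_norm_sq hw.star ξ).mul_left ν)
  obtain ⟨s, hs, hse, hsf⟩ := hfin.exists_equiv_sub hM hv₀ hin rfl rfl hwM hwp hwe hwf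
  have he' := hin.sub_initial hwp hwe
  have hf' := hfi.sub_final hwp hwf
  have hsp : IsPartialIsometry s := isPartialIsometry_of_initial (hse ▸ he')
  have hs0 : s ≠ 0 := by
    rintro rfl
    rw [zero_mul, eq_comm, sub_eq_zero] at hsf
    rw [mul_zero, eq_comm, sub_eq_zero] at hse
    rw [← norm_apply_eq_of_star_mul_self_eq hse, ← norm_apply_eq_of_star_mul_self_eq
      (x := star v₀) (y := star w) (by simpa using hsf)] at hwξ
    linarith
  have hcut2 : ∀ v : H →L[ℂ] H, v * (star s * s) = v → s * star s * v = v →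
      v * (star v₀ * v₀) = v ∧ v₀ * star v₀ * v = v := fun v h1 h2 => by
    rw [hse] at h1
    rw [hsf] at h2
    constructor
    · rw [← h1, mul_assoc, sub_mul, hin.isIdempotentElem.eq, mul_assoc (star w), hwe]
    · rw [← h2, ← mul_assoc, mul_sub, hfi.isIdempotentElem.eq, ← mul_assoc (v₀ * star v₀), hwf]
  have hcut3 : ∀ v : H →L[ℂ] H, v * (star s * s) = v → s * star s * v = v →
      v * (star t * t) = v ∧ t * star t * v = v := fun v h1 h2 => by
    obtain ⟨h3, h4⟩ := hcut2 v h1 h2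
    constructor
    · rw [← h3, mul_assoc, mul_assoc, hv₀t]
    · rw [← h4, ← mul_assoc, ← mul_assoc, htv₀]
  have hlow : ∀ v ∈ M, IsPartialIsometry v → v * (star s * s) = v → s * star s * v = v →
      ν * ‖star v ξ‖ ^ 2 ≤ ‖v ξ‖ ^ 2 := by
    intro v hv hvp h1 h2
    by_cases hv0 : v = 0
    · simp [hv0]
    by_contra hlt'
    rw [not_le] at hlt'
    obtain ⟨h3, h4⟩ := hcut2 v h1 h2
    rw [hse] at h1
    rw [hsf] at h2
    refine hmax v hv hvp hv0 ⟨h3, h4, hlt'.le⟩ ?_ ?_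
    · rw [← h1, mul_assoc, sub_mul, mul_star_eq_of_mul_eq hin hwe, mul_assoc,
        hwp.star_mul_mul_star, sub_self, mul_zero]
    · rw [← mul_eq_of_mul_eq hf' h2, mul_assoc, sub_mul, hwf, mul_assoc, hwp.mul_star_mul,
        sub_self, mul_zero]
  have hsM : star s * s ∈ M := mul_mem (star_mem hs) hs
  refine ⟨ξ, star s * s, hsM, hsp.initial, ?_, fun x hx h1 h2 =>
    norm_star_apply_sq_le_of_partialIsometry hsp.initial (fun u hu hup' heu hue => ?_) hx h1 h2⟩
  · intro h0
    have k := hcut3 s hsp.mul_star_mul hsp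
    have := (hne s hs hs0 (hcut s k.1 k.2).1 (hcut s k.1 k.2).2).1
    rw [norm_apply_sq_of_star_mul_self, h0, inner_zero_left] at this
    exact lt_irrefl _ this
  -- Both $u^*u$ and $uu^*$ are equivalent, through $su$ and $suu^*$, to the same projection
  -- $suu^*s^*$. The bounds `ν` and `μ` for these two partial isometries compare the state on $uu^*$
  -- with that on $u^*u$.
  · have i1 : star (s * u) * (s * u) = star u * u := by
      rw [star_mul, mul_assoc, ← mul_assoc (star s), heu]
    have hss : s * (star s * s) = s := hsp.mul_star_mul
    have i2 : star (s * (u * star u)) * (s * (u * star u)) = u * star u := by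
      rw [star_mul, hup'.final.isSelfAdjoint.star_eq, mul_assoc, ← mul_assoc (star s),
        ← mul_assoc (star s * s), heu, hup'.final.isIdempotentElem.eq]
    have i3 : star (star (s * (u * star u))) * star (s * (u * star u)) =
        star (star (s * u)) * star (s * u) := by
      simp only [star_mul, star_star]
      calc s * (u * star u) * (u * star u * star s) =
          s * ((u * star u) * (u * star u)) * star s := by simp only [mul_assoc]
        _ = s * u * (star u * star s) := by
          rw [hup'.final.isIdempotentElem.eq]; simp only [mul_assoc]
    have l1 := hlow (s * u) (mul_mem hs hu)
      (isPartialIsometry_of_initial (by rw [i1]; exact hup'.initial)) (by rw [mul_assoc, hue])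
      (by rw [← mul_assoc, mul_assoc s, hss])
    have a1 : s * (u * star u) * (star s * s) = s * (u * star u) := by
      rw [mul_assoc, mul_assoc u, mul_eq_of_mul_eq hsp.initial heu]
    have a2 : s * star s * (s * (u * star u)) = s * (u * star u) := by
      rw [← mul_assoc, mul_assoc s, hss]
    have l2 := hup (s * (u * star u)) (mul_mem hs (mul_mem hu (star_mem hu)))
      (isPartialIsometry_of_initial (by rw [i2]; exact hup'.final)) (hcut3 _ a1 a2).1
      (hcut3 _ a1 a2).2
    rw [norm_apply_eq_of_star_mul_self_eq i1] at l1
    rw [norm_apply_eq_of_star_mul_self_eq (x := s * (u * star u)) (y := star u)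
      (by rw [i2, star_star]), norm_apply_eq_of_star_mul_self_eq i3, ← hνμ] at l2
    nlinarith

/-- A finite factor has normal states, given by finitely many vectors, that are tracial up to a
factor `1 + ε`. -/
theorem IsFinite.exists_almost_tracial_vectors [Nontrivial H] (hfin : M.IsFinite)
    (hM : M.IsFactor) {ε : ℝ} (hε : 0 < ε) :
    ∃ (n : ℕ) (η : Fin n → H), ∑ i, ‖η i‖ ^ 2 = 1 ∧
      ∀ x ∈ M, ∑ i, ‖star x (η i)‖ ^ 2 ≤ (1 + ε) * ∑ i, ‖x (η i)‖ ^ 2 := by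
  obtain ⟨ξ, e, he, hep, heξ, htr⟩ := hfin.exists_almost_tracial_corner hM hε
  have he0 : e ≠ 0 := by rintro rfl; simp at heξ
  obtain ⟨S, ⟨u₀, hu₀⟩, hSM, w, hw, hwp, hwe, hsum⟩ := hfin.exists_partition hM he hep he0
  -- The columns $c_i$ satisfy $\sum c_ic_i^*=1$ and $c_ie=c_i$; they spread the corner state to all
  -- of `M` as $x\mapsto\sum_i\langle x c_i\xi,c_i\xi\rangle$, up to normalization.
  let c : Option S → H →L[ℂ] H := fun i => i.elim w Subtype.val
  have hcM : ∀ i, c i ∈ M := by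
    rintro (_ | ⟨u, hu⟩)
    exacts [hw, (hSM u hu).1]
  have hce : ∀ i, c i * e = c i := by
    rintro (_ | ⟨u, hu⟩)
    · exact hwe
    · have hup : IsPartialIsometry u := isPartialIsometry_of_initial ((hSM u hu).2.symm ▸ hep)
      change u * e = u
      rw [← (hSM u hu).2]; exact hup.mul_star_mul
  have hc1 : ∑ i, c i * star (c i) = 1 := by
    rw [Fintype.sum_option, ← hsum, add_comm]
    congr 1
    exact Finset.sum_coe_sort S fun u => u * star u
  have hnorm : ∀ ζ : H, ∑ i, ‖star (c i) ζ‖ ^ 2 = ‖ζ‖ ^ 2 := fun ζ => by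
    have h1 : ∀ i, ‖star (c i) ζ‖ ^ 2 = (inner ℂ ((c i * star (c i)) ζ) ζ).re := fun i => by
      rw [norm_apply_sq_of_star_mul_self, star_star]
    simp only [h1]
    rw [← Complex.re_sum, ← sum_inner, ← _root_.sum_apply, hc1]
    have := inner_self_eq_norm_sq_to_K (𝕜 := ℂ) ζ
    rw [one_apply_eq_self, this]
    norm_cast
  have hineq : ∀ x ∈ M, ∑ i, ‖star x (c i ξ)‖ ^ 2 ≤ (1 + ε) * ∑ i, ‖x (c i ξ)‖ ^ 2 := by
    intro x hx
    have h1 : ∑ i, ‖star x (c i ξ)‖ ^ 2 = ∑ j, ∑ i, ‖star (c j) (star x (c i ξ))‖ ^ 2 := by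
      rw [Finset.sum_comm]
      exact Finset.sum_congr rfl fun i _ => (hnorm _).symm
    have h2 : ∑ i, ‖x (c i ξ)‖ ^ 2 = ∑ i, ∑ j, ‖star (c j) (x (c i ξ))‖ ^ 2 :=
      Finset.sum_congr rfl fun i _ => (hnorm _).symm
    rw [h1, h2, Finset.mul_sum]
    refine Finset.sum_le_sum fun j _ => ?_
    rw [Finset.mul_sum]
    refine Finset.sum_le_sum fun i _ => ?_
    -- Each matrix entry $c_i^*xc_j$ lies in the corner $eMe$, where the state is almost tracial.
    have h3 := htr (star (c i) * x * c j) (mul_mem (mul_mem (star_mem (hcM i)) hx) (hcM j))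
      (by rw [← mul_assoc, ← mul_assoc, mul_star_eq_of_mul_eq hep (hce i)])
      (by rw [mul_assoc, hce j])
    have h4 : star (star (c i) * x * c j) = star (c j) * (star x * c i) := by
      simp only [star_mul, star_star]
    rw [h4] at h3
    exact h3
  set σ := ∑ i, ‖c i ξ‖ ^ 2 with hσ
  have hσ0 : 0 < σ := by
    refine lt_of_lt_of_le ?_ (Finset.single_le_sum (f := fun i => ‖c i ξ‖ ^ 2)
      (fun i _ => by positivity) (Finset.mem_univ (some ⟨u₀, hu₀⟩)))
    have h1 : ‖c (some ⟨u₀, hu₀⟩) ξ‖ = ‖e ξ‖ :=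
      norm_apply_eq_of_star_mul_self_eq (x := u₀) (y := e) (by
        rw [(hSM u₀ hu₀).2, hep.isSelfAdjoint.star_eq, hep.isIdempotentElem.eq]) ξ
    simp only [h1]
    positivity
  let φ := Fintype.equivFin (Option S)
  have hsmul : ∀ ζ : H, ‖(((Real.sqrt σ)⁻¹ : ℝ) : ℂ) • ζ‖ ^ 2 = σ⁻¹ * ‖ζ‖ ^ 2 := fun ζ => by
    rw [norm_smul, mul_pow, Complex.norm_real, Real.norm_eq_abs, sq_abs, inv_pow,
      Real.sq_sqrt hσ0.le]
  refine ⟨Fintype.card (Option S), fun i => (((Real.sqrt σ)⁻¹ : ℝ) : ℂ) • c (φ.symm i) ξ, ?_,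
    fun x hx => ?_⟩
  · simp only [hsmul]
    rw [φ.symm.sum_comp fun i => σ⁻¹ * ‖c i ξ‖ ^ 2, ← Finset.mul_sum, ← hσ,
      inv_mul_cancel₀ hσ0.ne']
  · simp only [map_smul, hsmul]
    rw [φ.symm.sum_comp fun i => σ⁻¹ * ‖star x (c i ξ)‖ ^ 2,
      φ.symm.sum_comp fun i => σ⁻¹ * ‖x (c i ξ)‖ ^ 2, ← Finset.mul_sum, ← Finset.mul_sum,
      mul_left_comm]
    exact mul_le_mul_of_nonneg_left (hineq x hx) (by positivity)

end VonNeumannAlgebra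

/-! ### Construction of the trace -/

theorem Ultrafilter.exists_tendsto_of_norm_le {ι : Type*} (l : Ultrafilter ι) {f : ι → ℂ} {C : ℝ}
    (hf : ∀ i, ‖f i‖ ≤ C) : ∃ a, Tendsto f l (𝓝 a) := by
  obtain ⟨a, -, ha⟩ := (isCompact_closedBall (0 : ℂ) C).ultrafilter_le_nhds (l.map f) (by
    rw [le_principal_iff]
    exact Filter.mem_map.2 (Filter.univ_mem' fun i => by simpa using hf i))
  exact ⟨a, ha⟩

namespace VonNeumannAlgebra

open ContinuousLinearMap

variable {H : Type*} [NormedAddCommGroup H] [InnerProductSpace ℂ H] [CompleteSpace H]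
  {M : VonNeumannAlgebra H}

/-- A normalized vector state, given by finitely many vectors, that is tracial on `M` up to a
factor `2`. -/
def IsTwoTracial (M : VonNeumannAlgebra H) {n : ℕ} (η : Fin n → H) : Prop :=
  ∑ i, ‖η i‖ ^ 2 = 1 ∧ ∀ x ∈ M, ∑ i, ‖star x (η i)‖ ^ 2 ≤ 2 * ∑ i, ‖x (η i)‖ ^ 2

/-- `k` is the number of full copies of `e` in a partition of the unit; it depends on `e` alone. If
$q$ is the value of the state at `e`, each copy has value between $q/2$ and $2q$ and the remainder
at most $2q$, whence $kq/2\le1\le 2kq+2q\le4kq$. -/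
theorem IsFinite.exists_dimension_bound (hfin : M.IsFinite) (hM : M.IsFactor) {e : H →L[ℂ] H}
    (he : e ∈ M) (hep : IsStarProjection e) (he0 : e ≠ 0) :
    ∃ k : ℝ, 0 < k ∧ ∀ (n : ℕ) (η : Fin n → H), IsTwoTracial M η →
      1 ≤ 4 * k * ∑ i, ‖e (η i)‖ ^ 2 ∧ k * ∑ i, ‖e (η i)‖ ^ 2 ≤ 2 := by
  obtain ⟨S, hS, hSM, w, hw, hwp, hwe, hsum⟩ := hfin.exists_partition hM he hep he0
  have hk : (1 : ℝ) ≤ S.card := by exact_mod_cast hS.card_pos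
  refine ⟨S.card, by linarith, fun n η hη => ?_⟩
  obtain ⟨h1, h2⟩ := hη
  have hnorm : ∀ ζ : H, ∑ u ∈ S, ‖star u ζ‖ ^ 2 + ‖star w ζ‖ ^ 2 = ‖ζ‖ ^ 2 := fun ζ => by
    simp only [norm_apply_sq_of_star_mul_self (star _), star_star]
    rw [← Complex.re_sum, ← sum_inner, ← _root_.sum_apply, ← Complex.add_re, ← inner_add_left,
      ← _root_.add_apply, hsum]
    have := inner_self_eq_norm_sq_to_K (𝕜 := ℂ) ζ
    rw [one_apply_eq_self, this]
    norm_cast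
  have hu : ∀ u ∈ S, ∀ ζ, ‖u ζ‖ = ‖e ζ‖ := fun u hu =>
    norm_apply_eq_of_star_mul_self_eq (by
      rw [(hSM u hu).2, hep.isSelfAdjoint.star_eq, hep.isIdempotentElem.eq])
  have hwn : ∀ ζ, ‖w ζ‖ ^ 2 ≤ ‖e ζ‖ ^ 2 := fun ζ => by
    have k1 := (hep.sub_initial hwp hwe).norm_apply_sq ζ
    rw [_root_.sub_apply, inner_sub_left, Complex.sub_re, ← norm_apply_sq_of_star_mul_self,
      ← hep.norm_apply_sq] at k1
    nlinarith [sq_nonneg ‖e ζ - (star w * w) ζ‖]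
  set q := ∑ i, ‖e (η i)‖ ^ 2 with hq
  have hq0 : 0 ≤ q := Finset.sum_nonneg fun i _ => by positivity
  have htot : ∑ u ∈ S, ∑ i, ‖star u (η i)‖ ^ 2 + ∑ i, ‖star w (η i)‖ ^ 2 = 1 := by
    rw [← h1, Finset.sum_comm, ← Finset.sum_add_distrib]
    exact Finset.sum_congr rfl fun i _ => hnorm (η i)
  have hw2 : ∑ i, ‖star w (η i)‖ ^ 2 ≤ 2 * q :=
    (h2 w hw).trans (mul_le_mul_of_nonneg_left (Finset.sum_le_sum fun i _ => hwn _) (by norm_num))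
  have hw3 : 0 ≤ ∑ i, ‖star w (η i)‖ ^ 2 := Finset.sum_nonneg fun i _ => by positivity
  have hqu : ∀ u ∈ S, ∑ i, ‖u (η i)‖ ^ 2 = q := fun u hu' =>
    Finset.sum_congr rfl fun i _ => by rw [hu u hu']
  have hup : ∑ u ∈ S, ∑ i, ‖star u (η i)‖ ^ 2 ≤ S.card * (2 * q) := by
    rw [← nsmul_eq_mul]
    refine Finset.sum_le_card_nsmul _ _ _ fun u hu' => ?_
    rw [← hqu u hu']
    exact h2 u (hSM u hu').1
  have hlow : S.card * (q / 2) ≤ ∑ u ∈ S, ∑ i, ‖star u (η i)‖ ^ 2 := by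
    rw [← nsmul_eq_mul]
    refine Finset.card_nsmul_le_sum _ _ _ fun u hu' => ?_
    have := h2 (star u) (star_mem (hSM u hu').1)
    rw [star_star, hqu u hu'] at this
    linarith
  constructor <;> nlinarith

/-- On a projection both states are determined by its dimension up to bounded factors: $kq\le2\le
8kq'$. The dyadic expansion of $x^*x$ passes this to all `x`. -/
theorem IsFinite.sum_norm_sq_le (hfin : M.IsFinite) (hM : M.IsFactor) {n m : ℕ} {η : Fin n → H}
    {η' : Fin m → H} (h : IsTwoTracial M η) (h' : IsTwoTracial M η') {x : H →L[ℂ] H} (hx : x ∈ M) :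
    ∑ i, ‖x (η i)‖ ^ 2 ≤ 8 * ∑ i, ‖x (η' i)‖ ^ 2 := by
  wlog hx1 : ‖x‖ ≤ 1 generalizing x
  · have hpos : 0 < ‖x‖ := by linarith [not_le.1 hx1]
    have := this (x := ((‖x‖⁻¹ : ℝ) : ℂ) • x) (smul_mem _ hx) (by
        rw [norm_smul, Complex.norm_real, norm_inv, norm_norm, inv_mul_cancel₀ hpos.ne'])
    simp only [_root_.smul_apply, norm_smul, mul_pow, ← Finset.mul_sum] at this
    rw [mul_left_comm] at this
    exact le_of_mul_le_mul_left this (by rw [Complex.norm_real, norm_inv, norm_norm]; positivity)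
  obtain ⟨e, he, hsum⟩ := exists_dyadic_norm_sq hx hx1
  have s1 := hasSum_sum (s := Finset.univ) fun i _ => hsum (η i)
  have s2 := (hasSum_sum (s := Finset.univ) fun i _ => hsum (η' i)).mul_left 8
  refine hasSum_le (fun k => ?_) s1 s2
  rw [← Finset.mul_sum, ← Finset.mul_sum, mul_left_comm]
  refine mul_le_mul_of_nonneg_left ?_ (by positivity)
  by_cases h0 : e k = 0
  · simp [h0]
  obtain ⟨c, hc, hc'⟩ := hfin.exists_dimension_bound hM (he k).1 (he k).2.1 h0
  have h1 := (hc' n η h).2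
  have h2 := (hc' m η' h').1
  have : c * ∑ i, ‖e k (η i)‖ ^ 2 ≤ c * (8 * ∑ i, ‖e k (η' i)‖ ^ 2) := by linarith
  exact le_of_mul_le_mul_left this hc

/-- A trace on `M` that is equivalent to the vector state given by `η`. -/
structure IsTrace (M : VonNeumannAlgebra H) {n : ℕ} (η : Fin n → H)
    (τ : (H →L[ℂ] H) →ₗ[ℂ] ℂ) : Prop where
  map_one : τ 1 = 1
  map_star : ∀ x, τ (star x) = star (τ x)
  nonneg : ∀ x, 0 ≤ (τ (star x * x)).re
  comm : ∀ x ∈ M, ∀ y ∈ M, τ (x * y) = τ (y * x)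
  le : ∀ x ∈ M, (τ (star x * x)).re ≤ 8 * ∑ i, ‖x (η i)‖ ^ 2
  ge : ∀ x ∈ M, ∑ i, ‖x (η i)‖ ^ 2 ≤ 8 * (τ (star x * x)).re

/-- A finite factor has a trace. -/
theorem IsFinite.exists_trace [Nontrivial H] (hfin : M.IsFinite) (hM : M.IsFactor) :
    ∃ (n : ℕ) (η : Fin n → H) (τ : (H →L[ℂ] H) →ₗ[ℂ] ℂ), IsTrace M η τ := by
  -- As $\varepsilon=1/(m+1)\le1$, every state of the sequence is tracial up to a factor `2`.
  choose n η h1 h2 using fun m : ℕ =>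
    hfin.exists_almost_tracial_vectors hM (ε := 1 / ((m : ℝ) + 1)) (by positivity)
  have htt : ∀ m, IsTwoTracial M (η m) := fun m => ⟨h1 m, fun x hx => (h2 m x hx).trans
    (mul_le_mul_of_nonneg_right (by
      have : 1 / ((m : ℝ) + 1) ≤ 1 := by
        rw [div_le_one (by positivity)]; linarith [(Nat.cast_nonneg m : (0 : ℝ) ≤ m)]
      linarith) (Finset.sum_nonneg fun i _ => by positivity))⟩
  let ψ : ℕ → (H →L[ℂ] H) → ℂ := fun m x => ∑ i, inner ℂ (η m i) (x (η m i))
  have hψle : ∀ x m, ‖ψ m x‖ ≤ ‖x‖ := fun x m => by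
    calc ‖ψ m x‖ ≤ ∑ i, ‖x‖ * ‖η m i‖ ^ 2 := by
          refine norm_sum_le_of_le _ fun i _ => (norm_inner_le_norm _ _).trans ?_
          have := x.le_opNorm (η m i)
          nlinarith [norm_nonneg (η m i)]
      _ = ‖x‖ := by rw [← Finset.mul_sum, h1, mul_one]
  let 𝒰 : Ultrafilter ℕ := hyperfilter ℕ
  have h𝒰 : (𝒰 : Filter ℕ) ≤ atTop := Nat.hyperfilter_le_atTop
  choose t ht using fun x => 𝒰.exists_tendsto_of_norm_le (hψle x)
  let τ : (H →L[ℂ] H) →ₗ[ℂ] ℂ :=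
    { toFun := t
      map_add' := fun x y => tendsto_nhds_unique (ht (x + y)) (by
        have := (ht x).add (ht y)
        refine this.congr fun m => ?_
        simp only [ψ, _root_.add_apply, inner_add_right, Finset.sum_add_distrib])
      map_smul' := fun c x => tendsto_nhds_unique (ht (c • x)) (by
        have := (ht x).const_mul c
        refine this.congr fun m => ?_
        simp only [ψ, _root_.smul_apply, inner_smul_right, Finset.mul_sum]) }
  have hq : ∀ m x, ψ m (star x * x) = ((∑ i, ‖x (η m i)‖ ^ 2 : ℝ) : ℂ) := fun m x => by
    simp only [ψ, mul_apply_eq_comp, star_eq_adjoint, adjoint_inner_right,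
      inner_self_eq_norm_sq_to_K]
    push_cast
    rfl
  have hQ : ∀ x, Tendsto (fun m => ∑ i, ‖x (η m i)‖ ^ 2) 𝒰 (𝓝 (τ (star x * x)).re) := fun x => by
    have := (Complex.continuous_re.tendsto _).comp (ht (star x * x))
    refine this.congr fun m => ?_
    simp only [Function.comp_apply, hq, Complex.ofReal_re]
  have him : ∀ x, τ (star x * x) = ((τ (star x * x)).re : ℂ) := fun x => by
    refine tendsto_nhds_unique (ht (star x * x)) ?_
    have := (Complex.continuous_ofReal.tendsto _).comp (hQ x)
    refine this.congr fun m => ?_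
    simp only [Function.comp_apply, hq]
  -- The factors $1+1/(m+1)$ tend to `1` along the ultrafilter, so traciality is exact in the limit.
  have hQle : ∀ x ∈ M, (τ (star (star x) * star x)).re ≤ (τ (star x * x)).re := fun x hx => by
    have hε : Tendsto (fun m : ℕ => 1 + 1 / ((m : ℝ) + 1)) 𝒰 (𝓝 (1 + 0)) :=
      (tendsto_const_nhds.add tendsto_one_div_add_atTop_nhds_zero_nat).mono_left h𝒰
    have := hε.mul (hQ x)
    rw [add_zero, one_mul] at this
    exact le_of_tendsto_of_tendsto' (hQ (star x)) this fun m => h2 m x hx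
  have hQeq : ∀ x ∈ M, τ (star x * x) = τ (x * star x) := fun x hx => by
    have e1 := hQle x hx
    have e2 := hQle (star x) (star_mem hx)
    have e3 := him (star x)
    simp only [star_star] at e1 e2 e3
    rw [him x, e3, le_antisymm e2 e1]
  refine ⟨n 0, η 0, τ, ?_, fun x => ?_, fun x => ?_, fun x hx y hy => ?_, fun x hx => ?_,
    fun x hx => ?_⟩
  · refine tendsto_nhds_unique (ht 1) (tendsto_const_nhds.congr fun m => ?_)
    have := hq m 1
    rw [star_one, one_mul] at this
    rw [this]
    simp only [one_apply_eq_self, h1, Complex.ofReal_one]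
  · refine tendsto_nhds_unique (ht (star x)) ?_
    have := (continuous_star.tendsto _).comp (ht x)
    refine this.congr fun m => ?_
    simp only [ψ, Function.comp_apply, star_sum, star_eq_adjoint, adjoint_inner_right]
    exact Finset.sum_congr rfl fun i _ => inner_conj_symm _ _
  · exact ge_of_tendsto' (hQ x) fun m => Finset.sum_nonneg fun i _ => by positivity
  -- Polarization of $\tau(x^*x)=\tau(xx^*)$ at $a+b$ and $a+ib$.
  · have key : ∀ a ∈ M, ∀ b ∈ M, τ (star a * b) = τ (b * star a) := by
      intro a ha b hb
      have e1 := hQeq (a + b) (add_mem ha hb)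
      have e2 := hQeq (a + Complex.I • b) (add_mem ha (smul_mem _ hb))
      have ea := hQeq a ha
      have eb := hQeq b hb
      simp only [star_add, star_smul, add_mul, mul_add, map_add, smul_mul_assoc, mul_smul_comm,
        map_smul, smul_eq_mul, RCLike.star_def, Complex.conj_I] at e1 e2
      have e3 : τ (star a * b) + τ (star b * a) = τ (b * star a) + τ (a * star b) := by
        linear_combination e1 - ea - eb
      have e4 : Complex.I * (τ (star a * b) - τ (star b * a)) =
          Complex.I * (τ (b * star a) - τ (a * star b)) := by
        linear_combination e2 - ea + (Complex.I * Complex.I) * eb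
      have e5 := mul_left_cancel₀ Complex.I_ne_zero e4
      linear_combination (e3 + e5) / 2
    have := key (star x) (star_mem hx) y hy
    rwa [star_star] at this
  · exact le_of_tendsto' (hQ x) fun m => hfin.sum_norm_sq_le hM (htt m) (htt 0) hx
  · exact ge_of_tendsto' ((hQ x).const_mul 8) fun m => hfin.sum_norm_sq_le hM (htt 0) (htt m) hx

end VonNeumannAlgebra

/-! ### Weak operator limits -/

section WeakLimits

open ContinuousLinearMap ContinuousLinearMapWOT

variable {H : Type*} [NormedAddCommGroup H] [InnerProductSpace ℂ H] {ι : Type*}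
  {l : Filter ι} {x : ι → H →L[ℂ] H} {a : H →L[ℂ] H}

/-- Convergence in the weak operator topology. -/
def TendstoWeakly (x : ι → H →L[ℂ] H) (l : Filter ι) (a : H →L[ℂ] H) : Prop :=
  ∀ ξ (f : H →L[ℂ] ℂ), Tendsto (fun i => f (x i ξ)) l (𝓝 (f (a ξ)))

namespace TendstoWeakly

theorem const_mul (h : TendstoWeakly x l a) (y : H →L[ℂ] H) :
    TendstoWeakly (fun i => y * x i) l (y * a) := fun ξ f => h ξ (f ∘L y)

theorem mul_const (h : TendstoWeakly x l a) (y : H →L[ℂ] H) :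
    TendstoWeakly (fun i => x i * y) l (a * y) := fun ξ f => h (y ξ) f

theorem sub {y : ι → H →L[ℂ] H} {b : H →L[ℂ] H} (h : TendstoWeakly x l a)
    (h' : TendstoWeakly y l b) : TendstoWeakly (fun i => x i - y i) l (a - b) := fun ξ f => by
  simpa using (h ξ f).sub (h' ξ f)

theorem unique [l.NeBot] {b : H →L[ℂ] H} (h : TendstoWeakly x l a) (h' : TendstoWeakly x l b) :
    a = b := by
  ext ξ
  refine ext_inner_left ℂ fun ζ => ?_
  exact tendsto_nhds_unique (h ξ (innerSL ℂ ζ)) (h' ξ (innerSL ℂ ζ))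

theorem congr' {y : ι → H →L[ℂ] H} (h : TendstoWeakly x l a) (hxy : x =ᶠ[l] y) :
    TendstoWeakly y l a := fun ξ f =>
  (h ξ f).congr' (hxy.mono fun i hi => by rw [hi])

theorem star [CompleteSpace H] (h : TendstoWeakly x l a) :
    TendstoWeakly (fun i => star (x i)) l (star a) := by
  intro ξ f
  obtain ⟨ζ, rfl⟩ := (InnerProductSpace.toDual ℂ H).surjective f
  have h1 := (continuous_star.tendsto _).comp (h ζ (innerSL ℂ ξ))
  have h2 : ∀ y : H →L[ℂ] H, InnerProductSpace.toDual ℂ H ζ (Star.star y ξ) =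
      Star.star (innerSL ℂ ξ (y ζ)) := fun y => by
    rw [InnerProductSpace.toDual_apply_apply, star_eq_adjoint, adjoint_inner_right, innerSL_apply_apply]
    exact (inner_conj_symm _ _).symm
  simp only [h2]
  exact h1

theorem mem [CompleteSpace H] [l.NeBot] {M : VonNeumannAlgebra H} (h : TendstoWeakly x l a) (hx : ∀ i, x i ∈ M) :
    a ∈ M := by
  refine VonNeumannAlgebra.mem_of_commute fun y hy => ?_
  refine (h.const_mul y).unique ((h.mul_const y).congr' (Eventually.of_forall fun i => ?_))
  exact VonNeumannAlgebra.mul_eq_of_mem_commutant (hx i) hy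

end TendstoWeakly

theorem tendstoWeakly_iff : TendstoWeakly x l a ↔
    Tendsto (fun i => (ofCLM (x i) : H →WOT[ℂ] H)) l (𝓝 (ofCLM a)) :=
  tendsto_iff_forall_dual_apply_tendsto.symm

/-- Bounded families have weak limits along ultrafilters. -/
theorem Ultrafilter.exists_tendstoWeakly [CompleteSpace H] (l : Ultrafilter ι) {C : ℝ} (hx : ∀ i, ‖x i‖ ≤ C) :
    ∃ a, TendstoWeakly x l a := by
  have hb : ∀ v w i, ‖(inner ℂ (x i v) w : ℂ)‖ ≤ C * ‖v‖ * ‖w‖ := fun v w i =>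
    (norm_inner_le_norm _ _).trans (mul_le_mul_of_nonneg_right ((x i).le_of_opNorm_le (hx i) v)
      (norm_nonneg _))
  choose B hB using fun v w => l.exists_tendsto_of_norm_le (hb v w)
  let L : H →ₗ⋆[ℂ] H →ₗ[ℂ] ℂ := LinearMap.mk₂'ₛₗ (starRingEnd ℂ) (RingHom.id ℂ) B
    (fun v v' w => tendsto_nhds_unique (hB _ _) (by
      simpa only [map_add, inner_add_left] using (hB v w).add (hB v' w)))
    (fun c v w => tendsto_nhds_unique (hB _ _) (by
      simpa only [map_smul, inner_smul_left, smul_eq_mul] using (hB v w).const_mul (starRingEnd ℂ c)))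
    (fun v w w' => tendsto_nhds_unique (hB _ _) (by
      simpa only [inner_add_right] using (hB v w).add (hB v w')))
    (fun c v w => tendsto_nhds_unique (hB _ _) (by
      simpa only [inner_smul_right, smul_eq_mul, RingHom.id_apply] using (hB v w).const_mul c))
  let B' : H →L⋆[ℂ] H →L[ℂ] ℂ := L.mkContinuous₂ C fun v w =>
    le_of_tendsto (hB v w).norm (Eventually.of_forall (hb v w))
  refine ⟨InnerProductSpace.continuousLinearMapOfBilin B', fun ξ f => ?_⟩
  obtain ⟨ζ, rfl⟩ := (InnerProductSpace.toDual ℂ H).surjective f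
  have h1 := (continuous_star.tendsto _).comp (hB ξ ζ)
  have h2 : ∀ η : H, InnerProductSpace.toDual ℂ H ζ η = star (inner ℂ η ζ : ℂ) := fun η => by
    rw [InnerProductSpace.toDual_apply_apply]
    exact (inner_conj_symm _ _).symm
  simp only [h2, InnerProductSpace.continuousLinearMapOfBilin_apply]
  exact h1

end WeakLimits

/-! ### Faithfulness and weak continuity of the trace -/

namespace VonNeumannAlgebra

open ContinuousLinearMap

variable {H : Type*} [NormedAddCommGroup H] [InnerProductSpace ℂ H] [CompleteSpace H]
  {M : VonNeumannAlgebra H} {n : ℕ} {η : Fin n → H} {τ : (H →L[ℂ] H) →ₗ[ℂ] ℂ}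

namespace IsTrace

theorem re_star_mul_self_comm (h : IsTrace M η τ) {x : H →L[ℂ] H} (hx : x ∈ M) :
    (τ (star (star x) * star x)).re = (τ (star x * x)).re := by
  rw [star_star, h.comm x hx _ (star_mem hx)]

/-- This is $\tau((x-\tau(x))^*(x-\tau(x)))\ge0$. -/
theorem sq_norm_le (h : IsTrace M η τ) (x : H →L[ℂ] H) : ‖τ x‖ ^ 2 ≤ (τ (star x * x)).re := by
  have h1 := h.nonneg (x - τ x • 1)
  have h2 : τ (star (x - τ x • 1) * (x - τ x • 1)) = τ (star x * x) - star (τ x) * τ x := by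
    simp only [star_sub, star_smul, star_one, sub_mul, mul_sub, smul_mul_assoc, mul_smul_comm,
      one_mul, mul_one, map_sub, map_smul, smul_eq_mul, h.map_one, h.map_star]
    ring
  have h3 : star (τ x) * τ x = ((‖τ x‖ ^ 2 : ℝ) : ℂ) := by
    rw [RCLike.star_def, Complex.conj_mul']; norm_cast
  rw [h2, h3, Complex.sub_re, Complex.ofReal_re] at h1
  linarith

/-- The trace of a factor is faithful. -/
theorem eq_zero (h : IsTrace M η τ) (hM : M.IsFactor) {x : H →L[ℂ] H} (hx : x ∈ M)
    (h0 : τ (star x * x) = 0) : x = 0 := by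
  -- Traciality moves adjoints across: $x$ null implies $x^*$ null, then $y^*x^*$ null because its
  -- norm on each `η i` is at most $\|y^*\|$ times that of $x^*$, and finally $xy$ null.
  have hη : ∀ y ∈ M, ∀ i, x (y (η i)) = 0 := by
    intro y hy i
    have h1 : ∑ i, ‖star x (η i)‖ ^ 2 ≤ 0 := by
      have := h.ge (star x) (star_mem hx)
      rwa [h.re_star_mul_self_comm hx, h0, Complex.zero_re, mul_zero] at this
    have h2 : ∑ i, ‖(star y * star x) (η i)‖ ^ 2 ≤ 0 := by
      calc ∑ i, ‖(star y * star x) (η i)‖ ^ 2 ≤ ∑ i, ‖star y‖ ^ 2 * ‖star x (η i)‖ ^ 2 := by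
            refine Finset.sum_le_sum fun i _ => ?_
            rw [← mul_pow]
            exact pow_le_pow_left₀ (norm_nonneg _) ((star y).le_opNorm _) 2
        _ ≤ 0 := by
            rw [← Finset.mul_sum]
            exact mul_nonpos_of_nonneg_of_nonpos (by positivity) h1
    have h3 := h.le (star (x * y)) (star_mem (mul_mem hx hy))
    rw [h.re_star_mul_self_comm (mul_mem hx hy), star_mul] at h3
    have h4 := h.ge (x * y) (mul_mem hx hy)
    rw [star_mul] at h4
    have h5 : ∑ i, ‖(x * y) (η i)‖ ^ 2 ≤ 0 := by linarith
    have h6 := (Finset.single_le_sum (f := fun i => ‖(x * y) (η i)‖ ^ 2)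
      (fun i _ => by positivity) (Finset.mem_univ i)).trans h5
    have h7 : ‖(x * y) (η i)‖ = 0 := by
      have : 0 ≤ ‖(x * y) (η i)‖ := norm_nonneg _
      have h8 : ‖(x * y) (η i)‖ ^ 2 = 0 := le_antisymm h6 (by positivity)
      exact pow_eq_zero_iff two_ne_zero |>.1 h8
    exact norm_eq_zero.1 h7
  obtain ⟨i, hi⟩ : ∃ i, η i ≠ 0 := by
    by_contra! hcon
    have := h.le 1 (one_mem M)
    rw [star_one, one_mul, h.map_one] at this
    simp [hcon] at this
    linarith
  by_contra hx0
  -- Now $xMp=0$ for the rank-one operator `p` on a nonzero `η i`, which is impossible in a factor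
  -- unless $x=0$.
  let p : H →L[ℂ] H := InnerProductSpace.rankOne ℂ (η i) (η i)
  have hp : p (η i) ≠ 0 := by
    simp only [p, InnerProductSpace.rankOne_apply]
    exact smul_ne_zero (inner_self_ne_zero.2 hi) hi
  obtain ⟨y, hy, hne⟩ := hM.exists_mul_mul_ne_zero (p := p) hx (fun h => hp (by simp [h])) hx0
  apply hne
  ext ζ
  simp only [p, mul_apply_eq_comp, InnerProductSpace.rankOne_apply, map_smul, hη y hy i, smul_zero]
  rfl

/-- By `sq_norm_le` and domination, $|\tau(x)|^2\le8\sum\|x\eta_i\|^2$. So $\tau(x)$ is a bounded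
functional of the tuple $(x\eta_i)$, and Hahn–Banach extends it to $H^n$. -/
theorem exists_functionals (h : IsTrace M η τ) :
    ∃ f : Fin n → H →L[ℂ] ℂ, ∀ x ∈ M, τ x = ∑ i, f i (x (η i)) := by
  let T : M.toStarSubalgebra.toSubmodule →ₗ[ℂ] (Fin n → H) :=
    LinearMap.pi fun i => (ContinuousLinearMap.apply ℂ H (η i) : (H →L[ℂ] H) →ₗ[ℂ] H) ∘ₗ
      M.toStarSubalgebra.toSubmodule.subtype
  let K := (LinearMap.range T).topologicalClosure
  let e : M.toStarSubalgebra.toSubmodule →ₗ[ℂ] K :=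
    T.codRestrict K fun x => Submodule.le_topologicalClosure _ ⟨x, rfl⟩
  have he : DenseRange e := by
    intro k
    rw [Metric.mem_closure_iff]
    intro ε hε
    have hk : (k : Fin n → H) ∈ closure ((LinearMap.range T : Submodule ℂ (Fin n → H)) :
        Set (Fin n → H)) := by
      rw [← Submodule.topologicalClosure_coe]; exact k.2
    obtain ⟨_, ⟨x, rfl⟩, hx⟩ := Metric.mem_closure_iff.1 hk ε hε
    exact ⟨e x, ⟨x, rfl⟩, hx⟩
  let g := τ ∘ₗ M.toStarSubalgebra.toSubmodule.subtype
  have hb : ∀ x, ‖g x‖ ≤ Real.sqrt (8 * n) * ‖e x‖ := by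
    intro x
    refine le_of_sq_le_sq ?_ (by positivity)
    rw [mul_pow, Real.sq_sqrt (by positivity)]
    calc ‖g x‖ ^ 2 ≤ 8 * ∑ i, ‖(x : H →L[ℂ] H) (η i)‖ ^ 2 := (h.sq_norm_le _).trans (h.le _ x.2)
      _ ≤ 8 * ∑ i : Fin n, ‖T x‖ ^ 2 := by
        refine mul_le_mul_of_nonneg_left (Finset.sum_le_sum fun i _ => ?_) (by norm_num)
        exact pow_le_pow_left₀ (norm_nonneg _) (norm_le_pi_norm (T x) i) 2
      _ = 8 * n * ‖e x‖ ^ 2 := by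
        rw [Finset.sum_const, Finset.card_univ, Fintype.card_fin, nsmul_eq_mul, mul_assoc]
        rfl
  obtain ⟨F, hF, -⟩ := exists_extension_norm_eq K (g.extendOfNorm e)
  refine ⟨fun i => F ∘L ContinuousLinearMap.single ℂ (fun _ => H) i, fun x hx => ?_⟩
  have h1 := hF (e ⟨x, hx⟩)
  rw [LinearMap.extendOfNorm_eq he ⟨_, hb⟩] at h1
  change F (T ⟨x, hx⟩) = τ x at h1
  rw [← h1]
  simp only [ContinuousLinearMap.comp_apply, ← map_sum]
  exact congrArg F (Finset.univ_sum_single fun i => x (η i)).symm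

theorem tendsto (h : IsTrace M η τ) {ι : Type*} {l : Filter ι} {x : ι → H →L[ℂ] H}
    {a : H →L[ℂ] H} (hx : ∀ i, x i ∈ M) (ha : a ∈ M) (hl : TendstoWeakly x l a) :
    Tendsto (fun i => τ (x i)) l (𝓝 (τ a)) := by
  obtain ⟨f, hf⟩ := h.exists_functionals
  simp only [hf _ (hx _), hf _ ha]
  exact tendsto_finsetSum _ fun i _ => hl (η i) (f i)

end IsTrace

end VonNeumannAlgebra

/-! ### Quasi-equivalence from intertwiners -/

section Intertwiners

open ContinuousLinearMap VonNeumannAlgebra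

variable {G H H₁ H₂ : Type*} [Group G]
  [NormedAddCommGroup H] [InnerProductSpace ℂ H] [CompleteSpace H]
  [NormedAddCommGroup H₁] [InnerProductSpace ℂ H₁] [CompleteSpace H₁]
  [NormedAddCommGroup H₂] [InnerProductSpace ℂ H₂] [CompleteSpace H₂]

theorem VonNeumannAlgebra.sqrt_mem {M : VonNeumannAlgebra H} {x : H →L[ℂ] H} (hx : x ∈ M) :
    CFC.sqrt x ∈ M := by
  refine mem_of_commute fun y hy => ?_
  by_cases h0 : 0 ≤ x
  · have h1 : Commute x y := mul_eq_of_mem_commutant hx hy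
    exact (h1.cfcₙ_nnreal _).symm
  · rw [CFC.sqrt, cfcₙ_apply_of_not_predicate _ h0, mul_zero, zero_mul]

namespace UnitaryRep

variable {π : UnitaryRep G H} {π₁ : UnitaryRep G H₁} {π₂ : UnitaryRep G H₂}

theorem star_apply (π : UnitaryRep G H) (g : G) : star (π g : H →L[ℂ] H) = π g⁻¹ := by
  rw [map_inv, ← Unitary.star_eq_inv]; rfl

theorem mem_commutant_vonNeumann {S : H →L[ℂ] H} (h : ∀ g, (π g : H →L[ℂ] H) * S = S * π g) :
    S ∈ π.vonNeumann.commutant := by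
  rw [mem_commutant_iff]
  intro x hx
  have hx' : x ∈ (π.vonNeumann : Set (H →L[ℂ] H)) := hx
  rw [coe_vonNeumann, Set.mem_centralizer_iff] at hx'
  refine (hx' S ?_).symm
  rw [Set.mem_centralizer_iff]
  rintro _ ⟨g, rfl⟩
  exact h g

/-- Bounded operators intertwining two unitary representations. -/
def IsIntertwiner (π₁ : UnitaryRep G H₁) (π₂ : UnitaryRep G H₂) (W : H₁ →L[ℂ] H₂) : Prop :=
  ∀ g, W ∘L (π₁ g : H₁ →L[ℂ] H₁) = (π₂ g : H₂ →L[ℂ] H₂) ∘L W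

namespace IsIntertwiner

variable {W V : H₁ →L[ℂ] H₂}

theorem apply_apply (hW : IsIntertwiner π₁ π₂ W) (g : G) (ξ : H₁) :
    W ((π₁ g : H₁ →L[ℂ] H₁) ξ) = (π₂ g : H₂ →L[ℂ] H₂) (W ξ) :=
  congrArg (fun z : H₁ →L[ℂ] H₂ => z ξ) (hW g)

theorem adjoint (hW : IsIntertwiner π₁ π₂ W) : IsIntertwiner π₂ π₁ (adjoint W) := by
  intro g
  have := congrArg ContinuousLinearMap.adjoint (hW g⁻¹)
  rw [adjoint_comp, adjoint_comp, ← star_eq_adjoint, ← star_eq_adjoint, star_apply, star_apply,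
    inv_inv] at this
  exact this.symm

theorem comp_of_mem_commutant (hW : IsIntertwiner π₁ π₂ W) {S : H₂ →L[ℂ] H₂}
    (hS : S ∈ π₂.vonNeumann.commutant) : IsIntertwiner π₁ π₂ (S ∘L W) := by
  intro g
  ext ξ
  simp only [ContinuousLinearMap.comp_apply, hW.apply_apply]
  exact (apply_of_mem_commutant (π₂.mem_vonNeumann g) hS _).symm

theorem adjoint_comp_mem (hW : IsIntertwiner π₁ π₂ W) (hV : IsIntertwiner π₁ π₂ V) :
    ContinuousLinearMap.adjoint W ∘L V ∈ π₁.vonNeumann.commutant :=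
  mem_commutant_vonNeumann fun g => by
    ext ξ
    simp only [mul_apply_eq_comp, ContinuousLinearMap.comp_apply, hV.apply_apply,
      hW.adjoint.apply_apply]

end IsIntertwiner

/-- If the ranges of the intertwiners are total, elements of `π₁(G)''` are carried to elements of
`π₂(G)''`. -/
theorem exists_intertwined (htot : ∀ ζ : H₂, (∀ W : H₁ →L[ℂ] H₂, IsIntertwiner π₁ π₂ W →
      adjoint W ζ = 0) → ζ = 0) {x : H₁ →L[ℂ] H₁} (hx : x ∈ π₁.vonNeumann) :
    ∃ y ∈ π₂.vonNeumann, ∀ W : H₁ →L[ℂ] H₂, IsIntertwiner π₁ π₂ W → y ∘L W = W ∘L x := by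
  let I := {W : H₁ →L[ℂ] H₂ // IsIntertwiner π₁ π₂ W}
  -- `F z` sends a finite family $(\xi_W)$ to $\sum W z\xi_W$. The operator sought is $F(1)c\mapsto
  -- F(x)c$, so a bound of $\|F(x)c\|$ by $\|F(1)c\|$ is needed.
  let F : (H₁ →L[ℂ] H₁) → (I →₀ H₁) →ₗ[ℂ] H₂ := fun z =>
    Finsupp.lsum ℂ fun W : I => ((W.1 ∘L z : H₁ →L[ℂ] H₂) : H₁ →ₗ[ℂ] H₂)
  have hF : ∀ z c, F z c = ∑ W ∈ c.support, W.1 (z (c W)) := fun z c => rfl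
  have hFs : ∀ z (W : I) ξ, F z (Finsupp.single W ξ) = W.1 (z ξ) := fun z W ξ => by
    simp only [F, Finsupp.lsum_single]; rfl
  have hdense : DenseRange (F 1) := by
    have h1 : (LinearMap.range (F 1)).topologicalClosure = ⊤ := by
      rw [Submodule.topologicalClosure_eq_top_iff, Submodule.eq_bot_iff]
      intro ζ hζ
      refine htot ζ fun W hW => ?_
      refine ext_inner_left ℂ fun ξ => ?_
      rw [adjoint_inner_right, inner_zero_right]
      exact (Submodule.mem_orthogonal _ _).1 hζ _ ⟨Finsupp.single ⟨W, hW⟩ ξ, hFs 1 ⟨W, hW⟩ ξ⟩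
    have h2 := congrArg (fun K : Submodule ℂ H₂ => (K : Set H₂)) h1
    simp only [Submodule.topologicalClosure_coe, Submodule.top_coe, LinearMap.coe_range] at h2
    exact dense_iff_closure_eq.2 h2
  -- The operators $W^*V$ lie in the commutant, so $\|F(z)c\|^2$ depends on `z` only through $z^*z$,
  -- and linearly.
  have hnorm : ∀ z ∈ π₁.vonNeumann, ∀ c, ((‖F z c‖ ^ 2 : ℝ) : ℂ) =
      ∑ W ∈ c.support, ∑ V ∈ c.support, inner ℂ ((star z * z) (c W))
        ((adjoint W.1 ∘L V.1) (c V)) := by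
    intro z hz c
    have h1 : ((‖F z c‖ ^ 2 : ℝ) : ℂ) = inner ℂ (F z c) (F z c) := by
      rw [inner_self_eq_norm_sq_to_K]; norm_cast
    rw [h1, hF, sum_inner]
    refine Finset.sum_congr rfl fun W _ => ?_
    rw [inner_sum]
    refine Finset.sum_congr rfl fun V _ => ?_
    rw [← adjoint_inner_right, mul_apply_eq_comp, star_eq_adjoint, adjoint_inner_left,
      apply_of_mem_commutant hz (W.2.adjoint_comp_mem V.2)]
    rfl
  have hb : ∀ c, ‖F x c‖ ≤ ‖x‖ * ‖F 1 c‖ := by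
    intro c
    have h0 : 0 ≤ ((‖x‖ ^ 2 : ℝ) : ℂ) • (1 : H₁ →L[ℂ] H₁) - star x * x := by
      have h1 := CStarAlgebra.star_mul_le_algebraMap_norm_sq (a := x)
      rw [Algebra.algebraMap_eq_smul_one] at h1
      rw [sub_nonneg]
      convert h1 using 1
      exact Complex.coe_smul _ _
    -- Writing $\|x\|^2-x^*x=b^*b$ with $b=\sqrt d$ in the algebra gives
    -- $\|F(x)c\|^2+\|F(b)c\|^2=\|x\|^2\|F(1)c\|^2$.
    set d := ((‖x‖ ^ 2 : ℝ) : ℂ) • (1 : H₁ →L[ℂ] H₁) - star x * x with hd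
    have hdM : d ∈ π₁.vonNeumann :=
      sub_mem (smul_mem _ (one_mem _)) (mul_mem (star_mem hx) hx)
    have hbb : star (CFC.sqrt d) * CFC.sqrt d = d := by
      rw [(CFC.sqrt_nonneg d).isSelfAdjoint.star_eq, CFC.sqrt_mul_sqrt_self d h0]
    have h3 : ((‖F x c‖ ^ 2 : ℝ) : ℂ) + ((‖F (CFC.sqrt d) c‖ ^ 2 : ℝ) : ℂ) =
        ((‖x‖ ^ 2 : ℝ) : ℂ) * ((‖F 1 c‖ ^ 2 : ℝ) : ℂ) := by
      rw [hnorm x hx, hnorm _ (sqrt_mem hdM), hnorm 1 (one_mem _), hbb, ← Finset.sum_add_distrib,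
        Finset.mul_sum]
      refine Finset.sum_congr rfl fun W _ => ?_
      rw [← Finset.sum_add_distrib, Finset.mul_sum]
      refine Finset.sum_congr rfl fun V _ => ?_
      rw [← inner_add_left, ← _root_.add_apply, hd, add_sub_cancel, star_one, one_mul,
        _root_.smul_apply, inner_smul_left, Complex.conj_ofReal]
    have h4 : ‖F x c‖ ^ 2 + ‖F (CFC.sqrt d) c‖ ^ 2 = ‖x‖ ^ 2 * ‖F 1 c‖ ^ 2 := by exact_mod_cast h3
    refine le_of_sq_le_sq ?_ (by positivity)
    rw [mul_pow, ← h4]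
    exact le_add_of_nonneg_right (by positivity)
  let y : H₂ →L[ℂ] H₂ := (F x).extendOfNorm (F 1)
  have hy : ∀ W : H₁ →L[ℂ] H₂, IsIntertwiner π₁ π₂ W → ∀ ξ, y (W ξ) = W (x ξ) := by
    intro W hW ξ
    have := LinearMap.extendOfNorm_eq hdense ⟨_, hb⟩ (Finsupp.single ⟨W, hW⟩ ξ)
    rw [hFs, hFs] at this
    exact this
  refine ⟨y, mem_of_commute fun S hS => ?_, fun W hW => ContinuousLinearMap.ext (hy W hW)⟩
  have hS' : ∀ c, (S * y) (F 1 c) = (y * S) (F 1 c) := by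
    intro c
    rw [hF]
    simp only [mul_apply_eq_comp, map_sum]
    refine Finset.sum_congr rfl fun W _ => ?_
    rw [hy W.1 W.2]
    exact (hy _ (W.2.comp_of_mem_commutant hS) _).symm
  exact ContinuousLinearMap.coeFn_injective
    (hdense.equalizer (S * y).continuous (y * S).continuous (funext hS'))

theorem eq_of_comp_intertwiner (htot : ∀ ζ : H₂, (∀ W : H₁ →L[ℂ] H₂, IsIntertwiner π₁ π₂ W →
      adjoint W ζ = 0) → ζ = 0) {z w : H₂ →L[ℂ] H}
    (h : ∀ W : H₁ →L[ℂ] H₂, IsIntertwiner π₁ π₂ W → z ∘L W = w ∘L W) : z = w := by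
  have : adjoint z = adjoint w := by
    ext ζ
    rw [← sub_eq_zero]
    refine htot _ fun W hW => ?_
    have := congrArg (fun v => adjoint v ζ) (h W hW)
    simp only [adjoint_comp, ContinuousLinearMap.comp_apply] at this
    rw [map_sub, this, sub_self]
  simpa using congrArg adjoint this

/-- Two representations whose intertwiners jointly separate points and whose adjoints do so as
well are quasi-equivalent. -/
theorem quasiEquivalent_of_intertwiners (htot : ∀ ζ : H₂, (∀ W : H₁ →L[ℂ] H₂,
      IsIntertwiner π₁ π₂ W → adjoint W ζ = 0) → ζ = 0)
    (hsep : ∀ ξ : H₁, (∀ W : H₁ →L[ℂ] H₂, IsIntertwiner π₁ π₂ W → W ξ = 0) → ξ = 0) :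
    π₁.QuasiEquivalent π₂ := by
  -- `R` is the graph of the isomorphism. Totality makes `y` unique, separation makes `x` unique,
  -- and compatibility with the operations can be checked on `R`.
  let R : (H₁ →L[ℂ] H₁) → (H₂ →L[ℂ] H₂) → Prop := fun x y =>
    ∀ W : H₁ →L[ℂ] H₂, IsIntertwiner π₁ π₂ W → y ∘L W = W ∘L x
  have huniq : ∀ x y y', R x y → R x y' → y = y' := fun x y y' h h' =>
    eq_of_comp_intertwiner htot fun W hW => (h W hW).trans (h' W hW).symm
  have huniq' : ∀ x x' y, R x y → R x' y → x = x' := fun x x' y h h' => by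
    ext ξ
    rw [← sub_eq_zero]
    refine hsep _ fun W hW => ?_
    have := congrArg (fun v : H₁ →L[ℂ] H₂ => v ξ) ((h W hW).symm.trans (h' W hW))
    simp only [ContinuousLinearMap.comp_apply] at this
    rw [map_sub, this, sub_self]
  have hex : ∀ x ∈ π₁.vonNeumann, ∃ y ∈ π₂.vonNeumann, R x y := fun x hx =>
    exists_intertwined htot hx
  have hex' : ∀ y ∈ π₂.vonNeumann, ∃ x ∈ π₁.vonNeumann, R x y := by
    intro y hy
    obtain ⟨x, hx, hxy⟩ := exists_intertwined (π₁ := π₂) (π₂ := π₁) (fun ξ h => hsep ξ fun W hW => by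
      have := h _ hW.adjoint
      rwa [adjoint_adjoint] at this) (star_mem hy)
    refine ⟨star x, star_mem hx, fun W hW => ?_⟩
    have := congrArg adjoint (hxy _ hW.adjoint)
    simp only [adjoint_comp, adjoint_adjoint, star_eq_adjoint] at this
    exact this.symm
  have hmul : ∀ x y x' y', R x y → R x' y' → R (x * x') (y * y') := fun x y x' y' h h' W hW => by
    calc (y * y') ∘L W = y ∘L (y' ∘L W) := rfl
      _ = (y ∘L W) ∘L x' := by rw [h' W hW]; rfl
      _ = W ∘L (x * x') := by rw [h W hW]; rfl
  have hadd : ∀ x y x' y', R x y → R x' y' → R (x + x') (y + y') := fun x y x' y' h h' W hW => by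
    rw [ContinuousLinearMap.add_comp, ContinuousLinearMap.comp_add, h W hW, h' W hW]
  have hsmul : ∀ (c : ℂ) x y, R x y → R (c • x) (c • y) := fun c x y h W hW => by
    rw [ContinuousLinearMap.smul_comp, ContinuousLinearMap.comp_smul, h W hW]
  have hstar : ∀ x ∈ π₁.vonNeumann, ∀ y, R x y → R (star x) (star y) := by
    intro x hx y h W hW
    -- Tested against an intertwiner `V`, this says that $W^*V$ commutes with `x`.
    have h1 : adjoint W ∘L y = x ∘L adjoint W := by
      refine eq_of_comp_intertwiner htot fun V hV => ?_
      rw [ContinuousLinearMap.comp_assoc, h V hV, ← ContinuousLinearMap.comp_assoc,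
        ContinuousLinearMap.comp_assoc]
      exact (mul_eq_of_mem_commutant hx (hW.adjoint_comp_mem hV)).symm
    have := congrArg adjoint h1
    simpa only [adjoint_comp, adjoint_adjoint, ← star_eq_adjoint] using this
  choose! φ hφM hφ using hex
  choose! ψ hψM hψ using hex'
  refine ⟨{ toFun := fun x => ⟨φ x, hφM x x.2⟩
            invFun := fun y => ⟨ψ y, hψM y y.2⟩
            left_inv := fun x => Subtype.ext ?_
            right_inv := fun y => Subtype.ext ?_
            map_mul' := fun x x' => Subtype.ext ?_
            map_add' := fun x x' => Subtype.ext ?_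
            map_star' := fun x => Subtype.ext ?_
            map_smul' := fun c x => Subtype.ext ?_ }, fun g => Subtype.ext ?_⟩
  · exact huniq' _ _ _ (hψ _ (hφM _ x.2)) (hφ _ x.2)
  · exact huniq _ _ _ (hφ _ (hψM _ y.2)) (hψ _ y.2)
  · exact huniq _ _ _ (hφ _ (x * x').2) (hmul _ _ _ _ (hφ _ x.2) (hφ _ x'.2))
  · exact huniq _ _ _ (hφ _ (x + x').2) (hadd _ _ _ _ (hφ _ x.2) (hφ _ x'.2))
  · exact huniq _ _ _ (hφ _ (star x).2) (hstar _ x.2 _ (hφ _ x.2))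
  · exact huniq _ _ _ (hφ _ (c • x).2) (hsmul c _ _ (hφ _ x.2))
  · exact huniq _ _ _ (hφ _ (π₁.mem_vonNeumann g)) fun W hW => (hW g).symm

end UnitaryRep

end Intertwiners

/-! ### A trace vanishing off the identity forces regularity -/

section RegularCriterion

open ContinuousLinearMap VonNeumannAlgebra

variable {G H : Type*} [Group G] [NormedAddCommGroup H] [InnerProductSpace ℂ H] [CompleteSpace H]

/-- The standard Hilbert basis of `ℓ²(G)`. -/
noncomputable def ellTwoBasis (G : Type*) [Group G] : HilbertBasis G ℂ (EllTwo G) :=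
  HilbertBasis.ofRepr (LinearIsometryEquiv.refl ℂ _)

theorem ellTwoBasis_apply (g k : G) [DecidableEq G] :
    (ellTwoBasis G g : G → ℂ) k = if k = g then 1 else 0 := by
  have h : lp.single 2 g (1 : ℂ) = ellTwoBasis G g := by
    rw [← HilbertBasis.repr_symm_single]; rfl
  rw [← h, lp.single_apply, Pi.single_apply]

theorem leftRegularRep_basis (g k : G) :
    (leftRegularRep G g : EllTwo G →L[ℂ] EllTwo G) (ellTwoBasis G k) = ellTwoBasis G (g * k) := by
  classical
  ext j
  rw [leftRegularRep_apply, ellTwoBasis_apply, ellTwoBasis_apply]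
  simp only [inv_mul_eq_iff_eq_mul]

namespace UnitaryRep

variable {π : UnitaryRep G H} {n : ℕ} {η : Fin n → H} {τ : (H →L[ℂ] H) →ₗ[ℂ] ℂ}

theorem trace_star_mul_self (hτ : IsTrace π.vonNeumann η τ)
    (h : ∀ g : G, g ≠ 1 → τ (π g : H →L[ℂ] H) = 0) (c : G →₀ ℂ) :
    τ (star (Finsupp.linearCombination ℂ (fun g => (π g : H →L[ℂ] H)) c) *
      Finsupp.linearCombination ℂ (fun g => (π g : H →L[ℂ] H)) c) =
      ((‖Finsupp.linearCombination ℂ (ellTwoBasis G) c‖ ^ 2 : ℝ) : ℂ) := by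
  classical
  have h1 : ((‖Finsupp.linearCombination ℂ (ellTwoBasis G) c‖ ^ 2 : ℝ) : ℂ) =
      inner ℂ (Finsupp.linearCombination ℂ (ellTwoBasis G) c)
        (Finsupp.linearCombination ℂ (ellTwoBasis G) c) := by
    rw [inner_self_eq_norm_sq_to_K]; norm_cast
  rw [h1, (ellTwoBasis G).orthonormal.inner_finsupp_eq_sum_left, Finsupp.linearCombination_apply,
    Finsupp.sum, Finsupp.sum, star_sum, Finset.sum_mul_sum, map_sum]
  refine Finset.sum_congr rfl fun g hg => ?_
  rw [map_sum, Finset.sum_eq_single g]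
  · rw [star_smul, smul_mul_smul_comm, map_smul, Unitary.coe_star_mul_self, hτ.map_one,
      smul_eq_mul, mul_one]
    rfl
  · intro k _ hkg
    have : star (π g : H →L[ℂ] H) * (π k : H →L[ℂ] H) = π (g⁻¹ * k) := by
      rw [star_apply, map_mul]; rfl
    rw [star_smul, smul_mul_smul_comm, map_smul, this,
      h _ (fun h' => hkg (inv_mul_eq_one.1 h').symm), smul_zero]
  · intro h'; exact absurd hg h'

/-- A factor representation whose trace vanishes off the identity is regular. -/
theorem isRegular_of_trace (hπ : π.IsFactorRep) (hτ : IsTrace π.vonNeumann η τ)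
    (h : ∀ g : G, g ≠ 1 → τ (π g : H →L[ℂ] H) = 0) : π.IsRegular := by
  let b := ellTwoBasis G
  let e : (G →₀ ℂ) →ₗ[ℂ] EllTwo G := Finsupp.linearCombination ℂ b
  let X : (G →₀ ℂ) →ₗ[ℂ] (H →L[ℂ] H) := Finsupp.linearCombination ℂ fun g => (π g : H →L[ℂ] H)
  have hX : ∀ c, X c ∈ π.vonNeumann := fun c => by
    simp only [X, Finsupp.linearCombination_apply, Finsupp.sum]
    exact sum_mem fun g _ => smul_mem _ (π.mem_vonNeumann g)
  let f : Fin n → (G →₀ ℂ) →ₗ[ℂ] H := fun i =>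
    (ContinuousLinearMap.apply ℂ H (η i) : (H →L[ℂ] H) →ₗ[ℂ] H) ∘ₗ X
  have hf : ∀ i c, f i c = X c (η i) := fun i c => rfl
  have hdense : DenseRange e := by
    have := congrArg (fun K : Submodule ℂ (EllTwo G) => (K : Set (EllTwo G))) b.dense_span
    simp only [Submodule.topologicalClosure_coe, Submodule.top_coe, ← Finsupp.range_linearCombination,
      LinearMap.coe_range] at this
    exact dense_iff_closure_eq.2 this
  have hbasis : Dense (Submodule.span ℂ (Set.range b) : Set (EllTwo G)) :=
    Submodule.dense_iff_topologicalClosure_eq_top.2 b.dense_span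
  have htr : ∀ c, (τ (star (X c) * X c)).re = ‖e c‖ ^ 2 := fun c => by
    rw [trace_star_mul_self hτ h c, Complex.ofReal_re]
  -- The trace norm of `X c` is the $\ell^2$-norm of `e c`. The two-sided comparison of `τ` with the
  -- vectors $\eta_i$ therefore makes $\delta_g\mapsto\pi(g)\eta_i$ bounded and, jointly in `i`,
  -- bounded below.
  have hbound : ∀ i c, ‖f i c‖ ≤ Real.sqrt 8 * ‖e c‖ := by
    intro i c
    refine le_of_sq_le_sq ?_ (by positivity)
    rw [mul_pow, Real.sq_sqrt (by norm_num), ← htr]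
    exact (Finset.single_le_sum (f := fun i => ‖X c (η i)‖ ^ 2) (fun i _ => by positivity)
      (Finset.mem_univ i)).trans (hτ.ge _ (hX c))
  let W : Fin n → EllTwo G →L[ℂ] H := fun i => (f i).extendOfNorm e
  have hW : ∀ i c, W i (e c) = f i c := fun i => LinearMap.extendOfNorm_eq hdense ⟨_, hbound i⟩
  have hWb : ∀ i g, W i (b g) = (π g : H →L[ℂ] H) (η i) := fun i g => by
    have := hW i (Finsupp.single g 1)
    rw [hf] at this
    simpa [e, X] using this
  have hWI : ∀ i, IsIntertwiner (leftRegularRep G) π (W i) := by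
    intro i g
    refine ContinuousLinearMap.ext_on hbasis ?_
    rintro _ ⟨k, rfl⟩
    simp only [ContinuousLinearMap.comp_apply]
    rw [leftRegularRep_basis, hWb, hWb, map_mul]
    rfl
  have hlow : ∀ ξ, ‖ξ‖ ^ 2 ≤ 8 * ∑ i, ‖W i ξ‖ ^ 2 := by
    intro ξ
    refine hdense.induction_on (p := fun ξ => ‖ξ‖ ^ 2 ≤ 8 * ∑ i, ‖W i ξ‖ ^ 2) ξ
      (isClosed_le (by fun_prop) (by fun_prop)) fun c => ?_
    rw [← htr]
    simp only [hW]
    exact hτ.le _ (hX c)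
  have hsep : ∀ ξ : EllTwo G, (∀ V : EllTwo G →L[ℂ] H, IsIntertwiner (leftRegularRep G) π V →
      V ξ = 0) → ξ = 0 := by
    intro ξ hξ
    have := hlow ξ
    simp only [hξ _ (hWI _), norm_zero] at this
    norm_num at this
    exact this
  have htot : ∀ ζ : H, (∀ V : EllTwo G →L[ℂ] H, IsIntertwiner (leftRegularRep G) π V →
      adjoint V ζ = 0) → ζ = 0 := by
    let K : Submodule ℂ H :=
      { carrier := {ζ | ∀ V : EllTwo G →L[ℂ] H, IsIntertwiner (leftRegularRep G) π V →
          adjoint V ζ = 0}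
        add_mem' := fun ha hb V hV => by rw [map_add, ha V hV, hb V hV, add_zero]
        zero_mem' := fun V _ => map_zero _
        smul_mem' := fun c a ha V hV => by rw [map_smul, ha V hV, smul_zero] }
    have hK : IsClosed (K : Set H) := by
      change IsClosed {ζ : H | ∀ V : EllTwo G →L[ℂ] H, IsIntertwiner (leftRegularRep G) π V →
          adjoint V ζ = 0}
      simp only [Set.ofPred_forall]
      exact isClosed_iInter fun V => isClosed_iInter fun _ =>
        isClosed_eq (adjoint V).continuous continuous_const
    -- `K` is $M$-invariant because $VV^*\in M'$, and $M'$-invariant because $S^*V$ intertwines for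
    -- $S\in M'$.
    have hbot : K = ⊥ ∨ K = ⊤ := by
      refine IsFactor.eq_bot_or_eq_top hπ K hK (fun y hy ζ hζ V hV => ?_) fun S hS ζ hζ V hV => ?_
      · have h1 : V ∘L adjoint V ∈ π.vonNeumann.commutant := by
          simpa using hV.adjoint.adjoint_comp_mem hV.adjoint
        have h2 : V (adjoint V (y ζ)) = 0 := by
          have := apply_of_mem_commutant hy h1 ζ
          simp only [ContinuousLinearMap.comp_apply] at this
          rw [← this, hζ V hV, map_zero, map_zero]
        rw [← inner_self_eq_zero (𝕜 := ℂ), adjoint_inner_left, h2, inner_zero_right]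
      · have := hζ _ (hV.comp_of_mem_commutant (star_mem hS))
        rw [adjoint_comp, star_eq_adjoint, adjoint_adjoint] at this
        exact this
    rcases hbot with hK' | hK'
    · intro ζ hζ
      have : ζ ∈ K := hζ
      rwa [hK', Submodule.mem_bot] at this
    · exfalso
      have h0 : ∀ i, W i = 0 := fun i => by
        have : adjoint (W i) = 0 := by
          ext1 ζ
          exact (hK' ▸ Submodule.mem_top : ζ ∈ K) (W i) (hWI i)
        simpa using congrArg adjoint this
      have := hlow (b 1)
      rw [b.orthonormal.1 1] at this
      simp [h0] at this
      linarith
  obtain ⟨φ, hφ⟩ := quasiEquivalent_of_intertwiners htot hsep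
  exact ⟨φ.symm, fun g => by rw [← hφ g]; exact φ.symm_apply_apply _⟩

end UnitaryRep

end RegularCriterion

/-! ### Commutation and disjoint families of translates -/

section Translates

variable {X G : Type*} [Group G] [MulAction G X] {Y : Set X}

/-- An element that is the identity on the support of another one commutes with it. -/
theorem commute_of_actionSupport_subset [FaithfulSMul G X] {s k : G}
    (h : actionSupport X k ⊆ MulAction.fixedBy X s) : Commute s k := by
  refine FaithfulSMul.eq_of_smul_eq_smul fun x : X => ?_
  rw [mul_smul, mul_smul]
  by_cases hx : k • x = x
  · rw [hx]
    by_contra hne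
    have h1 : s • s • x = s • x := h (show s • x ∈ actionSupport X k from fun h' => hne h'.symm)
    have h2 : s • x = x := smul_left_cancel s h1
    exact hne (by rw [h2, hx])
  · have h1 : s • x = x := h hx
    have h2 : s • k • x = k • x := h (show k • x ∈ actionSupport X k from
      fun h' => hx (smul_left_cancel k h'))
    rw [h1, h2]

theorem pairwise_disjoint_elim {z w : ℕ → G} {U V : Set X} (hUV : Disjoint U V)
    (hz : Pairwise fun i j => Disjoint (z i • Y) (z j • Y)) (hzU : ∀ i, z i • Y ⊆ U)
    (hw : Pairwise fun i j => Disjoint (w i • Y) (w j • Y)) (hwV : ∀ i, w i • Y ⊆ V) :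
    Pairwise fun i j => Disjoint ((Sum.elim z w) i • Y) ((Sum.elim z w) j • Y) := by
  rintro (i | i) (j | j) hij
  · exact hz fun h => hij (by rw [h])
  · exact hUV.mono (hzU i) (hwV j)
  · exact (hUV.mono (hzU j) (hwV i)).symm
  · exact hw fun h => hij (by rw [h])

theorem pairwise_disjoint_mul_left {z : ℕ → G}
    (hz : Pairwise fun i j => Disjoint (z i • Y) (z j • Y)) (g : G) :
    Pairwise fun i j => Disjoint ((g * z i) • Y) ((g * z j) • Y) := by
  intro i j hij
  simp only [mul_smul]
  exact Set.disjoint_smul_set.2 (hz hij)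

end Translates

/-! ### Disjoint translates in a Cantor space -/

section CantorDynamics

variable {X G : Type*} [TopologicalSpace X]

theorem IsCantorSpace.infinite_of_isOpen (hX : IsCantorSpace X) {U : Set X} (hU : IsOpen U)
    (hne : U.Nonempty) : U.Infinite := by
  obtain ⟨e⟩ := hX
  obtain ⟨x, hx⟩ := hne
  have hV : IsOpen (e.symm ⁻¹' U) := hU.preimage e.symm.continuous
  obtain ⟨I, u, hu, hIu⟩ := isOpen_pi_iff.1 hV (e x) (by simpa using hx)
  -- Flipping one coordinate outside the finite set `I` stays in the basic neighbourhood, and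
  -- different coordinates give different points.
  have hinj : Function.Injective fun n => e.symm (Function.update (e x) n (!e x n)) := by
    intro m n hmn
    by_contra hne
    have := congrFun (e.symm.injective hmn) m
    rw [Function.update_self, Function.update_of_ne hne] at this
    simp at this
  refine ((I.finite_toSet.infinite_compl).image hinj.injOn).mono ?_
  rintro _ ⟨n, hn, rfl⟩
  refine hIu fun i hi => ?_
  have hin : i ≠ n := fun h => hn (h ▸ hi)
  rw [Function.update_of_ne hin]
  exact (hu i hi).2

theorem IsCantorSpace.exists_isClopen (hX : IsCantorSpace X) {U : Set X} (hU : IsOpen U) {x : X}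
    (hx : x ∈ U) : ∃ V, IsClopen V ∧ x ∈ V ∧ V ⊆ U := by
  obtain ⟨e⟩ := hX
  have := e.symm.compactSpace
  have := e.symm.t2Space
  have := e.symm.totallyDisconnectedSpace
  exact compact_exists_isClopen_in_isOpen hU hx

variable [Group G] [MulAction G X] {Y : Set X}

theorem DenseTranslates.exists_seq (hY : DenseTranslates G Y) (hX : IsCantorSpace X) {U : Set X}
    (hU : IsOpen U) (hne : U.Nonempty) : ∃ z : ℕ → G, (∀ i, z i • Y ⊆ U) ∧
      Pairwise fun i j => Disjoint (z i • Y) (z j • Y) := by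
  have := hX.some.symm.t2Space
  have : Infinite U := (hX.infinite_of_isOpen hU hne).to_subtype
  obtain ⟨V, hVi, hVo, hVd⟩ := exists_seq_infinite_isOpen_pairwise_disjoint U
  have key : ∀ i, ∃ q : G, q • Y ⊆ Subtype.val '' V i := by
    intro i
    obtain ⟨x, hx⟩ := (hVi i).nonempty
    obtain ⟨W, hW, hxW, hWV⟩ := hX.exists_isClopen (hU.isOpenMap_subtype_val _ (hVo i))
      (Set.mem_image_of_mem _ hx)
    obtain ⟨q, hq⟩ := hY W hW ⟨_, hxW⟩
    exact ⟨q, hq.trans hWV⟩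
  choose z hz using key
  refine ⟨z, fun i => (hz i).trans (Subtype.coe_image_subset _ _), fun i j hij => ?_⟩
  exact ((Set.disjoint_image_iff Subtype.val_injective).2 (hVd hij)).mono (hz i) (hz j)

theorem exists_isClopen_disjoint_smul [ContinuousConstSMul G X] [FaithfulSMul G X]
    (hX : IsCantorSpace X) {g : G} (hg : g ≠ 1) :
    ∃ U : Set X, IsClopen U ∧ U.Nonempty ∧ Disjoint U (g • U) := by
  have := hX.some.symm.t2Space
  obtain ⟨x, hx⟩ : ∃ x : X, g • x ≠ x := by
    by_contra! h
    exact hg (FaithfulSMul.eq_of_smul_eq_smul fun x => by rw [h x, one_smul])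
  obtain ⟨V, W, hV, hW, hxV, hxW, hVW⟩ := t2_separation hx.symm
  obtain ⟨U, hU, hxU, hUV⟩ := hX.exists_isClopen (hV.inter (hW.preimage (continuous_const_smul g)))
    ⟨hxV, hxW⟩
  refine ⟨U, hU, ⟨x, hxU⟩, hVW.mono (hUV.trans Set.inter_subset_left) ?_⟩
  rintro _ ⟨y, hy, rfl⟩
  exact (hUV hy).2

end CantorDynamics

/-! ### Conjugates indexed by translates of `Y` -/

namespace UnitaryRep

open ContinuousLinearMap VonNeumannAlgebra

variable {X G H : Type*} [Group G] [MulAction G X]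
  [NormedAddCommGroup H] [InnerProductSpace ℂ H] [CompleteSpace H]

/-- Conjugation `b ↦ π(g) b π(g)*` on `B(H)`. -/
noncomputable def conj (π : UnitaryRep G H) : G →* ((H →L[ℂ] H) ≃⋆ₐ[ℂ] (H →L[ℂ] H)) :=
  (Unitary.conjStarAlgAut ℂ (H →L[ℂ] H)).comp π

variable (π : UnitaryRep G H)

theorem conj_apply (g : G) (b : H →L[ℂ] H) :
    π.conj g b = (π g : H →L[ℂ] H) * b * star (π g : H →L[ℂ] H) :=
  Unitary.conjStarAlgAut_apply _ _

theorem conj_conj (g k : G) (b : H →L[ℂ] H) : π.conj g (π.conj k b) = π.conj (g * k) b := by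
  rw [map_mul]; rfl

theorem norm_conj (g : G) (b : H →L[ℂ] H) : ‖π.conj g b‖ = ‖b‖ := by
  rw [conj_apply, ← Unitary.coe_star, CStarRing.norm_mul_coe_unitary,
    CStarRing.norm_coe_unitary_mul]

theorem conj_star (g : G) (b : H →L[ℂ] H) : π.conj g (star b) = star (π.conj g b) := by
  simp only [conj_apply, star_mul, star_star, mul_assoc]

theorem conj_eq_self_iff {g : G} {b : H →L[ℂ] H} :
    π.conj g b = b ↔ (π g : H →L[ℂ] H) * b = b * π g := by
  rw [conj_apply]
  constructor
  · intro h
    conv_rhs => rw [← h]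
    rw [mul_assoc _ (star _), Unitary.coe_star_mul_self, mul_one]
  · intro h
    rw [h, mul_assoc, Unitary.mul_star_self_of_mem (π g).2, mul_one]

theorem conj_mem {b : H →L[ℂ] H} (hb : b ∈ π.vonNeumann) (g : G) : π.conj g b ∈ π.vonNeumann := by
  rw [conj_apply]
  exact mul_mem (mul_mem (π.mem_vonNeumann g) hb) (star_mem (π.mem_vonNeumann g))

theorem _root_.TendstoWeakly.conj {ι : Type*} {l : Filter ι} {x : ι → H →L[ℂ] H} {a : H →L[ℂ] H}
    (h : TendstoWeakly x l a) (g : G) :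
    TendstoWeakly (fun i => π.conj g (x i)) l (π.conj g a) := by
  simp only [conj_apply]
  exact (h.const_mul _).mul_const _

variable {π}

theorem _root_.VonNeumannAlgebra.IsTrace.conj {n : ℕ} {η : Fin n → H}
    {τ : (H →L[ℂ] H) →ₗ[ℂ] ℂ} (hτ : IsTrace π.vonNeumann η τ) {b : H →L[ℂ] H}
    (hb : b ∈ π.vonNeumann) (g : G) : τ (π.conj g b) = τ b := by
  rw [conj_apply, hτ.comm _ (mul_mem (π.mem_vonNeumann g) hb) _ (star_mem (π.mem_vonNeumann g)),
    ← mul_assoc, Unitary.coe_star_mul_self, one_mul]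

variable (π) in
/-- The elements of `π(G)''` that commute with `π(s)` for every `s` fixing `Y` pointwise. -/
def stabilized (Y : Set X) : Set (H →L[ℂ] H) :=
  {b | b ∈ π.vonNeumann ∧ ∀ s : G, (∀ y ∈ Y, s • y = y) → π.conj s b = b}

section Stabilized

variable {Y : Set X} {b b' : H →L[ℂ] H}

theorem star_mem_stabilized (hb : b ∈ π.stabilized Y) : star b ∈ π.stabilized Y :=
  ⟨star_mem hb.1, fun s hs => by rw [conj_star, hb.2 s hs]⟩

theorem mul_mem_stabilized (hb : b ∈ π.stabilized Y) (hb' : b' ∈ π.stabilized Y) :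
    b * b' ∈ π.stabilized Y :=
  ⟨mul_mem hb.1 hb'.1, fun s hs => by rw [map_mul, hb.2 s hs, hb'.2 s hs]⟩

theorem sub_smul_one_mem_stabilized (hb : b ∈ π.stabilized Y) (c : ℂ) :
    b - c • 1 ∈ π.stabilized Y :=
  ⟨sub_mem hb.1 (smul_mem _ (one_mem _)), fun s hs => by
    rw [map_sub, map_smul, map_one, hb.2 s hs]⟩

/-- The conjugate of a stabilized element depends only on the corresponding translate of `Y`. -/
theorem conj_eq_conj (hY : ∀ x : X, (Y ∩ MulAction.orbit G x).Subsingleton)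
    (hb : b ∈ π.stabilized Y) {q q' : G} (h : q • Y = q' • Y) : π.conj q b = π.conj q' b := by
  -- Both `y` and $q^{-1}q'y$ lie in `Y` and in one orbit, so they coincide; thus $q^{-1}q'$ fixes
  -- `Y` pointwise.
  have hs : ∀ y ∈ Y, (q⁻¹ * q') • y = y := by
    intro y hy
    have h1 : q' • y ∈ q • Y := h ▸ Set.smul_mem_smul_set hy
    rw [Set.mem_smul_set_iff_inv_smul_mem, ← mul_smul] at h1
    exact hY y ⟨h1, MulAction.mem_orbit y _⟩ ⟨hy, MulAction.mem_orbit_self y⟩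
  calc π.conj q b = π.conj q (π.conj (q⁻¹ * q') b) := by rw [hb.2 _ hs]
    _ = π.conj q' b := by rw [conj_conj, mul_inv_cancel_left]

/-- Conjugates along disjoint translates of `Y` are exchangeable. -/
theorem exists_conj_conj_eq (hYne : Y.Nonempty)
    (hY : ∀ x : X, (Y ∩ MulAction.orbit G x).Subsingleton) {n : ℕ}
    (hYn : TransitiveOnDisjointTranslates G Y n) {ι : Type*} {r : ι → G}
    (hr : Pairwise fun i j => Disjoint (r i • Y) (r j • Y)) {u v : Fin n → ι}
    (hu : Function.Injective u) (hv : Function.Injective v) :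
    ∃ g : G, ∀ i, ∀ b ∈ π.stabilized Y,
      π.conj g (π.conj (r (u i)) b) = π.conj (r (v i)) b := by
  have hinj : Function.Injective fun i => r i • Y := by
    intro i j hij
    by_contra hne
    have h1 : Disjoint (r i • Y) (r j • Y) := hr hne
    have h2 : r i • Y = r j • Y := hij
    rw [h2, disjoint_self] at h1
    exact hYne.smul_set.ne_empty h1
  obtain ⟨g, hg⟩ := hYn (Set.range fun i => r i • Y) (by rintro _ ⟨i, rfl⟩; exact ⟨r i, rfl⟩)
    (by
      rintro _ ⟨i, rfl⟩ _ ⟨j, rfl⟩ hij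
      exact hr fun h => hij (by rw [h]))
    (fun i => r (u i) • Y) (fun i => r (v i) • Y) (hinj.comp hu) (hinj.comp hv)
    (fun i => ⟨u i, rfl⟩) (fun i => ⟨v i, rfl⟩)
  refine ⟨g, fun i b hb => ?_⟩
  rw [conj_conj]
  exact conj_eq_conj hY hb (by rw [mul_smul]; exact hg i)

end Stabilized

end UnitaryRep

namespace VonNeumannAlgebra

variable {H : Type*} [NormedAddCommGroup H] [InnerProductSpace ℂ H] [CompleteSpace H]
  {M : VonNeumannAlgebra H} {n : ℕ} {η : Fin n → H} {τ : (H →L[ℂ] H) →ₗ[ℂ] ℂ}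

/-- A weak limit of a sequence that is orthogonal for the trace vanishes. -/
theorem IsTrace.eq_zero_of_orthogonal (hτ : IsTrace M η τ) (hM : M.IsFactor) {l : Filter ℕ}
    [l.NeBot] (hl : l ≤ cofinite) {x : ℕ → H →L[ℂ] H} {a : H →L[ℂ] H} (hx : ∀ i, x i ∈ M)
    (ha : TendstoWeakly x l a) (h0 : ∀ i j, i ≠ j → τ (star (x j) * x i) = 0) : a = 0 := by
  have haM : a ∈ M := ha.mem hx
  -- $\tau(a^*x_i)=\lim_j\tau(x_j^*x_i)$, and `j` eventually differs from `i`. Letting $i$ vary next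
  -- gives $\tau(a^*a)=0$.
  have h1 : ∀ i, τ (star a * x i) = 0 := by
    intro i
    refine tendsto_nhds_unique (hτ.tendsto (fun j => mul_mem (star_mem (hx j)) (hx i))
      (mul_mem (star_mem haM) (hx i)) (ha.star.mul_const (x i))) ?_
    refine tendsto_const_nhds.congr' ?_
    filter_upwards [hl (Set.finite_singleton i).compl_mem_cofinite] with j hj
    exact (h0 i j fun h => hj h.symm).symm
  refine hτ.eq_zero hM haM (tendsto_nhds_unique (hτ.tendsto
    (fun i => mul_mem (star_mem haM) (hx i)) (mul_mem (star_mem haM) haM) (ha.const_mul (star a))) ?_)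
  simp only [h1]
  exact tendsto_const_nhds

end VonNeumannAlgebra

/-! ### Exchangeability and scalar weak limits -/

section WeakLimitsOfConjugates

open VonNeumannAlgebra UnitaryRep

variable {X G H : Type*} [Group G] [MulAction G X]
  [NormedAddCommGroup H] [InnerProductSpace ℂ H] [CompleteSpace H]
  {π : UnitaryRep G H} {n : ℕ} {η : Fin n → H} {τ : (H →L[ℂ] H) →ₗ[ℂ] ℂ}
  {Y : Set X} {b : H →L[ℂ] H}

theorem trace_star_mul_conj_eq (hτ : IsTrace π.vonNeumann η τ) (hYne : Y.Nonempty)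
    (hY : ∀ x : X, (Y ∩ MulAction.orbit G x).Subsingleton)
    (hY2 : TransitiveOnDisjointTranslates G Y 2) (hb : b ∈ π.stabilized Y) {ι : Type*} {r : ι → G}
    (hr : Pairwise fun i j => Disjoint (r i • Y) (r j • Y)) {i j k m : ι} (hij : i ≠ j)
    (hkm : k ≠ m) : τ (star (π.conj (r i) b) * π.conj (r j) b) =
      τ (star (π.conj (r k) b) * π.conj (r m) b) := by
  obtain ⟨g, hg⟩ := exists_conj_conj_eq (π := π) hYne hY hY2 hr (u := ![i, j]) (v := ![k, m])
    (by simpa [Function.Injective, Fin.forall_fin_two, hij.symm] using hij)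
    (by simpa [Function.Injective, Fin.forall_fin_two, hkm.symm] using hkm)
  have h0 := hg 0 b hb
  have h1 := hg 1 b hb
  simp only [Matrix.cons_val_zero, Matrix.cons_val_one] at h0 h1
  rw [← h0, ← h1, ← conj_star π g, ← map_mul, hτ.conj]
  exact mul_mem (star_mem (π.conj_mem hb.1 _)) (π.conj_mem hb.1 _)

/-- Conjugates along two disjoint sequences of translates have the same weak limits. -/
theorem tendstoWeakly_conj_of_disjoint (hτ : IsTrace π.vonNeumann η τ) (hπ : π.IsFactorRep)
    (hYne : Y.Nonempty) (hY : ∀ x : X, (Y ∩ MulAction.orbit G x).Subsingleton)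
    (hY2 : TransitiveOnDisjointTranslates G Y 2) (hb : b ∈ π.stabilized Y) {z w : ℕ → G}
    (hr : Pairwise fun i j => Disjoint ((Sum.elim z w) i • Y) ((Sum.elim z w) j • Y))
    {l : Ultrafilter ℕ} (hl : (l : Filter ℕ) ≤ cofinite) {B : H →L[ℂ] H}
    (hB : TendstoWeakly (fun i => π.conj (z i) b) l B) :
    TendstoWeakly (fun i => π.conj (w i) b) l B := by
  obtain ⟨C, hC⟩ := l.exists_tendstoWeakly (x := fun i => π.conj (w i) b) (C := ‖b‖)
    fun i => (π.norm_conj _ _).le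
  -- The differences $z_i.b-w_i.b$ are orthogonal for `τ`: in their inner products the four terms
  -- involve distinct translates, so they are equal and cancel.
  have h0 := hτ.eq_zero_of_orthogonal hπ hl
    (fun i => sub_mem (π.conj_mem hb.1 (z i)) (π.conj_mem hb.1 (w i))) (hB.sub hC) ?_
  · rwa [sub_eq_zero.1 h0]
  intro i j hij
  have key := fun {p q p' q' : ℕ ⊕ ℕ} (h : p ≠ q) (h' : p' ≠ q') =>
    trace_star_mul_conj_eq hτ hYne hY hY2 hb hr h h'
  have h1 := key (p := .inl j) (q := .inl i) (p' := .inl j) (q' := .inr i)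
    (by simpa using hij.symm) (by simp)
  have h2 := key (p := .inr j) (q := .inl i) (p' := .inr j) (q' := .inr i)
    (by simp) (by simpa using hij.symm)
  simp only [Sum.elim_inl, Sum.elim_inr] at h1 h2
  rw [star_sub, sub_mul, mul_sub, mul_sub, map_sub, map_sub, map_sub, h1, h2]
  ring

/-- Conjugates along disjoint translates inside a proper clopen set tend to a scalar. -/
theorem tendstoWeakly_conj_scalar [TopologicalSpace X] [ContinuousConstSMul G X] (hX : IsCantorSpace X)
    (hτ : IsTrace π.vonNeumann η τ) (hπ : π.IsFactorRep)
    (hYne : Y.Nonempty) (hY : ∀ x : X, (Y ∩ MulAction.orbit G x).Subsingleton)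
    (hYd : DenseTranslates G Y)
    (hY2 : TransitiveOnDisjointTranslates G Y 2) (hb : b ∈ π.stabilized Y) {U : Set X}
    (hU : IsClopen U) (hUne : U.Nonempty) (hUne' : Uᶜ.Nonempty) {z : ℕ → G}
    (hz : Pairwise fun i j => Disjoint (z i • Y) (z j • Y)) (hzU : ∀ i, z i • Y ⊆ U)
    {l : Ultrafilter ℕ} (hl : (l : Filter ℕ) ≤ cofinite) :
    TendstoWeakly (fun i => π.conj (z i) b) l (τ b • (1 : H →L[ℂ] H)) := by
  obtain ⟨B, hB⟩ := l.exists_tendstoWeakly (x := fun i => π.conj (z i) b) (C := ‖b‖)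
    fun i => (π.norm_conj _ _).le
  have hUc : ∀ w : ℕ → G, (Pairwise fun i j => Disjoint (w i • Y) (w j • Y)) →
      (∀ i, w i • Y ⊆ Uᶜ) → TendstoWeakly (fun i => π.conj (w i) b) l B := fun w hw hwU =>
    tendstoWeakly_conj_of_disjoint hτ hπ hYne hY hY2 hb
      (pairwise_disjoint_elim disjoint_compl_right hz hzU hw hwU) hl hB
  obtain ⟨w, hwU, hw⟩ := hYd.exists_seq hX hU.compl.isOpen hUne'
  have hUU : ∀ v : ℕ → G, (Pairwise fun i j => Disjoint (v i • Y) (v j • Y)) →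
      (∀ i, v i • Y ⊆ U) → TendstoWeakly (fun i => π.conj (v i) b) l B := fun v hv hvU =>
    tendstoWeakly_conj_of_disjoint hτ hπ hYne hY hY2 hb
      (pairwise_disjoint_elim disjoint_compl_left hw hwU hv hvU) hl (hUc w hw hwU)
  -- All disjoint sequences in `U`, and all those in its complement, share the limit `B`. A small
  -- open `V` in `U` is carried by `g` into one of the two sides, so `g` takes one such sequence to
  -- another and preserves `B`.
  have hinv : ∀ g : G, π.conj g B = B := by
    intro g
    obtain ⟨V, hV, hVne, hVU, hgV⟩ : ∃ V : Set X, IsOpen V ∧ V.Nonempty ∧ V ⊆ U ∧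
        (g • V ⊆ U ∨ g • V ⊆ Uᶜ) := by
      by_cases h : (U ∩ (g • ·) ⁻¹' U).Nonempty
      · refine ⟨_, hU.isOpen.inter (hU.isOpen.preimage (continuous_const_smul g)), h,
          Set.inter_subset_left, Or.inl ?_⟩
        rintro _ ⟨y, hy, rfl⟩
        exact hy.2
      · refine ⟨U, hU.isOpen, hUne, subset_rfl, Or.inr ?_⟩
        rintro _ ⟨y, hy, rfl⟩ hgy
        exact h ⟨y, hy, hgy⟩
    obtain ⟨v, hvV, hv⟩ := hYd.exists_seq hX hV hVne
    have hgv := pairwise_disjoint_mul_left hv g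
    have hgvV : ∀ i, (g * v i) • Y ⊆ g • V := fun i => by
      rw [mul_smul]; exact Set.smul_set_mono (hvV i)
    have h1 : TendstoWeakly (fun i => π.conj (g * v i) b) l B := by
      rcases hgV with h | h
      · exact hUU _ hgv fun i => (hgvV i).trans h
      · exact hUc _ hgv fun i => (hgvV i).trans h
    refine TendstoWeakly.unique ((hUU v hv fun i => (hvV i).trans hVU).conj π g) ?_
    simpa only [conj_conj] using h1
  have hBM : B ∈ π.vonNeumann := hB.mem fun i => π.conj_mem hb.1 (z i)
  have hBM' : B ∈ π.vonNeumann.commutant :=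
    mem_commutant_vonNeumann fun g => π.conj_eq_self_iff.1 (hinv g)
  obtain ⟨c, hc⟩ := hπ.subset ⟨hBM, hBM'⟩
  have hc' : c • (1 : H →L[ℂ] H) = B := hc
  have hτB : τ b = τ B := by
    have h1 := hτ.tendsto (fun i => π.conj_mem hb.1 (z i)) hBM hB
    simp only [hτ.conj hb.1] at h1
    exact tendsto_nhds_unique tendsto_const_nhds h1
  have hτc : τ B = c := by rw [← hc', map_smul, hτ.map_one, smul_eq_mul, mul_one]
  rwa [hτB, hτc, hc']

/-- If the trace does not vanish off the identity, the stabilized elements are scalars. -/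
theorem eq_smul_one_of_mem_stabilized [TopologicalSpace X] [ContinuousConstSMul G X]
    [FaithfulSMul G X]
    (hX : IsCantorSpace X) (hτ : IsTrace π.vonNeumann η τ) (hπ : π.IsFactorRep)
    (hYne : Y.Nonempty) (hY : ∀ x : X, (Y ∩ MulAction.orbit G x).Subsingleton)
    (hYd : DenseTranslates G Y) (hY2 : TransitiveOnDisjointTranslates G Y 2)
    (hY4 : TransitiveOnDisjointTranslates G Y 4) {g : G} (hg : g ≠ 1)
    (hτg : τ (π g : H →L[ℂ] H) ≠ 0) {a : H →L[ℂ] H} (ha : a ∈ π.stabilized Y) :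
    a = τ a • (1 : H →L[ℂ] H) := by
  let t : H →L[ℂ] H := a - τ a • 1
  have ht : t ∈ π.stabilized Y := sub_smul_one_mem_stabilized ha _
  have hτt : τ t = 0 := by
    simp only [t, map_sub, map_smul, hτ.map_one, smul_eq_mul, mul_one, sub_self]
  obtain ⟨U, hU, hUne, hgU⟩ := exists_isClopen_disjoint_smul hX hg
  obtain ⟨z, hzU, hz⟩ := hYd.exists_seq hX hU.isOpen hUne
  have hUne' : Uᶜ.Nonempty := (hUne.smul_set (a := g)).mono
    (Set.disjoint_left.1 hgU.symm)
  have hgz := pairwise_disjoint_mul_left hz g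
  have hgzU : ∀ i, (g * z i) • Y ⊆ g • U := fun i => by
    rw [mul_smul]; exact Set.smul_set_mono (hzU i)
  have hr := pairwise_disjoint_elim hgU hz hzU hgz hgzU
  let l := hyperfilter ℕ
  have hl : (l : Filter ℕ) ≤ cofinite := hyperfilter_le_cofinite
  have hmem : ∀ q, π.conj q t ∈ π.vonNeumann := π.conj_mem ht.1
  have hscalar : ∀ b ∈ π.stabilized Y,
      TendstoWeakly (fun i => π.conj (z i) b) l (τ b • (1 : H →L[ℂ] H)) := fun b hb =>
    tendstoWeakly_conj_scalar hX hτ hπ hYne hY hYd hY2 hb hU hUne hUne' hz hzU hl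
  -- the products of conjugates along two disjoint translates tend to zero
  obtain ⟨E, hE⟩ := l.exists_tendstoWeakly
    (x := fun i => star (π.conj (z i) t) * π.conj (g * z i) t) (C := ‖t‖ * ‖t‖) fun i => by
      refine (norm_mul_le _ _).trans ?_
      rw [norm_star, norm_conj, norm_conj]
  have hxM : ∀ i, star (π.conj (z i) t) * π.conj (g * z i) t ∈ π.vonNeumann := fun i =>
    mul_mem (star_mem (hmem _)) (hmem _)
  have hE0 : E = 0 := by
    refine hτ.eq_zero_of_orthogonal hπ hl hxM hE fun i j hij => ?_
    -- `y` collects the three factors other than $gz_i.t$ in the inner product of the `j`-th and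
    -- `i`-th products.
    let y := star (star (π.conj (z j) t) * π.conj (g * z j) t) * star (π.conj (z i) t)
    have hy : y ∈ π.vonNeumann := mul_mem (star_mem (hxM j)) (star_mem (hmem _))
    have h1 : ∀ k, k ≠ i → k ≠ j →
        τ (y * π.conj (z k) t) =
          τ (star (star (π.conj (z j) t) * π.conj (g * z j) t) *
            (star (π.conj (z i) t) * π.conj (g * z i) t)) := by
      intro k hki hkj
      -- 4-transitivity: keep the translates $gz_jY$, $z_jY$, $z_iY$ in place and move $gz_iY$ to
      -- $z_kY$. As $k$ grows, $z_k.t\to\tau(t)\mathrm{Id}=0$, so the inner product is zero.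
      obtain ⟨k', hk'⟩ := exists_conj_conj_eq (π := π) hYne hY hY4 hr
        (u := ![.inr j, .inl j, .inl i, .inr i]) (v := ![.inr j, .inl j, .inl i, .inl k])
        (by
          intro p q hpq
          fin_cases p <;> fin_cases q <;> simp_all [eq_comm])
        (by
          intro p q hpq
          fin_cases p <;> fin_cases q <;> simp_all [eq_comm])
      have e0 := hk' 0 t ht
      have e1 := hk' 1 t ht
      have e2 := hk' 2 t ht
      have e3 := hk' 3 t ht
      simp only [Matrix.cons_val, Sum.elim_inl, Sum.elim_inr] at e0 e1 e2 e3
      rw [← hτ.conj (mul_mem (star_mem (hxM j)) (hxM i)) k']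
      simp only [y, map_mul (π.conj k'), star_mul, star_star, conj_star, e0, e1, e2, e3, mul_assoc]
    have h2 := hτ.tendsto (fun k => mul_mem hy (hmem (z k)))
      (mul_mem hy (smul_mem _ (one_mem _))) ((hscalar t ht).const_mul y)
    rw [hτt, zero_smul, mul_zero, map_zero] at h2
    refine tendsto_nhds_unique (tendsto_const_nhds.congr' ?_) h2
    filter_upwards [hl (Set.finite_singleton i).compl_mem_cofinite,
      hl (Set.finite_singleton j).compl_mem_cofinite] with k hki hkj
    exact (h1 k hki hkj).symm
  have htt : t * star t ∈ π.stabilized Y := mul_mem_stabilized ht (star_mem_stabilized ht)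
  have hgM := π.mem_vonNeumann g
  have h1 := hτ.tendsto (fun i => mul_mem hgM (π.conj_mem htt.1 (z i)))
    (mul_mem hgM (smul_mem _ (one_mem _))) ((hscalar _ htt).const_mul (π g : H →L[ℂ] H))
  have h2 := hτ.tendsto (fun i => mul_mem hgM (hxM i))
    (mul_mem hgM (hE.mem hxM)) (hE.const_mul (π g : H →L[ℂ] H))
  have h3 : ∀ i, τ ((π g : H →L[ℂ] H) * π.conj (z i) (t * star t)) =
      τ ((π g : H →L[ℂ] H) * (star (π.conj (z i) t) * π.conj (g * z i) t)) := by
    intro i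
    have h4 : π.conj (g * z i) t * (π g : H →L[ℂ] H) = (π g : H →L[ℂ] H) * π.conj (z i) t := by
      rw [← conj_conj, conj_apply π g, mul_assoc, Unitary.coe_star_mul_self, mul_one]
    rw [← mul_assoc, hτ.comm _ (mul_mem hgM (star_mem (hmem _))) _ (hmem _), ← mul_assoc, h4,
      map_mul (π.conj (z i)), conj_star, mul_assoc]
  simp only [h3] at h1
  have h5 := tendsto_nhds_unique h1 h2
  rw [hE0, mul_zero, map_zero, mul_smul_comm, mul_one, map_smul, smul_eq_mul] at h5
  have h6 : τ (star t * t) = 0 := by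
    rw [hτ.comm _ (star_mem ht.1) _ ht.1]
    exact (mul_eq_zero.1 h5).resolve_right hτg
  exact sub_eq_zero.1 (hτ.eq_zero hπ ht.1 h6)

end WeakLimitsOfConjugates

theorem mainTheorem5 {X G H : Type*}
    [TopologicalSpace X] (hX : IsCantorSpace X)
    [Group G] [Countable G] [MulAction G X] [ContinuousConstSMul G X] [FaithfulSMul G X]
    (hFix : ∀ g : G, IsClopen (MulAction.fixedBy X g))
    (Y : Set X) (hYne : Y.Nonempty) (hYclosed : IsClosed Y)
    (hYorbit : ∀ x : X, (Y ∩ MulAction.orbit G x).Subsingleton)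
    (hYdense : DenseTranslates G Y)
    (hYtrans : ∀ n : ℕ, 1 ≤ n → TransitiveOnDisjointTranslates G Y n)
    (h : ℕ → G)
    (hTriv : ∀ n : ℕ, ∀ y ∈ Y, h n • y = y)
    (hSupp : ∀ U : Set X, IsClopen U → Y ⊆ U →
      ∃ N : ℕ, ∀ n ≥ N, actionSupport X (h n) ⊆ U)
    [NormedAddCommGroup H] [InnerProductSpace ℂ H] [CompleteSpace H]
    [TopologicalSpace.SeparableSpace H]
    (π : UnitaryRep G H) (hπfinite : π.IsFiniteType) (hπfactor : π.IsFactorRep)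
    (hπreg : ¬ π.IsRegular)
    (A : H →L[ℂ] H)
    (hA : MapClusterPt (ContinuousLinearMapWOT.ofCLM A : H →WOT[ℂ] H) atTop
      (fun n : ℕ => (ContinuousLinearMapWOT.ofCLM (π (h n) : H →L[ℂ] H) : H →WOT[ℂ] H))) :
    ∃ c : ℂ, A = c • (1 : H →L[ℂ] H) := by
  rcases subsingleton_or_nontrivial H with hH | hH
  · exact ⟨0, ContinuousLinearMap.ext fun ξ => Subsingleton.elim _ _⟩
  obtain ⟨n, η, τ, hτ⟩ := VonNeumannAlgebra.IsFinite.exists_trace hπfinite hπfactor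
  obtain ⟨g, hg, hτg⟩ : ∃ g : G, g ≠ 1 ∧ τ (π g : H →L[ℂ] H) ≠ 0 := by
    by_contra! hcon
    exact hπreg (UnitaryRep.isRegular_of_trace hπfactor hτ hcon)
  obtain ⟨l, hl, hlA⟩ := mapClusterPt_iff_ultrafilter.1 hA
  have hA' : TendstoWeakly (fun n => (π (h n) : H →L[ℂ] H)) l A := tendstoWeakly_iff.2 hlA
  refine ⟨τ A, eq_smul_one_of_mem_stabilized hX hτ hπfactor hYne hYorbit hYdense
    (hYtrans 2 (by norm_num)) (hYtrans 4 (by norm_num)) hg hτg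
    ⟨hA'.mem fun n => π.mem_vonNeumann (h n), fun s hs => ?_⟩⟩
  obtain ⟨N, hN⟩ := hSupp _ (hFix s) hs
  refine TendstoWeakly.unique (hA'.conj π s) (hA'.congr' ?_)
  filter_upwards [hl (eventually_ge_atTop N)] with n hn
  refine (π.conj_eq_self_iff.2 ?_).symm
  have := congrArg (fun k => (π k : H →L[ℂ] H)) (commute_of_actionSupport_subset (hN n hn)).eq
  simpa only [map_mul, Submonoid.coe_mul] using this
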